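/- **Conventions.** $\log$ is base $2$, $[k]=\{1,\dots,k\}$, and $\Lambda=\lceil 2\log(n/\varepsilon)\rceil$ with $0<\varepsilon\le 1$. Besides the variables in $[n]$ there is a placeholder variable $n+1$. For $x\in\{0,1\}^n$ and $S\subseteq[n+1]$, $x^{(S)}$ is $x$ with the coordinates in $S\cap[n]$ flipped, and $x^{(i)}=x^{(\{i\})}$. For $f:\{0,1\}^n\to\{0,1\}$, an edge $(x,x^{(i)})$ is bichromatic along $i\in[n]$ if $f(x)\ne f(x^{(i)})$; it is then monotone if $x_i=f(x)$ and anti-monotone if $x_i\neq f(x)$. An *edge violation to unateness* is a pair of edges along the same variable, one monotone and one anti-monotone. $\mathrm{Inf}_f[i]=\Pr_x[f(x)\ne f(x^{(i)})]$ for uniform $x$. **Persistency.** A point $x$ is $S$-persistent if for both $k=\lfloor |S|/2\rfloor$ and $k=\lfloor |S|/2\rfloor+1$, a uniformly random $T\subseteq S$ with $|T|=k$ has $f(x)=f(x^{(T)})$ with probability at least $1-1/\log^2 n$ (no condition if there is no such $T$). An edge is $S$-persistent if both its endpoints are. **Preprocess.** For an ordering $\pi$ of $S\subseteq [n+1]$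 and $f(x)\ne f(x^{(S)})$, binary search on the path $x=x_0,\dots,x_{|S|}=x^{(S)}$ that flips the variables in the order $\pi$ starts with $(l,r)=(0,|S|)$ and, while $r-l>1$, puts $u=\lceil (l+r)/2\rceil$ and sets $r=u$ if $f(x_l)\neq f(x_u)$, and $l=u$ otherwise; it returns $\pi(r)$. If $f(x)=f(x^{(S)})$ it returns nil. $\mathtt{Preprocess}(f,S_0,\pi,\xi)$ starts with $S=S_0$ and, while $S\neq\emptyset$, runs up to $\lceil\log^4 n/\xi\rceil$ rounds, each of which draws a uniform $x\in\{0,1\}^n$, a fair coin choosing the size $\lfloor|S|/2\rfloor$ or $\lfloor|S|/2\rfloor+1$, and a uniform $T\subseteq S$ of that size, and runs binary search from $x$ on $T$ with the induced ordering. The first variable returned is removed from $S$ (and from the ordering) and the rounds start afresh; if all rounds return nil, the procedure stops. Its output is the final $S$. **Scores.** $\mathcal H_{\xi,m}$ is the law of $\mathtt{Preprocess}(f,S_0,\pi,\xi)$ for a uniform $S_0\subseteq[n+1]$ with $|S_0|=m$, $n+1\in S_0$, and a uniform ordering $\pi$ of $S_0$; $\mathcal P_{i,m}$ is the uniform distribution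 on size-$m$ subsets of $[n]\setminus\{i\}$. A bichromatic edge along $i$ is $a$-strong ($a\in[\Lambda]$) if it is $S$-persistent with probability at least $1-1/\log n$ both (1) for $S\sim\mathcal H_{\xi,m}$, for every power of two $m\le n^{2/3}$ (including $1$) and every $\xi=2^{-k}$, $a\le k\le\Lambda$; and (2) for $S\sim\mathcal P_{i,\lceil\sqrt n/2^a\rceil}$. $\mathrm{Score}^+_{i,a}$ (resp. $\mathrm{Score}^-_{i,a}$) is $2^{-n}$ times the number of $a$-strong monotone (resp. anti-monotone) edges along $i$. **Lemma.** There is a constant $k$ such that for every constant $c>0$ there is a constant $C>0$ for which the following holds. Let $n\in\mathbb N$, $0<\varepsilon\le1$, $s,t\in[\Lambda]$ with $s\ge t$, $h\in[3\Lambda]$ and $\ell\in[\lfloor\log n\rfloor]$ with $2^\ell/2^t\ge n^{2/3}$. There is a randomized adaptive algorithm (which may depend on $n,\varepsilon,s,t,h,\ell,c$) that always makes at most $$C\cdot\frac{n^{2/3}}{\varepsilon^2}\cdot\log^k(n/\varepsilon)$$ queries, i.e. $\tilde O(n^{2/3}/\varepsilon^2)$ queries, with the following property. Given query access to any $f:\{0,1\}^n\to\{0,1\}$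 for which there is a set $\mathcal I\subseteq[n]$ with $|\mathcal I|=2^\ell$ such that (i) $|\mathcal I|/2^h\ge c\,\varepsilon^2/\Lambda^{11}$, and $\min\{\mathrm{Score}^+_{i,s}/2^s,\ \mathrm{Score}^-_{i,t}/2^t\}\ge 2^{-h}$ for every $i\in\mathcal I$; and (ii) at least half of the $i\in\mathcal I$ satisfy $\mathrm{Inf}_f[i]\le\dfrac{\varepsilon^2}{\Lambda^{13}}\cdot\dfrac{n^{1/3}}{|\mathcal I|}$, the algorithm outputs an edge violation of $f$ to unateness with probability at least $2/3$. -/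

import Mathlib

noncomputable section

/-! ### Boolean functions on the cube -/

/-- The Boolean cube; `false` is the bit 0 and `true` is the bit 1. -/
abbrev Cube (n : ℕ) := Fin n → Bool

/-- Variable names: `some i` is the `i`-th variable, `none` is the placeholder (dummy) variable,
usually called `n + 1`. -/
abbrev Var (n : ℕ) := Option (Fin n)

/-- The point obtained from `x` by flipping the variables in `S`; flipping the placeholder
changes nothing. -/
def flipSet {n : ℕ} (x : Cube n) (S : Finset (Var n)) : Cube n :=
  fun k => if some k ∈ S then !(x k) else x k

/-- The point obtained from `x` by flipping the `i`-th variable. -/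
def flipVar {n : ℕ} (x : Cube n) (i : Fin n) : Cube n := flipSet x {some i}

/-- The edge between `x` and `flipVar x i` is bichromatic. -/
def IsBichromatic {n : ℕ} (f : Cube n → Bool) (i : Fin n) (x : Cube n) : Prop :=
  f x ≠ f (flipVar x i)

/-- The edge between `x` and `flipVar x i` is monotone (bichromatic). -/
def IsMonoEdge {n : ℕ} (f : Cube n → Bool) (i : Fin n) (x : Cube n) : Prop :=
  IsBichromatic f i x ∧ x i = f x

/-- The edge between `x` and `flipVar x i` is anti-monotone (bichromatic). -/
def IsAntiEdge {n : ℕ} (f : Cube n → Bool) (i : Fin n) (x : Cube n) : Prop :=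
  IsBichromatic f i x ∧ x i ≠ f x

/-- The triple `(i, x, y)` describes an edge violation of `f` to unateness: the edge along `i` at
`x` is monotone and the edge along `i` at `y` is anti-monotone. -/
def IsEdgeViolation {n : ℕ} (f : Cube n → Bool) (v : Fin n × Cube n × Cube n) : Prop :=
  IsMonoEdge f v.1 v.2.1 ∧ IsAntiEdge f v.1 v.2.2

/-- The influence of variable `i` in `f`. -/
def influence {n : ℕ} (f : Cube n → Bool) (i : Fin n) : ℝ :=
  ((Finset.univ.filter fun x : Cube n => f x ≠ f (flipVar x i)).card : ℝ) / 2 ^ n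

/-! ### Finite probability -/

/-- The probability of the event `E` under `p`, as a real number. -/
def prob {α : Type} (p : PMF α) (E : Set α) : ℝ := (p.toOuterMeasure E).toReal

/-- The uniform distribution on the finite set `s` (a point mass if `s` is empty). -/
def uniformOn {α : Type} [Inhabited α] (s : Finset α) : PMF α :=
  open Classical in if hs : s.Nonempty then PMF.uniformOfFinset s hs else PMF.pure default

/-! ### Randomized adaptive query algorithms -/

/-- A randomized adaptive algorithm with query access to an unknown `f : Cube n → Bool`, with
output in `α`: it stops with an output, or queries a point and continues according to the
answer, or draws a random element and continues according to it. -/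
inductive QueryAlg (n : ℕ) (α : Type) : Type 1
  | ret (a : α) : QueryAlg n α
  | query (x : Cube n) (next : Bool → QueryAlg n α) : QueryAlg n α
  | draw (β : Type) (p : PMF β) (next : β → QueryAlg n α) : QueryAlg n α

namespace QueryAlg

/-- Run an algorithm and continue with its output. -/
def bind {n : ℕ} {α β : Type} : QueryAlg n α → (α → QueryAlg n β) → QueryAlg n β
  | ret a, g => g a
  | query x next, g => query x fun b => (next b).bind g
  | draw γ p next, g => draw γ p fun c => (next c).bind g

/-- The distribution of the output when the queries are answered by `f`. -/
def law {n : ℕ} {α : Type} (f : Cube n → Bool) : QueryAlg n α → PMF α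
  | ret a => PMF.pure a
  | query x next => (next (f x)).law f
  | draw _ p next => p.bind fun c => (next c).law f

/-- Every execution makes at most `q` queries, whatever the answers and the random draws. -/
def QueriesAtMost {n : ℕ} {α : Type} : QueryAlg n α → ℕ → Prop
  | ret _, _ => True
  | query _ next, q => 1 ≤ q ∧ ∀ b, (next b).QueriesAtMost (q - 1)
  | draw _ p next, q => ∀ c ∈ p.support, (next c).QueriesAtMost q

end QueryAlg

/-! ### The preprocessing procedure

A set of variables endowed with an ordering is represented by the duplicate-free list of its
elements in that order. -/

/-- The `t`-th point of the path from `x` that flips the variables of `π` one after another. -/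
def pathPoint {n : ℕ} (x : Cube n) (π : List (Var n)) (t : ℕ) : Cube n :=
  flipSet x (π.take t).toFinset

/-- The loop of the binary search, on the points with indices `l < r` of the path, where `a` is
the (already queried) value of `f` at the point with index `l`. -/
def binarySearchLoop {n : ℕ} (x : Cube n) (π : List (Var n)) (a : Bool) (l r : ℕ) :
    QueryAlg n (Option (Var n × Cube n)) :=
  if 1 < r - l then
    QueryAlg.query (pathPoint x π ((l + r + 1) / 2)) fun b =>
      if a ≠ b then binarySearchLoop x π a l ((l + r + 1) / 2)
      else binarySearchLoop x π a ((l + r + 1) / 2) r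
  else QueryAlg.ret ((π[r - 1]?).map fun i => (i, pathPoint x π l))
termination_by r - l
decreasing_by all_goals omega

/-- Binary search for a bichromatic edge along the path from `x` given by `π`; the output `none`
is `nil`. -/
def binarySearch {n : ℕ} (x : Cube n) (π : List (Var n)) :
    QueryAlg n (Option (Var n × Cube n)) :=
  QueryAlg.query x fun a => QueryAlg.query (flipSet x π.toFinset) fun b =>
    if a = b then QueryAlg.ret none else binarySearchLoop x π a 0 π.length

/-- At most `N` rounds, each of which draws a uniform point `x`, a fair coin and, depending on
the coin, a uniform subset `T` of the set `S` ordered by `π` of size `⌊|S|/2⌋` or `⌊|S|/2⌋ + 1`,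
and runs the binary search from `x` on `T` with the induced ordering. It outputs the first
variable found by a binary search, and `none` if there is no such variable. -/
def checkRounds {n : ℕ} (π : List (Var n)) : ℕ → QueryAlg n (Option (Var n))
  | 0 => QueryAlg.ret none
  | N + 1 =>
    QueryAlg.draw (Cube n) (PMF.uniformOfFintype (Cube n)) fun x =>
    QueryAlg.draw Bool (PMF.uniformOfFintype Bool) fun coin =>
    QueryAlg.draw (Finset (Var n))
      (uniformOn (π.toFinset.powersetCard
        (if coin then π.length / 2 else π.length / 2 + 1))) fun T =>
    (binarySearch x (π.filter fun i => decide (i ∈ T))).bind fun out =>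
      match out with
      | some v => QueryAlg.ret (some v.1)
      | none => checkRounds π N

/-- `CheckPersistence`: `log⁴ n / ξ` rounds (rounded up). -/
def checkPersistence {n : ℕ} (π : List (Var n)) (ξ : ℝ) : QueryAlg n (Option (Var n)) :=
  checkRounds π ⌈Real.logb 2 n ^ 4 / ξ⌉₊

/-- The loop of `Preprocess`, for at most `N` iterations. -/
def preprocessLoop {n : ℕ} (ξ : ℝ) : ℕ → List (Var n) → QueryAlg n (Finset (Var n))
  | 0, π => QueryAlg.ret π.toFinset
  | N + 1, π =>
    if π = [] then QueryAlg.ret ∅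
    else (checkPersistence π ξ).bind fun out =>
      match out with
      | none => QueryAlg.ret π.toFinset
      | some i => preprocessLoop ξ N (π.erase i)

/-- `Preprocess`: as long as the current ordered set is nonempty, run `CheckPersistence` on it;
return the set if the outcome is `nil`, and remove the variable found otherwise. Each iteration
but the last removes a variable, so `π.length` iterations are enough to finish the loop. -/
def preprocess {n : ℕ} (π : List (Var n)) (ξ : ℝ) : QueryAlg n (Finset (Var n)) :=
  preprocessLoop ξ π.length π

/-- The type of orderings of a finite set is nonempty. -/
instance orderingNonempty {n : ℕ} (S : Finset (Var n)) :
    Nonempty (Fin S.card ≃ {v : Var n // v ∈ S}) := ⟨S.equivFin.symm⟩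

/-- The distribution `H_{ξ,m}` (for the function `f`): draw a uniform set `S₀` of `m` variables
that contains the placeholder and a uniform ordering of `S₀`, and run `Preprocess`. -/
def distH {n : ℕ} (f : Cube n → Bool) (ξ : ℝ) (m : ℕ) : PMF (Finset (Var n)) :=
  (uniformOn ((Finset.univ.powersetCard m).filter fun S : Finset (Var n) => none ∈ S)).bind
    fun S₀ => (PMF.uniformOfFintype (Fin S₀.card ≃ {v : Var n // v ∈ S₀})).bind
      fun π => (preprocess (List.ofFn fun j => (π j : Var n)) ξ).law f

/-- The distribution `P_{i,m}`: a uniform set of `m` proper variables other than `i`. -/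
def distP {n : ℕ} (i : Fin n) (m : ℕ) : PMF (Finset (Var n)) :=
  uniformOn (({none, some i}ᶜ : Finset (Var n)).powersetCard m)

/-! ### Persistency, strong edges and scores -/

/-- All but a `1 / log² n` fraction of the subsets `T` of `S` of size `k` satisfy
`f x = f (flipSet x T)` (trivially true if there is no such `T`). -/
def PersistentAt {n : ℕ} (f : Cube n → Bool) (S : Finset (Var n)) (k : ℕ) (x : Cube n) : Prop :=
  (1 - 1 / Real.logb 2 n ^ 2) * ((S.powersetCard k).card : ℝ) ≤
    (((S.powersetCard k).filter fun T => f x = f (flipSet x T)).card : ℝ)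

/-- The point `x` is `S`-persistent. -/
def IsPersistent {n : ℕ} (f : Cube n → Bool) (S : Finset (Var n)) (x : Cube n) : Prop :=
  PersistentAt f S (S.card / 2) x ∧ PersistentAt f S (S.card / 2 + 1) x

/-- The edge between `x` and `flipVar x i` is `S`-persistent. -/
def IsPersistentEdge {n : ℕ} (f : Cube n → Bool) (S : Finset (Var n)) (i : Fin n) (x : Cube n) :
    Prop :=
  IsPersistent f S x ∧ IsPersistent f S (flipVar x i)

/-- The parameter `Λ = ⌈2 log (n / ε)⌉`. -/
def Lam (n : ℕ) (ε : ℝ) : ℕ := ⌈2 * Real.logb 2 (n / ε)⌉₊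

/-- The two conditions for the bichromatic edge between `x` and `flipVar x i` to be
`a`-strong. -/
def IsStrong {n : ℕ} (ε : ℝ) (f : Cube n → Bool) (a : ℕ) (i : Fin n) (x : Cube n) : Prop :=
  (∀ j k : ℕ, (2 : ℝ) ^ j ≤ (n : ℝ) ^ (2 / 3 : ℝ) → a ≤ k → k ≤ Lam n ε →
    1 - 1 / Real.logb 2 n ≤ prob (distH f (1 / 2 ^ k) (2 ^ j)) {S | IsPersistentEdge f S i x}) ∧
  1 - 1 / Real.logb 2 n ≤
    prob (distP i ⌈Real.sqrt n / 2 ^ a⌉₊) {S | IsPersistentEdge f S i x}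

/-- `Score⁺_{i,a}(f)`: the number of `a`-strong monotone edges along `i`, divided by `2 ^ n`.
Each edge is counted once, through its endpoint `x` with `x i = 0`. -/
def scorePlus {n : ℕ} (ε : ℝ) (f : Cube n → Bool) (i : Fin n) (a : ℕ) : ℝ :=
  (Set.ncard {x : Cube n | x i = false ∧ IsMonoEdge f i x ∧ IsStrong ε f a i x} : ℝ) / 2 ^ n

/-- `Score⁻_{i,a}(f)`: the number of `a`-strong anti-monotone edges along `i`, divided by
`2 ^ n`. -/
def scoreMinus {n : ℕ} (ε : ℝ) (f : Cube n → Bool) (i : Fin n) (a : ℕ) : ℝ :=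
  (Set.ncard {x : Cube n | x i = false ∧ IsAntiEdge f i x ∧ IsStrong ε f a i x} : ℝ) / 2 ^ n

/-- The bucketed score summary for `f` with parameters `s, t, h` and the set `I`, where `c` is
the constant in `|I| / 2 ^ h = Ω(ε² / Λ¹¹)`. -/
def ScoreSummary {n : ℕ} (c ε : ℝ) (f : Cube n → Bool) (s t h : ℕ) (I : Finset (Fin n)) : Prop :=
  c * (ε ^ 2 / (Lam n ε : ℝ) ^ 11) ≤ (I.card : ℝ) / 2 ^ h ∧
  ∀ i ∈ I, 1 / 2 ^ h ≤ min (scorePlus ε f i s * (1 / 2 ^ s)) (scoreMinus ε f i t * (1 / 2 ^ t))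

open Classical in
/-- At least half of the variables `i ∈ I` have influence at most
`(ε² / Λ¹³) · n^{1/3} / |I|`. -/
def HalfLowInfluence {n : ℕ} (ε : ℝ) (f : Cube n → Bool) (I : Finset (Fin n)) : Prop :=
  I.card ≤ 2 * (I.filter fun i =>
    influence f i ≤ ε ^ 2 / (Lam n ε : ℝ) ^ 13 * ((n : ℝ) ^ (1 / 3 : ℝ) / I.card)).card

end

/-!
The algorithm repeats a constant number of attempts. An attempt draws a uniform set `S₀` of `m`
proper variables, orders it at random and preprocesses it with precision `2 ^ (-t)`, which leaves a
set `S`. With `q` samples it collects anti-monotone edges along variables of `S`. Then it splits its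
effort over random blocks `V ⊆ S₀` of size `m'`: each block is preprocessed with precision
`2 ^ (-s)`, and `r` samples look in what remains for a monotone edge along a variable for which an
anti-monotone edge has been recorded. Every edge that is output has been queried, so only the
probability of finding something matters.

A sample (`sampleEdge`) takes a uniform point `x` and logarithmically many uniform sets
`T ⊆ S` of half size. If the edge along `i` at `x` is bichromatic and both its ends are persistent
for `S` with `i` replaced by the placeholder, then flipping `T` changes the value of `f` at `x` with
high probability exactly when `i ∈ T`, and the sets `T` single out `i`
(`persistentCount_le_ex_sampleEdge`). So a sample finds each variable `i` that is kept with
probability proportional to its number of strong edges.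

Strong edges are persistent for the outcome of `Preprocess` on sets that contain the placeholder,
whereas the algorithm works with sets that contain `i`. The bridge is the comparison of the run of
`Preprocess` on a list containing `i` with its run on the list where `i` is replaced by the
placeholder (`ex_preSet_swap_le`). In a binary search along a path that flips `i` at position `p`,
only those of the `O(log n)` nodes that the search can visit while its interval contains `p` matter.
If `f` is insensitive to `i` at these nodes, then the searches from `x` and from `x` with `i`
flipped return the same two results for both lists, and never return `i` (`sum_bsVal_swap_le`).
Hence one round changes by at most `O(log n)` times the influence of `i`, and for the variables of
low influence the whole preprocessing changes by a negligible amount. Markov's inequality then shows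
that a variable `i` with large scores, given that it lies in `S₀`, is kept with high probability and
with at least half of its strong edges persistent (`ex_not_keeps_le`).

By the second moment method (`paley_zygmund`, `goodVars_large`) the number of good variables in `S₀`
is with constant probability at least a constant times its expectation. Given this, the first part
finds anti-monotone edges along `d` of them (`half_le_ex_collect`) and the second part finds a match
(`le_ex_attempt`). The sizes `m`, `m'`, `q`, `r` are powers of two that balance the costs; that they
make sense and that the costs are `n^{2/3} / ε ^ 2` up to logarithms follows from `Regime`, whose
relations come from comparing the score of a variable of low influence with its influence
(`regime_of_bounds`). In bounded dimension the algorithm queries the whole cube.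
-/

open scoped ENNReal

noncomputable section

/-! ### Expectations of nonnegative functions -/

/-- The expectation of the nonnegative function `g` under `p`. -/
def ex {α : Type} (p : PMF α) (g : α → ℝ≥0∞) : ℝ≥0∞ := ∑' a, p a * g a

lemma ex_pure {α : Type} (a : α) (g : α → ℝ≥0∞) : ex (PMF.pure a) g = g a := by
  unfold ex
  rw [tsum_eq_single a]
  · simp
  · intro b hb; simp [hb]

lemma ex_bind {α β : Type} (p : PMF α) (k : α → PMF β) (g : β → ℝ≥0∞) :
    ex (p.bind k) g = ex p fun a => ex (k a) g := by
  unfold ex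
  simp_rw [PMF.bind_apply, ← ENNReal.tsum_mul_right, ← ENNReal.tsum_mul_left]
  rw [ENNReal.tsum_comm]
  simp_rw [mul_assoc]

lemma ex_map {α β : Type} (p : PMF α) (k : α → β) (g : β → ℝ≥0∞) :
    ex (p.map k) g = ex p fun a => g (k a) := by
  rw [← PMF.bind_pure_comp, ex_bind]; simp [ex_pure]

lemma ex_mono_support {α : Type} {p : PMF α} {g h : α → ℝ≥0∞} (H : ∀ a ∈ p.support, g a ≤ h a) :
    ex p g ≤ ex p h := by
  unfold ex
  refine ENNReal.tsum_le_tsum fun a => ?_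
  by_cases ha : a ∈ p.support
  · exact mul_le_mul_right (H a ha) _
  · rw [PMF.mem_support_iff, not_not] at ha; simp [ha]

lemma ex_mono {α : Type} {p : PMF α} {g h : α → ℝ≥0∞} (H : ∀ a, g a ≤ h a) :
    ex p g ≤ ex p h := ex_mono_support fun a _ => H a

lemma ex_add {α : Type} (p : PMF α) (g h : α → ℝ≥0∞) :
    ex p (fun a => g a + h a) = ex p g + ex p h := by
  unfold ex; simp_rw [mul_add]; exact ENNReal.tsum_add

lemma ex_const_mul {α : Type} (p : PMF α) (c : ℝ≥0∞) (g : α → ℝ≥0∞) :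
    ex p (fun a => c * g a) = c * ex p g := by
  unfold ex; rw [← ENNReal.tsum_mul_left]; refine tsum_congr fun a => ?_; ring

lemma ex_mul_const {α : Type} (p : PMF α) (c : ℝ≥0∞) (g : α → ℝ≥0∞) :
    ex p (fun a => g a * c) = ex p g * c := by
  simp_rw [mul_comm _ c]; exact ex_const_mul p c g

lemma ex_const {α : Type} (p : PMF α) (c : ℝ≥0∞) : ex p (fun _ => c) = c := by
  unfold ex; rw [ENNReal.tsum_mul_right, p.tsum_coe, one_mul]

lemma ex_sum {α ι : Type} (p : PMF α) (s : Finset ι) (g : ι → α → ℝ≥0∞) :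
    ex p (fun a => ∑ i ∈ s, g i a) = ∑ i ∈ s, ex p (g i) := by
  classical
  induction s using Finset.induction_on with
  | empty => simpa using ex_const p 0
  | insert i s hi ih => simp_rw [Finset.sum_insert hi]; rw [ex_add, ih]

lemma ex_le_const {α : Type} {p : PMF α} {g : α → ℝ≥0∞} {c : ℝ≥0∞} (H : ∀ a, g a ≤ c) :
    ex p g ≤ c := (ex_mono H).trans_eq (ex_const p c)

lemma ex_uniformOn {α : Type} [Inhabited α] {s : Finset α} (hs : s.Nonempty) (g : α → ℝ≥0∞) :
    ex (uniformOn s) g = (∑ a ∈ s, g a) / s.card := by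
  unfold ex uniformOn
  rw [dif_pos hs, tsum_eq_sum (s := s)]
  · rw [ENNReal.div_eq_inv_mul, Finset.mul_sum]
    refine Finset.sum_congr rfl fun a ha => ?_
    rw [PMF.uniformOfFinset_apply_of_mem _ ha]
  · intro a ha; rw [PMF.uniformOfFinset_apply_of_notMem _ ha, zero_mul]

lemma mem_support_uniformOn {α : Type} [Inhabited α] {s : Finset α} (hs : s.Nonempty) {a : α} :
    a ∈ (uniformOn s).support ↔ a ∈ s := by
  unfold uniformOn; rw [dif_pos hs]; simp

lemma ex_uniformOfFintype {α : Type} [Fintype α] [Nonempty α] (g : α → ℝ≥0∞) :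
    ex (PMF.uniformOfFintype α) g = (∑ a, g a) / Fintype.card α := by
  unfold ex
  rw [tsum_fintype, ENNReal.div_eq_inv_mul, Finset.mul_sum]
  simp

open Classical in
/-- The indicator function of a proposition. -/
def ind (P : Prop) : ℝ≥0∞ := if P then 1 else 0

lemma ind_le_one (P : Prop) : ind P ≤ 1 := by unfold ind; split_ifs <;> simp

lemma ind_of {P : Prop} (h : P) : ind P = 1 := by simp [ind, h]

lemma ind_of_not {P : Prop} (h : ¬ P) : ind P = 0 := by simp [ind, h]

lemma ind_mono {P Q : Prop} (h : P → Q) : ind P ≤ ind Q := by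
  by_cases hP : P
  · rw [ind_of hP, ind_of (h hP)]
  · rw [ind_of_not hP]; exact zero_le

lemma ind_add_ind_not (P : Prop) : ind P + ind (¬ P) = 1 := by
  by_cases h : P <;> simp [ind, h]

lemma ind_mul_ind (P Q : Prop) : ind P * ind Q = ind (P ∧ Q) := by
  by_cases h : P <;> by_cases h' : Q <;> simp [ind, h, h']

lemma ind_eq_ite (P : Prop) [Decidable P] : ind P = if P then 1 else 0 := by
  by_cases h : P <;> simp [ind, h]

lemma sum_ind {α : Type} (s : Finset α) (P : α → Prop) [DecidablePred P] :
    ∑ a ∈ s, ind (P a) = ((s.filter P).card : ℝ≥0∞) := by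
  simp_rw [ind_eq_ite]
  rw [Finset.sum_boole]

lemma ex_add_ex_not {α : Type} (p : PMF α) (P : α → Prop) :
    ex p (fun a => ind (P a)) + ex p (fun a => ind (¬ P a)) = 1 := by
  rw [← ex_add]; simp_rw [ind_add_ind_not]; exact ex_const p 1

lemma prob_eq_ex {α : Type} (p : PMF α) (E : Set α) :
    prob p E = (ex p fun a => ind (a ∈ E)).toReal := by
  unfold prob ex
  rw [PMF.toOuterMeasure_apply]
  congr 1
  refine tsum_congr fun a => ?_
  by_cases h : a ∈ E <;> simp [ind, h]

lemma ofReal_prob {α : Type} (p : PMF α) (E : Set α) :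
    ENNReal.ofReal (prob p E) = ex p fun a => ind (a ∈ E) := by
  rw [prob_eq_ex, ENNReal.ofReal_toReal]
  exact ne_top_of_le_ne_top ENNReal.one_ne_top (ex_le_const fun a => ind_le_one _)

lemma le_prob_iff {α : Type} (p : PMF α) (E : Set α) {r : ℝ} :
    r ≤ prob p E ↔ ENNReal.ofReal r ≤ ex p fun a => ind (a ∈ E) := by
  rw [← ofReal_prob]
  exact (ENNReal.ofReal_le_ofReal_iff (by unfold prob; positivity)).symm

/-- The complement of an event of probability at least `1 - δ` has probability at most `δ`. -/
lemma ex_not_le_of_le_prob {α : Type} {p : PMF α} {E : Set α} {δ : ℝ}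
    (h : 1 - δ ≤ prob p E) : ex p (fun a => ind (a ∉ E)) ≤ ENNReal.ofReal δ := by
  have h1 := ex_add_ex_not p (fun a => a ∈ E)
  rw [← ofReal_prob] at h1
  have hfin : ex p (fun a => ind (a ∉ E)) ≠ ⊤ :=
    ne_top_of_le_ne_top ENNReal.one_ne_top (ex_le_const fun a => ind_le_one _)
  rw [← ENNReal.ofReal_toReal hfin] at h1 ⊢
  have hp : 0 ≤ prob p E := by unfold prob; positivity
  rw [← ENNReal.ofReal_add hp ENNReal.toReal_nonneg, ← ENNReal.ofReal_one,
    ENNReal.ofReal_eq_ofReal_iff (by positivity) zero_le_one] at h1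
  exact ENNReal.ofReal_le_ofReal (by linarith)

/-! ### Laws and query counts of composed algorithms -/

namespace QueryAlg

lemma law_bind {n : ℕ} {α β : Type} (f : Cube n → Bool) (A : QueryAlg n α)
    (g : α → QueryAlg n β) : (A.bind g).law f = (A.law f).bind fun a => (g a).law f := by
  induction A with
  | ret a => simp [bind, law]
  | query x next ih => simp only [bind, law]; exact ih _
  | draw γ p next ih => simp only [bind, law, ih, PMF.bind_bind]

lemma QueriesAtMost.mono {n : ℕ} {α : Type} {A : QueryAlg n α} {q q' : ℕ} (h : A.QueriesAtMost q)
    (hq : q ≤ q') : A.QueriesAtMost q' := by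
  induction A generalizing q q' with
  | ret a => trivial
  | query x next ih =>
    obtain ⟨h1, h2⟩ := h
    exact ⟨h1.trans hq, fun b => ih b (h2 b) (by omega)⟩
  | draw γ p next ih => exact fun c hc => ih c (h c hc) hq

lemma QueriesAtMost.bind {n : ℕ} {α β : Type} {A : QueryAlg n α} {g : α → QueryAlg n β}
    {a b : ℕ} (hA : A.QueriesAtMost a) (hg : ∀ o, (g o).QueriesAtMost b) :
    (A.bind g).QueriesAtMost (a + b) := by
  induction A generalizing a with
  | ret c => exact (hg c).mono (by omega)
  | query x next ih =>
    obtain ⟨h1, h2⟩ := hA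
    refine ⟨by omega, fun c => ?_⟩
    have := ih c (h2 c)
    exact this.mono (by omega)
  | draw γ p next ih => exact fun c hc => ih c (hA c hc)

/-- Run an algorithm up to `r` times, until it outputs something. -/
def firstSome {n : ℕ} {α : Type} (A : QueryAlg n (Option α)) : ℕ → QueryAlg n (Option α)
  | 0 => ret none
  | r + 1 => A.bind fun o => match o with
    | some v => ret (some v)
    | none => firstSome A r

lemma queriesAtMost_firstSome {n : ℕ} {α : Type} {A : QueryAlg n (Option α)} {a : ℕ}
    (hA : A.QueriesAtMost a) (r : ℕ) : (firstSome A r).QueriesAtMost (r * a) := by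
  induction r with
  | zero => trivial
  | succ r ih =>
    have : (firstSome A (r + 1)).QueriesAtMost (a + r * a) := by
      refine hA.bind fun o => ?_
      rcases o with _ | v
      · exact ih
      · trivial
    exact this.mono (by rw [Nat.add_mul, one_mul, add_comm])

lemma ex_firstSome_none {n : ℕ} {α : Type} (f : Cube n → Bool) (A : QueryAlg n (Option α))
    (r : ℕ) : ex ((firstSome A r).law f) (fun o => ind (o = none)) =
      ex (A.law f) (fun o => ind (o = none)) ^ r := by
  induction r with
  | zero => simp [firstSome, law, ex_pure, ind]
  | succ r ih =>
    rw [firstSome, law_bind, ex_bind, pow_succ', ← ex_mul_const]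
    congr 1
    funext o
    rcases o with _ | v
    · simp only [ih, ind_of, one_mul]
    · simp [law, ex_pure, ind]

/-- Whatever an algorithm outputs (when it outputs something) satisfies `P`. -/
def Sound {n : ℕ} {α : Type} (f : Cube n → Bool) (A : QueryAlg n (Option α)) (P : α → Prop) :
    Prop := ∀ v, some v ∈ (A.law f).support → P v

lemma Sound.bind {n : ℕ} {α β : Type} {f : Cube n → Bool} {A : QueryAlg n β}
    {g : β → QueryAlg n (Option α)} {P : α → Prop}
    (h : ∀ b ∈ (A.law f).support, Sound f (g b) P) : Sound f (A.bind g) P := by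
  intro v hv
  rw [law_bind, PMF.mem_support_bind_iff] at hv
  obtain ⟨b, hb, hv⟩ := hv
  exact h b hb v hv

lemma Sound.draw {n : ℕ} {α β : Type} {f : Cube n → Bool} {p : PMF β}
    {g : β → QueryAlg n (Option α)} {P : α → Prop}
    (h : ∀ b ∈ p.support, Sound f (g b) P) : Sound f (QueryAlg.draw β p g) P := by
  intro v hv
  rw [law, PMF.mem_support_bind_iff] at hv
  obtain ⟨b, hb, hv⟩ := hv
  exact h b hb v hv

lemma Sound.ret_none {n : ℕ} {α : Type} {f : Cube n → Bool} {P : α → Prop} :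
    Sound f (ret none) P := by
  intro v hv; simp [law] at hv

lemma Sound.ret_some {n : ℕ} {α : Type} {f : Cube n → Bool} {P : α → Prop} {w : α} (h : P w) :
    Sound f (ret (some w)) P := by
  intro v hv; simp [law] at hv; exact hv ▸ h

lemma Sound.firstSome {n : ℕ} {α : Type} {f : Cube n → Bool} {A : QueryAlg n (Option α)}
    {P : α → Prop} (h : Sound f A P) (r : ℕ) : Sound f (firstSome A r) P := by
  induction r with
  | zero => exact Sound.ret_none
  | succ r ih =>
    refine Sound.bind fun o ho => ?_
    rcases o with _ | v
    · exact ih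
    · exact Sound.ret_some (h v ho)

end QueryAlg

/-! ### Flipping variables -/

lemma flipSet_flipSet {n : ℕ} (x : Cube n) (S T : Finset (Var n)) :
    flipSet (flipSet x S) T = flipSet (flipSet x T) S := by
  funext k; unfold flipSet; split_ifs <;> rfl

lemma flipSet_self {n : ℕ} (x : Cube n) (S : Finset (Var n)) : flipSet (flipSet x S) S = x := by
  funext k; unfold flipSet; split_ifs <;> simp

lemma flipVar_flipSet {n : ℕ} (x : Cube n) (S : Finset (Var n)) (i : Fin n) :
    flipVar (flipSet x S) i = flipSet (flipVar x i) S := flipSet_flipSet _ _ _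

lemma flipVar_flipVar {n : ℕ} (x : Cube n) (i : Fin n) : flipVar (flipVar x i) i = x :=
  flipSet_self _ _

/-- Flipping a fixed set of variables, as a permutation of the cube. -/
def flipEquiv {n : ℕ} (S : Finset (Var n)) : Equiv.Perm (Cube n) where
  toFun x := flipSet x S
  invFun x := flipSet x S
  left_inv x := flipSet_self x S
  right_inv x := flipSet_self x S

/-- The transposition of the variable `i` and the placeholder. -/
def swapVar {n : ℕ} (i : Fin n) : Equiv.Perm (Var n) := Equiv.swap none (some i)

/-- The set of variables obtained by exchanging `i` and the placeholder. -/
def swapSet {n : ℕ} (i : Fin n) (S : Finset (Var n)) : Finset (Var n) :=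
  S.map (swapVar i).toEmbedding

lemma mem_swapSet {n : ℕ} {i : Fin n} {S : Finset (Var n)} {v : Var n} :
    v ∈ swapSet i S ↔ swapVar i v ∈ S := by
  unfold swapSet swapVar
  rw [Finset.mem_map_equiv, Equiv.symm_swap]

lemma card_swapSet {n : ℕ} (i : Fin n) (S : Finset (Var n)) : (swapSet i S).card = S.card :=
  Finset.card_map _

lemma swapSet_swapSet {n : ℕ} (i : Fin n) (S : Finset (Var n)) : swapSet i (swapSet i S) = S := by
  ext v; rw [mem_swapSet, mem_swapSet]; simp [swapVar]

lemma swapVar_of_ne {n : ℕ} {i : Fin n} {v : Var n} (h1 : v ≠ none) (h2 : v ≠ some i) :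
    swapVar i v = v := Equiv.swap_apply_of_ne_of_ne h1 h2

lemma swapVar_none {n : ℕ} {i : Fin n} : swapVar i none = some i := Equiv.swap_apply_left _ _

lemma swapVar_some {n : ℕ} {i : Fin n} : swapVar i (some i) = none := Equiv.swap_apply_right _ _

lemma swapVar_swapVar {n : ℕ} {i : Fin n} (v : Var n) : swapVar i (swapVar i v) = v := by
  simp [swapVar]

/-- Replacing the placeholder by `i` in a set of variables to flip amounts to flipping `i`. -/
lemma flipSet_swapSet_of_mem {n : ℕ} {i : Fin n} {S : Finset (Var n)} (hi : some i ∈ S)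
    (hn : none ∉ S) (x : Cube n) : flipSet x S = flipVar (flipSet x (swapSet i S)) i := by
  funext k
  unfold flipVar flipSet
  simp only [mem_swapSet, Finset.mem_singleton, Option.some.injEq]
  by_cases hk : k = i
  · subst hk; simp [swapVar_some, hn, hi]
  · rw [swapVar_of_ne (by simp) (by simpa using hk)]; simp [hk]

lemma swapSet_of_notMem {n : ℕ} {i : Fin n} {S : Finset (Var n)} (hi : some i ∉ S)
    (hn : none ∉ S) : swapSet i S = S := by
  ext v
  rw [mem_swapSet]
  by_cases h1 : v = none
  · subst h1; rw [swapVar_none]; tauto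
  by_cases h2 : v = some i
  · subst h2; rw [swapVar_some]; tauto
  rw [swapVar_of_ne h1 h2]

/-! ### Binary search on a sequence of bits -/

/-- The right end of the last interval of the binary search for a position where the bit sequence
`s` changes, started on the interval `(l, r)` with `c` the bit at its left end. -/
def bsIdx (s : ℕ → Bool) (c : Bool) (l r : ℕ) : ℕ :=
  if 1 < r - l then
    if c ≠ s ((l + r + 1) / 2) then bsIdx s c l ((l + r + 1) / 2)
    else bsIdx s c ((l + r + 1) / 2) r
  else r
termination_by r - l
decreasing_by all_goals omega

/-- The midpoints of those intervals of the binary search tree on `(l, r)` that contain the step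
from `p` to `p + 1`. -/
def fixedNodes (p l r : ℕ) : List ℕ :=
  if 1 < r - l then
    if p < (l + r + 1) / 2 then (l + r + 1) / 2 :: fixedNodes p l ((l + r + 1) / 2)
    else (l + r + 1) / 2 :: fixedNodes p ((l + r + 1) / 2) r
  else []
termination_by r - l
decreasing_by all_goals omega

lemma length_fixedNodes (p l r : ℕ) : (fixedNodes p l r).length ≤ Nat.clog 2 (r - l) := by
  induction l, r using fixedNodes.induct p with
  | case1 l r h hp ih =>
    rw [fixedNodes, if_pos h, if_pos hp, List.length_cons, Nat.clog_of_two_le (by norm_num) h]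
    have : Nat.clog 2 ((l + r + 1) / 2 - l) ≤ Nat.clog 2 ((r - l + 2 - 1) / 2) :=
      Nat.clog_mono_right _ (by omega)
    omega
  | case2 l r h hp ih =>
    rw [fixedNodes, if_pos h, if_neg hp, List.length_cons, Nat.clog_of_two_le (by norm_num) h]
    have : Nat.clog 2 (r - (l + r + 1) / 2) ≤ Nat.clog 2 ((r - l + 2 - 1) / 2) :=
      Nat.clog_mono_right _ (by omega)
    omega
  | case3 l r h => rw [fixedNodes, if_neg h]; simp

lemma bsIdx_mem (s : ℕ → Bool) (c : Bool) (l r : ℕ) (h : l < r) :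
    l < bsIdx s c l r ∧ bsIdx s c l r ≤ r := by
  induction l, r using bsIdx.induct s c with
  | case1 l r h1 h2 ih => rw [bsIdx, if_pos h1, if_pos h2]; have := ih (by omega); omega
  | case2 l r h1 h2 ih => rw [bsIdx, if_pos h1, if_neg h2]; have := ih (by omega); omega
  | case3 l r h1 => rw [bsIdx, if_neg h1]; omega

lemma bsIdx_congr {s s' : ℕ → Bool} (c : Bool) (l r : ℕ)
    (h : ∀ t, l < t → t < r → s t = s' t) : bsIdx s c l r = bsIdx s' c l r := by
  induction l, r using bsIdx.induct s c with
  | case1 l r h1 h2 ih =>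
    rw [bsIdx.eq_def s c l r, if_pos h1, if_pos h2, bsIdx.eq_def s' c l r, if_pos h1,
      ← h _ (by omega) (by omega), if_pos h2]
    exact ih fun t ht ht' => h t ht (by omega)
  | case2 l r h1 h2 ih =>
    rw [bsIdx.eq_def s c l r, if_pos h1, if_neg h2, bsIdx.eq_def s' c l r, if_pos h1,
      ← h _ (by omega) (by omega), if_neg h2]
    exact ih fun t ht ht' => h t (by omega) (by omega)
  | case3 l r h1 => rw [bsIdx.eq_def s c l r, if_neg h1, bsIdx.eq_def s' c l r, if_neg h1]

/-- Exchanging the sequences `a` and `b` after position `p` permutes the two results of the binary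
search, provided that they agree at the midpoints queried while the interval contains the step
from `p` to `p + 1`: as soon as the interval leaves this step, all later queries are on one side
of it. -/
lemma bsIdx_mix {a b m₁ m₂ : ℕ → Bool} {p : ℕ} (c : Bool)
    (hm₁ : ∀ t, m₁ t = if t ≤ p then a t else b t) (hm₂ : ∀ t, m₂ t = if t ≤ p then b t else a t)
    (hp : a p = a (p + 1)) (l r : ℕ) (hl : l ≤ p) (hr : p < r)
    (hfix : ∀ u ∈ fixedNodes p l r, a u = b u) (hal : a l = c) (har : a r ≠ c) :
    ((bsIdx m₁ c l r = bsIdx a c l r ∧ bsIdx m₂ c l r = bsIdx b c l r) ∨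
      (bsIdx m₁ c l r = bsIdx b c l r ∧ bsIdx m₂ c l r = bsIdx a c l r)) ∧
    bsIdx a c l r ≠ p + 1 ∧ bsIdx b c l r ≠ p + 1 := by
  induction l, r using fixedNodes.induct p with
  | case1 l r h hpu ih =>
    rw [fixedNodes, if_pos h, if_pos hpu] at hfix
    have hu := hfix _ List.mem_cons_self
    have h1 : m₁ ((l + r + 1) / 2) = a ((l + r + 1) / 2) := by
      rw [hm₁]; split_ifs <;> simp [hu]
    have h2 : m₂ ((l + r + 1) / 2) = a ((l + r + 1) / 2) := by
      rw [hm₂]; split_ifs <;> simp [hu]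
    rw [bsIdx.eq_def m₁ c l r, bsIdx.eq_def a c l r, bsIdx.eq_def b c l r, bsIdx.eq_def m₂ c l r]
    simp only [if_pos h, h1, h2, ← hu]
    by_cases hc : c ≠ a ((l + r + 1) / 2)
    · simp only [if_pos hc]
      exact ih hl hpu (fun u hu' => hfix u (List.mem_cons_of_mem _ hu')) hal hc.symm
    · simp only [if_neg hc]
      have e1 : bsIdx m₁ c ((l + r + 1) / 2) r = bsIdx b c ((l + r + 1) / 2) r :=
        bsIdx_congr _ _ _ fun t ht _ => by rw [hm₁, if_neg (by omega)]
      have e2 : bsIdx m₂ c ((l + r + 1) / 2) r = bsIdx a c ((l + r + 1) / 2) r :=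
        bsIdx_congr _ _ _ fun t ht _ => by rw [hm₂, if_neg (by omega)]
      have h3 := bsIdx_mem a c ((l + r + 1) / 2) r (by omega)
      have h4 := bsIdx_mem b c ((l + r + 1) / 2) r (by omega)
      exact ⟨Or.inr ⟨e1, e2⟩, by omega, by omega⟩
  | case2 l r h hpu ih =>
    rw [fixedNodes, if_pos h, if_neg hpu] at hfix
    have hu := hfix _ List.mem_cons_self
    have h1 : m₁ ((l + r + 1) / 2) = a ((l + r + 1) / 2) := by
      rw [hm₁]; split_ifs <;> simp [hu]
    have h2 : m₂ ((l + r + 1) / 2) = a ((l + r + 1) / 2) := by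
      rw [hm₂]; split_ifs <;> simp [hu]
    rw [bsIdx.eq_def m₁ c l r, bsIdx.eq_def a c l r, bsIdx.eq_def b c l r, bsIdx.eq_def m₂ c l r]
    simp only [if_pos h, h1, h2, ← hu]
    by_cases hc : c ≠ a ((l + r + 1) / 2)
    · simp only [if_pos hc]
      have e1 : bsIdx m₁ c l ((l + r + 1) / 2) = bsIdx a c l ((l + r + 1) / 2) :=
        bsIdx_congr _ _ _ fun t ht _ => by rw [hm₁, if_pos (by omega)]
      have e2 : bsIdx m₂ c l ((l + r + 1) / 2) = bsIdx b c l ((l + r + 1) / 2) :=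
        bsIdx_congr _ _ _ fun t ht _ => by rw [hm₂, if_pos (by omega)]
      have h3 := bsIdx_mem a c l ((l + r + 1) / 2) (by omega)
      have h4 := bsIdx_mem b c l ((l + r + 1) / 2) (by omega)
      exact ⟨Or.inl ⟨e1, e2⟩, by omega, by omega⟩
    · simp only [if_neg hc]
      exact ih (by omega) hr (fun u hu' => hfix u (List.mem_cons_of_mem _ hu'))
        (not_not.1 hc).symm har
  | case3 l r h =>
    exfalso
    obtain rfl : l = p := by omega
    obtain rfl : r = l + 1 := by omega
    exact har (hp ▸ hal)

/-! ### Binary search along a path -/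

/-- The variable found by the binary search from `x` along the path that flips the variables of
`π` in this order. -/
def bsVal {n : ℕ} (f : Cube n → Bool) (x : Cube n) (π : List (Var n)) : Option (Var n) :=
  if f x = f (flipSet x π.toFinset) then none
  else π[bsIdx (fun t => f (pathPoint x π t)) (f x) 0 π.length - 1]?

lemma ex_binarySearchLoop {n : ℕ} (f : Cube n → Bool) (x : Cube n) (π : List (Var n)) (a : Bool)
    (l r : ℕ) (g : Option (Var n) → ℝ≥0∞) :
    ex ((binarySearchLoop x π a l r).law f) (fun o => g (o.map Prod.fst)) =
      g π[bsIdx (fun t => f (pathPoint x π t)) a l r - 1]? := by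
  induction l, r using bsIdx.induct (fun t => f (pathPoint x π t)) a with
  | case1 l r h1 h2 ih =>
    rw [binarySearchLoop, if_pos h1, QueryAlg.law, if_pos h2, ih, bsIdx.eq_def _ a l r, if_pos h1, if_pos h2]
  | case2 l r h1 h2 ih =>
    rw [binarySearchLoop, if_pos h1, QueryAlg.law, if_neg h2, ih, bsIdx.eq_def _ a l r, if_pos h1, if_neg h2]
  | case3 l r h1 =>
    rw [binarySearchLoop, if_neg h1, QueryAlg.law, ex_pure, bsIdx, if_neg h1]
    cases π[r - 1]? <;> rfl

lemma ex_binarySearch {n : ℕ} (f : Cube n → Bool) (x : Cube n) (π : List (Var n))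
    (g : Option (Var n) → ℝ≥0∞) :
    ex ((binarySearch x π).law f) (fun o => g (o.map Prod.fst)) = g (bsVal f x π) := by
  rw [binarySearch, QueryAlg.law, QueryAlg.law, bsVal]
  split_ifs with h
  · rw [QueryAlg.law, ex_pure]; rfl
  · exact ex_binarySearchLoop f x π _ _ _ g

lemma bsVal_mem {n : ℕ} {f : Cube n → Bool} {x : Cube n} {π : List (Var n)} {v : Var n}
    (h : bsVal f x π = some v) : v ∈ π := by
  unfold bsVal at h
  split_ifs at h with h1
  exact List.mem_of_getElem? h

lemma queriesAtMost_binarySearchLoop {n : ℕ} (x : Cube n) (π : List (Var n)) (a : Bool)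
    (l r : ℕ) : (binarySearchLoop x π a l r).QueriesAtMost (Nat.clog 2 (r - l)) := by
  induction k : r - l using Nat.strong_induction_on generalizing l r with
  | _ k ih =>
    subst k
    rw [binarySearchLoop]
    split_ifs with h
    · have e : Nat.clog 2 (r - l) = Nat.clog 2 ((r - l + 2 - 1) / 2) + 1 :=
        Nat.clog_of_two_le (by norm_num) h
      refine ⟨by omega, fun b => ?_⟩
      beta_reduce
      split_ifs with hb
      · exact (ih _ (by omega) _ _ rfl).mono (by
          rw [e, Nat.add_sub_cancel]; exact Nat.clog_mono_right 2 (by omega))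
      · exact (ih _ (by omega) _ _ rfl).mono (by
          rw [e, Nat.add_sub_cancel]; exact Nat.clog_mono_right 2 (by omega))
    · trivial

lemma queriesAtMost_binarySearch {n : ℕ} (x : Cube n) (π : List (Var n)) :
    (binarySearch x π).QueriesAtMost (2 + Nat.clog 2 π.length) := by
  refine ⟨by omega, fun a => ⟨by omega, fun b => ?_⟩⟩
  beta_reduce
  split_ifs with h
  · trivial
  · exact (queriesAtMost_binarySearchLoop x π a 0 π.length).mono (by simp)

/-! ### Replacing a variable by the placeholder in a binary search -/

lemma pathPoint_append_le {n : ℕ} (x : Cube n) (A B : List (Var n)) (v w : Var n) {t : ℕ}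
    (ht : t ≤ A.length) : pathPoint x (A ++ v :: B) t = pathPoint x (A ++ w :: B) t := by
  unfold pathPoint
  rw [List.take_append_of_le_length ht, List.take_append_of_le_length ht]

lemma pathPoint_append_gt {n : ℕ} (x : Cube n) {A B : List (Var n)} {i : Fin n}
    (hA : some i ∉ A) (hB : some i ∉ B) {t : ℕ} (ht : A.length < t) :
    pathPoint x (A ++ some i :: B) t = flipVar (pathPoint x (A ++ none :: B) t) i := by
  unfold pathPoint
  obtain ⟨k, rfl⟩ : ∃ k, t = A.length + (k + 1) := ⟨t - A.length - 1, by omega⟩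
  have hB' : some i ∉ B.take k := fun h => hB (List.mem_of_mem_take h)
  rw [List.take_length_add_append, List.take_length_add_append, List.take_succ_cons,
    List.take_succ_cons]
  funext j
  unfold flipVar flipSet
  simp only [List.mem_toFinset, List.mem_append, List.mem_cons, Finset.mem_singleton,
    Option.some.injEq, reduceCtorEq, false_or]
  by_cases hj : j = i
  · subst hj; simp [hA, hB']
  · simp [hj]

lemma pathPoint_flipVar {n : ℕ} (x : Cube n) (π : List (Var n)) (t : ℕ) (i : Fin n) :
    pathPoint (flipVar x i) π t = flipVar (pathPoint x π t) i := (flipVar_flipSet _ _ _).symm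

/-- The positions on a path of length `len` whose values must not depend on `i` for the binary
search not to notice that the `(p + 1)`-st flip is that of `i`. -/
def checkNodes (p len : ℕ) : List ℕ := 0 :: len :: fixedNodes p 0 len

lemma length_checkNodes (p len : ℕ) : (checkNodes p len).length ≤ 2 + Nat.clog 2 len := by
  have := length_fixedNodes p 0 len
  simp [checkNodes] at *; omega

lemma pathPoint_length {n : ℕ} (x : Cube n) (π : List (Var n)) :
    pathPoint x π π.length = flipSet x π.toFinset := by simp [pathPoint]

lemma pathPoint_zero {n : ℕ} (x : Cube n) (π : List (Var n)) : pathPoint x π 0 = x := by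
  funext k; simp [pathPoint, flipSet]

/-- If `f` is insensitive to `i` at the check nodes, the two searches from `x` and from `x` with `i`
flipped have the same pair of results whether the step after `A` flips `i` or the placeholder, and
they do not return `i`. -/
lemma bsVal_swap {n : ℕ} (f : Cube n → Bool) (x : Cube n) {A B : List (Var n)} {i : Fin n}
    (hA : some i ∉ A) (hB : some i ∉ B)
    (good : ∀ u ∈ checkNodes A.length (A ++ none :: B).length,
      f (pathPoint x (A ++ none :: B) u) = f (flipVar (pathPoint x (A ++ none :: B) u) i)) :
    ((bsVal f x (A ++ some i :: B) = bsVal f x (A ++ none :: B) ∧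
      bsVal f (flipVar x i) (A ++ some i :: B) = bsVal f (flipVar x i) (A ++ none :: B)) ∨
    (bsVal f x (A ++ some i :: B) = bsVal f (flipVar x i) (A ++ none :: B) ∧
      bsVal f (flipVar x i) (A ++ some i :: B) = bsVal f x (A ++ none :: B))) ∧
    bsVal f x (A ++ some i :: B) ≠ some (some i) ∧
    bsVal f (flipVar x i) (A ++ some i :: B) ≠ some (some i) := by
  set P := A ++ some i :: B with hP
  set P' := A ++ none :: B with hP'
  have hlen : P'.length = P.length := by simp [hP, hP']
  have hlen' : A.length < P.length := by simp [hP]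
  set a : ℕ → Bool := fun t => f (pathPoint x P' t) with ha
  set b : ℕ → Bool := fun t => f (pathPoint (flipVar x i) P' t) with hb
  set m₁ : ℕ → Bool := fun t => f (pathPoint x P t) with hm₁
  set m₂ : ℕ → Bool := fun t => f (pathPoint (flipVar x i) P t) with hm₂
  -- past the step that flips `i`, the path from `x` continues on the other path from `flipVar x i`
  have hm₁' : ∀ t, m₁ t = if t ≤ A.length then a t else b t := by
    intro t
    split_ifs with ht
    · simp only [hm₁, ha, hP, hP', pathPoint_append_le x A B (some i) none ht]
    · simp only [hm₁, hb, hP, hP', pathPoint_append_gt x hA hB (not_le.1 ht), pathPoint_flipVar]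
  have hm₂' : ∀ t, m₂ t = if t ≤ A.length then b t else a t := by
    intro t
    split_ifs with ht
    · simp only [hm₂, hb, hP, hP', pathPoint_append_le _ A B (some i) none ht]
    · simp only [hm₂, ha, hP, hP', pathPoint_append_gt _ hA hB (not_le.1 ht), pathPoint_flipVar,
        flipVar_flipVar]
  have hab : ∀ u ∈ checkNodes A.length P'.length, a u = b u := by
    intro u hu
    simp only [ha, hb, pathPoint_flipVar]; exact good u hu
  have h0 : a 0 = b 0 := hab 0 (by simp [checkNodes])
  have h1 : a P'.length = b P'.length := hab _ (by simp [checkNodes])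
  have e0 : f (flipVar x i) = f x := by
    simpa only [ha, hb, pathPoint_zero] using h0.symm
  have ea0 : a 0 = f x := by simp only [ha, pathPoint_zero]
  have eL : f (flipSet x P'.toFinset) = a P'.length := by simp only [ha, pathPoint_length]
  have eL' : f (flipSet (flipVar x i) P'.toFinset) = a P'.length := by
    rw [h1]; simp only [hb, pathPoint_length]
  have eM : f (flipSet x P.toFinset) = a P'.length := by
    rw [← pathPoint_length]
    have := hm₁' P.length
    rw [if_neg (by omega), ← hlen, ← h1] at this
    rw [← hlen]; exact this
  have eM' : f (flipSet (flipVar x i) P.toFinset) = a P'.length := by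
    rw [← pathPoint_length]
    have := hm₂' P.length
    rw [if_neg (by omega), ← hlen] at this
    rw [← hlen]; exact this
  have hstep : a A.length = a (A.length + 1) := by
    simp only [ha]
    congr 1
    funext j
    simp [pathPoint, hP', flipSet, List.take_append, List.take_of_length_le (Nat.le_succ A.length)]
  unfold bsVal
  rw [e0, eL, eL', eM, eM']
  rw [hlen]
  by_cases hc : f x = a P.length
  · simp only [if_pos hc]; simp
  · simp only [if_neg hc]
    have key := bsIdx_mix (f x) hm₁' hm₂' hstep 0 P.length (Nat.zero_le _) hlen'
      (fun u hu => hab u (by rw [hlen]; simp [checkNodes, hu])) ea0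
      (fun h => hc h.symm)
    have hget : ∀ k, k ≠ A.length → P[k]? = P'[k]? := by
      intro k hk
      rw [hP, hP', List.getElem?_append, List.getElem?_append]
      split_ifs with hk'
      · rfl
      · obtain ⟨j, hj⟩ : ∃ j, k - A.length = j + 1 := ⟨k - A.length - 1, by omega⟩
        rw [hj, List.getElem?_cons_succ, List.getElem?_cons_succ]
    have hne : ∀ k, k ≠ A.length → P[k]? ≠ some (some i) := by
      intro k hk h
      rw [hP, List.getElem?_append] at h
      split_ifs at h with hk'
      · exact hA (List.mem_of_getElem? h)
      · obtain ⟨j, hj⟩ : ∃ j, k - A.length = j + 1 := ⟨k - A.length - 1, by omega⟩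
        rw [hj, List.getElem?_cons_succ] at h
        exact hB (List.mem_of_getElem? h)
    obtain ⟨key1, key2, key3⟩ := key
    have p1 := bsIdx_mem a (f x) 0 P.length (by omega)
    have p2 := bsIdx_mem b (f x) 0 P.length (by omega)
    have na : bsIdx a (f x) 0 P.length - 1 ≠ A.length := by omega
    have nb : bsIdx b (f x) 0 P.length - 1 ≠ A.length := by omega
    rcases key1 with ⟨k1, k2⟩ | ⟨k1, k2⟩
    · rw [k1, k2]
      exact ⟨Or.inl ⟨hget _ na, hget _ nb⟩, hne _ na, hne _ nb⟩
    · rw [k1, k2]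
      exact ⟨Or.inr ⟨hget _ nb, hget _ na⟩, hne _ nb, hne _ na⟩

/-- The point at a fixed position of the path from a uniform point is uniform. -/
lemma card_sensitive_le {n : ℕ} (f : Cube n → Bool) (i : Fin n) (π : List (Var n)) (u : ℕ) :
    ((Finset.univ.filter fun x : Cube n =>
      f (pathPoint x π u) ≠ f (flipVar (pathPoint x π u) i)).card : ℝ≥0∞) =
      ENNReal.ofReal (influence f i) * 2 ^ n := by
  have h1 : (Finset.univ.filter fun x : Cube n =>
      f (pathPoint x π u) ≠ f (flipVar (pathPoint x π u) i)).card =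
      (Finset.univ.filter fun x : Cube n => f x ≠ f (flipVar x i)).card := by
    refine Finset.card_equiv (flipEquiv (π.take u).toFinset) fun x => ?_
    simp only [Finset.mem_filter, Finset.mem_univ, true_and]
    rfl
  rw [h1, influence, ENNReal.ofReal_div_of_pos (by positivity), ENNReal.ofReal_natCast,
    ENNReal.ofReal_pow (by norm_num), ENNReal.ofReal_ofNat]
  rw [ENNReal.div_mul_cancel (by positivity) (by finiteness)]

/-- The expected result of a binary search from a uniform point hardly changes when a variable of
small influence is replaced by the placeholder. -/
lemma sum_bsVal_swap_le {n : ℕ} (f : Cube n → Bool) {P : List (Var n)} {i : Fin n}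
    (hP : P.Nodup) (hn : none ∉ P) {g h : Option (Var n) → ℝ≥0∞} (hg : ∀ o, g o ≤ 1)
    (h0 : g none ≤ h none) (hgh : ∀ v ∈ P, v ≠ some i → g (some v) ≤ h (some v)) :
    ∑ x, g (bsVal f x P) ≤ ∑ x, h (bsVal f x (P.map (swapVar i))) +
      (2 + Nat.clog 2 P.length : ℕ) * ENNReal.ofReal (influence f i) * 2 ^ n := by
  by_cases hi : some i ∈ P
  swap
  · have e : P.map (swapVar i) = P := by
      conv_rhs => rw [← List.map_id P]
      refine List.map_congr_left fun v hv => ?_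
      exact swapVar_of_ne (fun h => hn (h ▸ hv)) (fun h => hi (h ▸ hv))
    rw [e]
    refine le_add_right (Finset.sum_le_sum fun x _ => ?_)
    rcases hv : bsVal f x P with _ | v
    · exact h0
    · exact hgh v (bsVal_mem hv) fun h => hi (h ▸ bsVal_mem hv)
  obtain ⟨A, B, rfl⟩ := List.append_of_mem hi
  have hAB : some i ∉ A ∧ some i ∉ B := by
    rw [List.nodup_append] at hP
    obtain ⟨h1, h2, h3⟩ := hP
    exact ⟨fun h => h3 _ h _ List.mem_cons_self rfl, (List.nodup_cons.1 h2).1⟩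
  have e : (A ++ some i :: B).map (swapVar i) = A ++ none :: B := by
    have : ∀ C : List (Var n), (∀ v ∈ C, v ≠ none ∧ v ≠ some i) → C.map (swapVar i) = C := by
      intro C hC
      conv_rhs => rw [← List.map_id C]
      exact List.map_congr_left fun v hv => swapVar_of_ne (hC v hv).1 (hC v hv).2
    rw [List.map_append, List.map_cons, swapVar_some, this A, this B]
    · exact fun v hv => ⟨fun h => hn (by simp [h ▸ hv]), fun h => hAB.2 (h ▸ hv)⟩
    · exact fun v hv => ⟨fun h => hn (by simp [h ▸ hv]), fun h => hAB.1 (h ▸ hv)⟩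
  rw [e]
  set P' := A ++ none :: B with hP'
  set nodes := checkNodes A.length P'.length with hnodes
  set bad : Cube n → Prop := fun x => ∃ u ∈ nodes,
    f (pathPoint x P' u) ≠ f (flipVar (pathPoint x P' u) i) with hbad
  have hgh' : ∀ x y, bsVal f x (A ++ some i :: B) = bsVal f y P' →
      bsVal f x (A ++ some i :: B) ≠ some (some i) →
      g (bsVal f x (A ++ some i :: B)) ≤ h (bsVal f y P') := by
    intro x y hxy hne
    rw [← hxy]
    rcases hv : bsVal f x (A ++ some i :: B) with _ | v
    · exact h0
    · exact hgh v (bsVal_mem hv) fun h => hne (by rw [hv, h])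
  -- only the sum over `x` and `flipVar x i` can be compared, as the two results may be exchanged
  have pt : ∀ x, g (bsVal f x (A ++ some i :: B)) + g (bsVal f (flipVar x i) (A ++ some i :: B)) ≤
      (h (bsVal f x P') + h (bsVal f (flipVar x i) P')) + 2 * ind (bad x) := by
    intro x
    by_cases hx : bad x
    · rw [ind_of hx]
      exact le_add_left ((add_le_add (hg _) (hg _)).trans (by norm_num))
    · simp only [hbad, not_exists, not_and, not_not] at hx
      obtain ⟨h1, h2, h3⟩ := bsVal_swap f x hAB.1 hAB.2 hx
      refine le_add_right ?_
      rcases h1 with ⟨k1, k2⟩ | ⟨k1, k2⟩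
      · exact add_le_add (hgh' _ _ k1 h2) (hgh' _ _ k2 h3)
      · rw [add_comm (h _)]; exact add_le_add (hgh' _ _ k1 h2) (hgh' _ _ k2 h3)
  have hsum := Finset.sum_le_sum fun x (_ : x ∈ Finset.univ) => pt x
  have hflip : ∀ F : Cube n → ℝ≥0∞, ∑ x, F (flipVar x i) = ∑ x, F x := fun F =>
    Equiv.sum_comp (flipEquiv {some i}) F
  rw [Finset.sum_add_distrib, Finset.sum_add_distrib, Finset.sum_add_distrib,
    hflip (fun x => g (bsVal f x (A ++ some i :: B))), hflip (fun x => h (bsVal f x P')),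
    ← two_mul, ← two_mul, ← Finset.mul_sum, ← mul_add] at hsum
  have hsum' := (ENNReal.mul_le_mul_iff_right (by norm_num) (by norm_num)).1 hsum
  refine hsum'.trans (by
    gcongr
    calc ∑ x, ind (bad x) ≤ ∑ x, (nodes.map fun u =>
          ind (f (pathPoint x P' u) ≠ f (flipVar (pathPoint x P' u) i))).sum := by
          refine Finset.sum_le_sum fun x _ => ?_
          by_cases hx : bad x
          · obtain ⟨u, hu, hux⟩ := hx
            refine (ind_le_one _).trans ?_
            rw [← ind_of hux]
            exact List.single_le_sum (fun _ _ => zero_le) _ (List.mem_map_of_mem hu)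
          · rw [ind_of_not hx]; exact zero_le
      _ = (nodes.map fun _ => ENNReal.ofReal (influence f i) * 2 ^ n).sum := by
          clear_value nodes
          clear hsum hsum' pt hbad bad hnodes
          induction nodes with
          | nil => simp
          | cons u us ih =>
            simp only [List.map_cons, List.sum_cons, Finset.sum_add_distrib]
            rw [ih, ← card_sensitive_le f i P' u]
            congr 1
            exact sum_ind _ _
      _ ≤ _ := by
          rw [List.map_const', List.sum_replicate, nsmul_eq_mul, mul_assoc]
          gcongr
          have := length_checkNodes A.length P'.length
          simpa [hnodes, hP'] using this)

/-! ### Replacing a variable by the placeholder in `Preprocess` -/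

lemma ex_comm {α β : Type} (p : PMF α) (q : PMF β) (F : α → β → ℝ≥0∞) :
    ex p (fun a => ex q fun b => F a b) = ex q fun b => ex p fun a => F a b := by
  unfold ex
  simp_rw [← ENNReal.tsum_mul_left]
  rw [ENNReal.tsum_comm]
  refine tsum_congr fun b => tsum_congr fun a => ?_
  ring

lemma filter_map_swap {n : ℕ} (i : Fin n) (L : List (Var n)) (T : Finset (Var n)) :
    (L.map (swapVar i)).filter (fun v => decide (v ∈ swapSet i T)) =
      (L.filter fun v => decide (v ∈ T)).map (swapVar i) := by
  rw [List.filter_map]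
  congr 1
  refine List.filter_congr fun v _ => ?_
  simp [mem_swapSet, swapVar_swapVar]

lemma toFinset_map_swap {n : ℕ} (i : Fin n) (L : List (Var n)) :
    (L.map (swapVar i)).toFinset = swapSet i L.toFinset := by
  ext v
  rw [mem_swapSet, List.mem_toFinset, List.mem_toFinset, List.mem_map]
  exact ⟨fun ⟨w, hw, e⟩ => by rw [← e, swapVar_swapVar]; exact hw,
    fun h => ⟨_, h, swapVar_swapVar v⟩⟩

/-- Exchanging `i` and the placeholder, as a permutation of the sets of variables. -/
def swapSetEquiv {n : ℕ} (i : Fin n) : Equiv.Perm (Finset (Var n)) where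
  toFun := swapSet i
  invFun := swapSet i
  left_inv := swapSet_swapSet i
  right_inv := swapSet_swapSet i

lemma swapSet_subset_swapSet {n : ℕ} {i : Fin n} {S T : Finset (Var n)} :
    swapSet i S ⊆ swapSet i T ↔ S ⊆ T := Finset.map_subset_map

lemma ex_powersetCard_swap {n : ℕ} (i : Fin n) (S : Finset (Var n)) {k : ℕ} (hk : k ≤ S.card)
    (F : Finset (Var n) → ℝ≥0∞) :
    ex (uniformOn ((swapSet i S).powersetCard k)) F =
      ex (uniformOn (S.powersetCard k)) fun T => F (swapSet i T) := by
  have h1 : ((swapSet i S).powersetCard k).Nonempty :=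
    Finset.powersetCard_nonempty.2 (by rwa [card_swapSet])
  have h2 : (S.powersetCard k).Nonempty := Finset.powersetCard_nonempty.2 hk
  rw [ex_uniformOn h1, ex_uniformOn h2, Finset.card_powersetCard, Finset.card_powersetCard,
    card_swapSet]
  congr 1
  symm
  refine Finset.sum_equiv (swapSetEquiv i) (fun T => ?_) fun T _ => rfl
  simp only [swapSetEquiv, Equiv.coe_fn_mk, Finset.mem_powersetCard, card_swapSet,
    swapSet_subset_swapSet]

lemma half_le_length {n : ℕ} {L : List (Var n)} (hL : L.Nodup) (h : L ≠ []) (coin : Bool) :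
    (if coin then L.length / 2 else L.length / 2 + 1) ≤ L.toFinset.card := by
  rw [List.toFinset_card_of_nodup hL]
  have : 0 < L.length := List.length_pos_of_ne_nil h
  split_ifs <;> omega

lemma ex_checkRounds_succ {n : ℕ} (f : Cube n → Bool) (L : List (Var n)) (N : ℕ)
    (g : Option (Var n) → ℝ≥0∞) :
    ex ((checkRounds L (N + 1)).law f) g =
      ex (PMF.uniformOfFintype Bool) fun coin =>
      ex (uniformOn (L.toFinset.powersetCard (if coin then L.length / 2 else L.length / 2 + 1)))
        fun T => ex (PMF.uniformOfFintype (Cube n)) fun x =>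
          (fun o : Option (Var n) => match o with
            | some v => g (some v)
            | none => ex ((checkRounds L N).law f) g)
            (bsVal f x (L.filter fun v => decide (v ∈ T))) := by
  rw [checkRounds, QueryAlg.law, ex_bind]
  simp only [QueryAlg.law, ex_bind, QueryAlg.law_bind]
  rw [ex_comm]
  congr 1
  funext coin
  rw [ex_comm]
  congr 1
  funext T
  congr 1
  funext x
  refine Eq.trans ?_ (ex_binarySearch f x _ fun o : Option (Var n) => match o with
    | some v => g (some v)
    | none => ex ((checkRounds L N).law f) g)
  congr 1
  funext o
  rcases o with _ | v
  · rfl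
  · simp [QueryAlg.law, ex_pure]

/-- The bound on the change caused in one round by replacing a variable by the placeholder, in a
list of at most `M` variables. -/
def roundErr {n : ℕ} (f : Cube n → Bool) (i : Fin n) (M : ℕ) : ℝ≥0∞ :=
  (2 + Nat.clog 2 M : ℕ) * ENNReal.ofReal (influence f i)

/-- Replacing `i` by the placeholder hardly changes the law of the first variable found in `N`
rounds. -/
lemma ex_checkRounds_swap_le {n : ℕ} (f : Cube n → Bool) {L : List (Var n)} {i : Fin n} {M : ℕ}
    (hL : L.Nodup) (hne : L ≠ []) (hn : none ∉ L) (hM : L.length ≤ M) (N : ℕ)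
    {g h : Option (Var n) → ℝ≥0∞} (hg : ∀ o, g o ≤ 1)
    (h0 : g none ≤ h none) (hgh : ∀ v ∈ L, v ≠ some i → g (some v) ≤ h (some v)) :
    ex ((checkRounds L N).law f) g ≤
      ex ((checkRounds (L.map (swapVar i)) N).law f) h + N * roundErr f i M := by
  induction N with
  | zero => simpa [checkRounds, QueryAlg.law, ex_pure] using h0
  | succ N ih =>
    rw [ex_checkRounds_succ, ex_checkRounds_succ]
    have step : ∀ coin : Bool, ex (uniformOn (L.toFinset.powersetCard
          (if coin then L.length / 2 else L.length / 2 + 1)))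
        (fun T => ex (PMF.uniformOfFintype (Cube n)) fun x =>
          (fun o : Option (Var n) => match o with
            | some v => g (some v)
            | none => ex ((checkRounds L N).law f) g)
            (bsVal f x (L.filter fun v => decide (v ∈ T)))) ≤
        ex (uniformOn ((L.map (swapVar i)).toFinset.powersetCard
          (if coin then (L.map (swapVar i)).length / 2 else (L.map (swapVar i)).length / 2 + 1)))
        (fun T => ex (PMF.uniformOfFintype (Cube n)) fun x =>
          (fun o : Option (Var n) => match o with
            | some v => h (some v)
            | none => ex ((checkRounds (L.map (swapVar i)) N).law f) h)
            (bsVal f x ((L.map (swapVar i)).filter fun v => decide (v ∈ T)))) +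
        (N + 1 : ℕ) * roundErr f i M := by
      intro coin
      rw [List.length_map, toFinset_map_swap, ex_powersetCard_swap i _ (half_le_length hL hne coin),
        ← ex_const (uniformOn (L.toFinset.powersetCard
          (if coin then L.length / 2 else L.length / 2 + 1))) ((N + 1 : ℕ) * roundErr f i M),
        ← ex_add]
      refine ex_mono fun T => ?_
      rw [filter_map_swap, ex_uniformOfFintype, ex_uniformOfFintype]
      -- compare one binary search, with the expected outcome of the other rounds as test functions
      have key := sum_bsVal_swap_le f (P := L.filter fun v => decide (v ∈ T)) (i := i)
        (hL.filter _) (fun h => hn (List.mem_of_mem_filter h))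
        (g := fun o : Option (Var n) => match o with
            | some v => g (some v)
            | none => ex ((checkRounds L N).law f) g)
        (h := fun o : Option (Var n) => match o with
            | some v => h (some v) + N * roundErr f i M
            | none => ex ((checkRounds (L.map (swapVar i)) N).law f) h + N * roundErr f i M)
        (by
          rintro (_ | v)
          · exact ex_le_const hg
          · exact hg _)
        ih (fun v hv hvi => le_add_right (hgh v (List.mem_of_mem_filter hv) hvi))
      have hc : (Fintype.card (Cube n) : ℝ≥0∞) = 2 ^ n := by simp
      rw [hc]
      have h2 : (2 : ℝ≥0∞) ^ n ≠ 0 := by positivity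
      have h2' : (2 : ℝ≥0∞) ^ n ≠ ⊤ := by finiteness
      rw [ENNReal.div_le_iff h2 h2', add_mul, ENNReal.div_mul_cancel h2 h2']
      refine key.trans ?_
      have e : ∀ o : Option (Var n), (match o with
            | some v => h (some v) + N * roundErr f i M
            | none => ex ((checkRounds (L.map (swapVar i)) N).law f) h + N * roundErr f i M) =
          (match o with
            | some v => h (some v)
            | none => ex ((checkRounds (L.map (swapVar i)) N).law f) h) + N * roundErr f i M := by
        rintro (_ | v) <;> rfl
      simp only [e]
      rw [Finset.sum_add_distrib, Finset.sum_const, Finset.card_univ, nsmul_eq_mul, hc, add_assoc]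
      gcongr
      rw [Nat.cast_succ, add_mul, one_mul, add_mul, mul_comm ((2 : ℝ≥0∞) ^ n)]
      gcongr
      unfold roundErr
      gcongr
      exact (List.length_filter_le _ _).trans hM
    rw [← ex_const (PMF.uniformOfFintype Bool) ((N + 1 : ℕ) * roundErr f i M), ← ex_add]
    exact ex_mono step

/-- The number of rounds of `CheckPersistence`, as in the definition of `checkPersistence`. -/
def numRounds (n : ℕ) (ξ : ℝ) : ℕ := ⌈Real.logb 2 n ^ 4 / ξ⌉₊

/-- The run on a list with `i` and the run with `i` replaced by the placeholder are compared round
by round; neither of them removes `i` or the placeholder, up to the error. -/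
lemma ex_preprocessLoop_swap_le {n : ℕ} (f : Cube n → Bool) {i : Fin n} {M : ℕ} (ξ : ℝ) (N : ℕ)
    {L : List (Var n)} (hL : L.Nodup) (hi : some i ∈ L) (hn : none ∉ L) (hM : L.length ≤ M)
    {g h : Finset (Var n) → ℝ≥0∞} (hg : ∀ S, g S ≤ 1)
    (hgh : ∀ S : Finset (Var n), some i ∈ S → none ∉ S → S.card ≤ M → g S ≤ h (swapSet i S)) :
    ex ((preprocessLoop ξ N L).law f) g ≤
      ex ((preprocessLoop ξ N (L.map (swapVar i))).law f) h +
        N * (numRounds n ξ * roundErr f i M) := by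
  induction N generalizing L with
  | zero =>
    simp only [preprocessLoop, QueryAlg.law, ex_pure, Nat.cast_zero, zero_mul, add_zero]
    rw [toFinset_map_swap]
    exact hgh _ (by simpa using hi) (by simpa using hn)
      ((List.toFinset_card_le L).trans hM)
  | succ N ih =>
    have hne : L ≠ [] := List.ne_nil_of_mem hi
    have hne' : L.map (swapVar i) ≠ [] := by simpa using hne
    rw [preprocessLoop, if_neg hne, preprocessLoop, if_neg hne', QueryAlg.law_bind,
      QueryAlg.law_bind, ex_bind, ex_bind]
    set h' : Option (Var n) → ℝ≥0∞ := fun o => ex (QueryAlg.law f (match o with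
      | none => QueryAlg.ret (L.map (swapVar i)).toFinset
      | some j => preprocessLoop ξ N ((L.map (swapVar i)).erase j))) h with hh'
    have key := ex_checkRounds_swap_le f hL hne hn hM (numRounds n ξ)
      (g := fun o => ex (QueryAlg.law f (match o with
        | none => QueryAlg.ret L.toFinset
        | some j => preprocessLoop ξ N (L.erase j))) g)
      (h := fun o => h' o + N * (numRounds n ξ * roundErr f i M)) (fun o => ex_le_const hg)
      (by
        simp only [hh', QueryAlg.law, ex_pure]
        rw [toFinset_map_swap]
        exact le_add_right (hgh _ (by simpa using hi) (by simpa using hn)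
          ((List.toFinset_card_le L).trans hM)))
      (by
        intro v hv hvi
        have hvn : v ≠ none := fun e => hn (e ▸ hv)
        have e : (L.map (swapVar i)).erase v = (L.erase v).map (swapVar i) := by
          rw [List.map_erase (swapVar i).injective, swapVar_of_ne hvn hvi]
        simp only [hh']
        rw [e]
        exact ih (hL.erase v) ((List.mem_erase_of_ne hvi.symm).2 hi)
          (fun h => hn (List.mem_of_mem_erase h)) ((List.length_erase_le).trans hM))
    refine (key : _ ≤ _).trans ?_
    rw [ex_add, ex_const]
    push_cast
    rw [add_mul, one_mul, add_assoc]
    rfl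

/-! ### Preprocessing a set in a uniform order -/

/-- Run `Preprocess` on `S` with a uniform ordering. -/
def preSet {n : ℕ} (S : Finset (Var n)) (ξ : ℝ) : QueryAlg n (Finset (Var n)) :=
  QueryAlg.draw (Fin S.card ≃ {v : Var n // v ∈ S}) (PMF.uniformOfFintype _) fun π =>
    preprocess (List.ofFn fun j => (π j : Var n)) ξ

lemma nodup_ordering {n : ℕ} {S : Finset (Var n)} (π : Fin S.card ≃ {v : Var n // v ∈ S}) :
    (List.ofFn fun j => (π j : Var n)).Nodup :=
  List.nodup_ofFn.2 (Subtype.val_injective.comp π.injective)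

lemma mem_ordering {n : ℕ} {S : Finset (Var n)} (π : Fin S.card ≃ {v : Var n // v ∈ S})
    {v : Var n} : v ∈ (List.ofFn fun j => (π j : Var n)) ↔ v ∈ S := by
  rw [List.mem_ofFn]
  exact ⟨fun ⟨j, hj⟩ => hj ▸ (π j).2, fun h => ⟨π.symm ⟨v, h⟩, by simp⟩⟩

/-- The orderings of `S` correspond to those of the set where `i` and the placeholder are
exchanged. -/
def swapOrdering {n : ℕ} (i : Fin n) (S : Finset (Var n)) :
    (Fin S.card ≃ {v : Var n // v ∈ S}) ≃
      (Fin (swapSet i S).card ≃ {v : Var n // v ∈ swapSet i S}) :=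
  Equiv.equivCongr (finCongr (card_swapSet i S).symm)
    ((swapVar i).subtypeEquiv fun v => by rw [mem_swapSet, swapVar_swapVar])

lemma ofFn_swapOrdering {n : ℕ} (i : Fin n) (S : Finset (Var n))
    (π : Fin S.card ≃ {v : Var n // v ∈ S}) :
    (List.ofFn fun j => (swapOrdering i S π j : Var n)) =
      (List.ofFn fun j => (π j : Var n)).map (swapVar i) := by
  rw [List.map_ofFn]
  refine List.ext_getElem (by simp [card_swapSet]) fun k h1 h2 => ?_
  simp [swapOrdering]

/-- Replacing `i` by the placeholder hardly changes the law of the output of `Preprocess`. -/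
lemma ex_preSet_swap_le {n : ℕ} (f : Cube n → Bool) {i : Fin n} (ξ : ℝ)
    {S₀ : Finset (Var n)} (hi : some i ∈ S₀) (hn : none ∉ S₀)
    {g h : Finset (Var n) → ℝ≥0∞} (hg : ∀ S, g S ≤ 1)
    (hgh : ∀ S : Finset (Var n), some i ∈ S → none ∉ S → S.card ≤ S₀.card →
      g S ≤ h (swapSet i S)) :
    ex ((preSet S₀ ξ).law f) g ≤ ex ((preSet (swapSet i S₀) ξ).law f) h +
        S₀.card * (numRounds n ξ * roundErr f i S₀.card) := by
  rw [preSet, preSet, QueryAlg.law, QueryAlg.law, ex_bind, ex_bind, ex_uniformOfFintype,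
    ex_uniformOfFintype, ← (swapOrdering i S₀).sum_comp, ← Fintype.card_congr (swapOrdering i S₀)]
  have hc0 : (Fintype.card (Fin S₀.card ≃ {v : Var n // v ∈ S₀}) : ℝ≥0∞) ≠ 0 := by
    exact_mod_cast Fintype.card_ne_zero
  have hc1 : (Fintype.card (Fin S₀.card ≃ {v : Var n // v ∈ S₀}) : ℝ≥0∞) ≠ ⊤ := by finiteness
  rw [ENNReal.div_le_iff hc0 hc1, add_mul, ENNReal.div_mul_cancel hc0 hc1, mul_comm (_ * _),
    ← nsmul_eq_mul, ← Finset.card_univ, ← Finset.sum_const, ← Finset.sum_add_distrib]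
  refine Finset.sum_le_sum fun π _ => ?_
  rw [ofFn_swapOrdering]
  have := ex_preprocessLoop_swap_le f (i := i) (M := S₀.card) ξ S₀.card (nodup_ordering π)
    ((mem_ordering π).2 hi) (fun h => hn ((mem_ordering π).1 h)) (by simp) hg hgh
  simpa [preprocess] using this

/-! ### Query counts of `Preprocess` -/

lemma queriesAtMost_checkRounds {n : ℕ} {L : List (Var n)} {M : ℕ} (hM : L.length ≤ M) (N : ℕ) :
    (checkRounds L N).QueriesAtMost (N * (2 + Nat.clog 2 M)) := by
  induction N with
  | zero => trivial
  | succ N ih =>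
    intro x _ coin _ T _
    have h1 := List.length_filter_le (fun v => decide (v ∈ T)) L
    have h2 := (queriesAtMost_binarySearch x (L.filter fun v => decide (v ∈ T))).mono
      (Nat.add_le_add_left (Nat.clog_mono_right 2 (h1.trans hM)) 2)
    rw [Nat.add_mul, one_mul, add_comm]
    refine h2.bind fun o => ?_
    rcases o with _ | v
    · exact ih
    · trivial

lemma queriesAtMost_preprocessLoop {n : ℕ} {M : ℕ} (ξ : ℝ) (N : ℕ) {L : List (Var n)}
    (hM : L.length ≤ M) : (preprocessLoop ξ N L).QueriesAtMost
      (N * (numRounds n ξ * (2 + Nat.clog 2 M))) := by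
  induction N generalizing L with
  | zero => trivial
  | succ N ih =>
    rw [preprocessLoop]
    split_ifs with h
    · trivial
    · rw [Nat.add_mul, one_mul, add_comm]
      refine (queriesAtMost_checkRounds hM _).bind fun o => ?_
      rcases o with _ | v
      · trivial
      · exact ih (List.length_erase_le.trans hM)

lemma queriesAtMost_preSet {n : ℕ} (S : Finset (Var n)) (ξ : ℝ) : (preSet S ξ).QueriesAtMost
    (S.card * (numRounds n ξ * (2 + Nat.clog 2 S.card))) := by
  intro π _
  have := queriesAtMost_preprocessLoop (M := S.card) ξ S.card
    (L := List.ofFn fun j => (π j : Var n)) (by simp)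
  simpa [preprocess] using this

/-- `Preprocess` outputs a subset of the initial set. -/
lemma preSet_subset {n : ℕ} {f : Cube n → Bool} {S T : Finset (Var n)} {ξ : ℝ}
    (h : T ∈ ((preSet S ξ).law f).support) : T ⊆ S := by
  rw [preSet, QueryAlg.law, PMF.mem_support_bind_iff] at h
  obtain ⟨π, -, h⟩ := h
  have key : ∀ N, ∀ L : List (Var n), T ∈ ((preprocessLoop ξ N L).law f).support →
      T ⊆ L.toFinset := by
    intro N
    induction N with
    | zero => intro L hT; simp [preprocessLoop, QueryAlg.law] at hT; rw [hT]
    | succ N ih =>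
      intro L hT
      rw [preprocessLoop] at hT
      split_ifs at hT with hL
      · simp [QueryAlg.law] at hT; rw [hT]; exact Finset.empty_subset _
      · rw [QueryAlg.law_bind, PMF.mem_support_bind_iff] at hT
        obtain ⟨o, -, hT⟩ := hT
        rcases o with _ | v
        · simp [QueryAlg.law] at hT; rw [hT]
        · refine (ih _ hT).trans fun w hw => ?_
          rw [List.mem_toFinset] at hw ⊢
          exact List.mem_of_mem_erase hw
  intro v hv
  have := key _ _ h hv
  rwa [List.mem_toFinset, mem_ordering] at this

/-! ### Searching for an edge whose endpoints are persistent -/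

/-- The edge along `i` at `x` is monotone if `σ = true`, and anti-monotone if `σ = false`. -/
def IsSignedEdge {n : ℕ} (f : Cube n → Bool) (σ : Bool) (i : Fin n) (x : Cube n) : Prop :=
  IsBichromatic f i x ∧ (x i = f x ↔ σ = true)

/-- Query all the points of a finite sequence. -/
def queryFin {n : ℕ} : (J : ℕ) → (Fin J → Cube n) → QueryAlg n (Fin J → Bool)
  | 0, _ => QueryAlg.ret fun _ => false
  | J + 1, p => QueryAlg.query (p 0) fun b =>
      (queryFin J (Fin.tail p)).bind fun c => QueryAlg.ret (Fin.cons b c)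

lemma law_queryFin {n : ℕ} (f : Cube n → Bool) (J : ℕ) (p : Fin J → Cube n) :
    (queryFin J p).law f = PMF.pure fun j => f (p j) := by
  induction J with
  | zero => rw [queryFin, QueryAlg.law]; congr 1; funext j; exact j.elim0
  | succ J ih =>
    rw [queryFin, QueryAlg.law, QueryAlg.law_bind, ih, PMF.pure_bind, QueryAlg.law]
    congr 1
    funext j
    refine Fin.cases rfl (fun j => rfl) j

lemma queriesAtMost_queryFin {n : ℕ} (J : ℕ) (p : Fin J → Cube n) :
    (queryFin J p).QueriesAtMost J := by
  induction J with
  | zero => trivial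
  | succ J ih =>
    refine ⟨by omega, fun b => ?_⟩
    exact (ih (Fin.tail p)).bind (b := 0) fun c => trivial

/-- The variable `i` is consistent with the observations that flipping `T j` changes the value of
the function if and only if `y j ≠ a`. -/
def Explains {n J : ℕ} (S : Finset (Var n)) (T : Fin J → Finset (Var n)) (a : Bool)
    (y : Fin J → Bool) (i : Fin n) : Prop :=
  some i ∈ S ∧ ∀ j, (some i ∈ T j ↔ a ≠ y j)

open Classical in
/-- A variable that explains the observations, if there is one. -/
def candidate {n J : ℕ} (S : Finset (Var n)) (T : Fin J → Finset (Var n)) (a : Bool)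
    (y : Fin J → Bool) : Option (Fin n) :=
  if h : ∃ i, Explains S T a y i then some h.choose else none

lemma candidate_eq {n J : ℕ} {S : Finset (Var n)} {T : Fin J → Finset (Var n)} {a : Bool}
    {y : Fin J → Bool} {i : Fin n} (hi : Explains S T a y i)
    (huniq : ∀ i', Explains S T a y i' → i' = i) : candidate S T a y = some i := by
  have h : ∃ i, Explains S T a y i := ⟨i, hi⟩
  rw [candidate, dif_pos h, huniq _ h.choose_spec]

/-- Sample a uniform point `x` and `J` uniform subsets of `S` of half its size, determine from the
values of `f` after flipping these subsets a variable `i ∈ S` which alone could be responsible for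
the changes, and output `(i, x)` if the edge along `i` at `x` has the sign `σ`. -/
def sampleEdge {n : ℕ} (σ : Bool) (J : ℕ) (S : Finset (Var n)) :
    QueryAlg n (Option (Fin n × Cube n)) :=
  QueryAlg.draw (Cube n) (PMF.uniformOfFintype (Cube n)) fun x =>
  QueryAlg.draw (Fin J → Finset (Var n))
    (uniformOn (Fintype.piFinset fun _ => S.powersetCard (S.card / 2))) fun T =>
  QueryAlg.query x fun a =>
  (queryFin J fun j => flipSet x (T j)).bind fun y =>
  match candidate S T a y with
  | none => QueryAlg.ret none
  | some i => QueryAlg.query (flipVar x i) fun b =>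
      QueryAlg.ret (if a ≠ b ∧ (x i = a ↔ σ = true) then some (i, x) else none)

lemma queriesAtMost_sampleEdge {n : ℕ} (σ : Bool) (J : ℕ) (S : Finset (Var n)) :
    (sampleEdge σ J S).QueriesAtMost (J + 2) := by
  intro x _ T _
  refine ⟨by omega, fun a => ?_⟩
  refine (QueryAlg.QueriesAtMost.bind (b := 1) (queriesAtMost_queryFin J _) fun y => ?_)
  split
  · trivial
  · exact ⟨le_rfl, fun b => trivial⟩

/-- The outcome of `sampleEdge` as a function of the random choices. -/
def sampleVal {n J : ℕ} (f : Cube n → Bool) (σ : Bool) (S : Finset (Var n)) (x : Cube n)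
    (T : Fin J → Finset (Var n)) : Option (Fin n × Cube n) :=
  match candidate S T (f x) fun j => f (flipSet x (T j)) with
  | none => none
  | some i => if f x ≠ f (flipVar x i) ∧ (x i = f x ↔ σ = true) then some (i, x) else none

lemma law_sampleEdge {n : ℕ} (f : Cube n → Bool) (σ : Bool) (J : ℕ) (S : Finset (Var n)) :
    (sampleEdge σ J S).law f = (PMF.uniformOfFintype (Cube n)).bind fun x =>
      (uniformOn (Fintype.piFinset fun _ : Fin J => S.powersetCard (S.card / 2))).bind fun T =>
        PMF.pure (sampleVal f σ S x T) := by
  rw [sampleEdge, QueryAlg.law]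
  congr 1
  funext x
  rw [QueryAlg.law]
  congr 1
  funext T
  rw [QueryAlg.law, QueryAlg.law_bind, law_queryFin, PMF.pure_bind, sampleVal]
  split <;> rfl

lemma sampleEdge_sound {n : ℕ} (f : Cube n → Bool) (σ : Bool) (J : ℕ) (S : Finset (Var n)) :
    (sampleEdge σ J S).Sound f fun v => IsSignedEdge f σ v.1 v.2 := by
  intro v hv
  rw [law_sampleEdge, PMF.mem_support_bind_iff] at hv
  obtain ⟨x, -, hv⟩ := hv
  rw [PMF.mem_support_bind_iff] at hv
  obtain ⟨T, -, hv⟩ := hv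
  simp only [PMF.support_pure, Set.mem_singleton_iff] at hv
  unfold sampleVal at hv
  split at hv
  · simp at hv
  · split_ifs at hv with h
    · cases hv; exact h

/-! ### Half-size subsets separate variables -/

/-- At most half of the subsets of `S` of half its size contain both or none of two given
elements. -/
lemma two_mul_card_not_separating_le {α : Type} [DecidableEq α] {S : Finset α} {v w : α}
    (hv : v ∈ S) (hw : w ∈ S) (hvw : v ≠ w) :
    2 * ((S.powersetCard (S.card / 2)).filter fun T => (v ∈ T ↔ w ∈ T)).card ≤
      (S.powersetCard (S.card / 2)).card := by
  set P := S.powersetCard (S.card / 2) with hP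
  set R := (S.erase v).erase w with hR
  have hwS : w ∈ S.erase v := Finset.mem_erase.2 ⟨hvw.symm, hw⟩
  have hcS : 2 ≤ S.card := by
    have := Finset.card_le_card (Finset.insert_subset hv (Finset.singleton_subset_iff.2 hw))
    rwa [Finset.card_pair hvw] at this
  have hcR : R.card = S.card - 2 := by
    rw [hR, Finset.card_erase_of_mem hwS, Finset.card_erase_of_mem hv]; omega
  have hvR : v ∉ R := by simp [hR]
  have hwR : w ∉ R := by simp [hR]
  have hRS : R ⊆ S := (Finset.erase_subset _ _).trans (Finset.erase_subset _ _)
  set k := S.card / 2 with hk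
  have hk1 : k - 1 = R.card / 2 := by omega
  -- subsets that avoid both elements
  have h0 : (P.filter fun T => v ∉ T ∧ w ∉ T).card ≤ R.card.choose k := by
    rw [← Finset.card_powersetCard]
    refine Finset.card_le_card fun T hT => ?_
    rw [Finset.mem_filter, hP, Finset.mem_powersetCard] at hT
    refine Finset.mem_powersetCard.2 ⟨fun z hz => ?_, hT.1.2⟩
    simp only [hR, Finset.mem_erase]
    exact ⟨fun e => hT.2.2 (e ▸ hz), fun e => hT.2.1 (e ▸ hz), hT.1.1 hz⟩
  -- subsets that contain both elements
  have h2 : (P.filter fun T => v ∈ T ∧ w ∈ T).card ≤ R.card.choose (k - 1) := by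
    refine le_trans ?_ (hk1 ▸ Nat.choose_le_middle (k - 2) R.card)
    rw [← Finset.card_powersetCard]
    refine Finset.card_le_card_of_injOn (fun T => (T.erase v).erase w) ?_ ?_
    · intro T hT
      simp only [Finset.coe_filter, Set.mem_ofPred_eq, hP, Finset.mem_powersetCard] at hT
      have hwT : w ∈ T.erase v := Finset.mem_erase.2 ⟨hvw.symm, hT.2.2⟩
      refine Finset.mem_coe.2 (Finset.mem_powersetCard.2 ⟨?_, ?_⟩)
      · exact Finset.erase_subset_erase _ (Finset.erase_subset_erase _ hT.1.1)
      · rw [Finset.card_erase_of_mem hwT, Finset.card_erase_of_mem hT.2.1, hT.1.2]; omega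
    · intro T hT T' hT' e
      simp only [Finset.coe_filter, Set.mem_ofPred_eq] at hT hT'
      have e' := congrArg (fun U => insert v (insert w U)) e
      simp only at e'
      rwa [Finset.insert_erase (Finset.mem_erase.2 ⟨hvw.symm, hT.2.2⟩),
        Finset.insert_erase (Finset.mem_erase.2 ⟨hvw.symm, hT'.2.2⟩), Finset.insert_erase hT.2.1,
        Finset.insert_erase hT'.2.1] at e'
  have h0' : R.card.choose k ≤ R.card.choose (k - 1) := hk1 ▸ Nat.choose_le_middle k R.card
  -- subsets that contain exactly one of the elements
  have h1 : ∀ a b : α, a ∉ R → b ∉ R → a ∈ S → a ≠ b →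
      R.card.choose (k - 1) ≤ (P.filter fun T => a ∈ T ∧ b ∉ T).card := by
    intro a b haR hbR haS hab
    rw [← Finset.card_powersetCard]
    refine Finset.card_le_card_of_injOn (fun T => insert a T) ?_ ?_
    · intro T hT
      have hT := Finset.mem_powersetCard.1 (Finset.mem_coe.1 hT)
      simp only [Finset.coe_filter, Set.mem_ofPred_eq, hP, Finset.mem_powersetCard]
      refine ⟨⟨Finset.insert_subset haS (hT.1.trans hRS), ?_⟩, Finset.mem_insert_self _ _, ?_⟩
      · rw [Finset.card_insert_of_notMem fun h => haR (hT.1 h), hT.2]; omega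
      · rw [Finset.mem_insert]; rintro (e | e)
        · exact hab e.symm
        · exact hbR (hT.1 e)
    · intro T hT T' hT' e
      have hT := Finset.mem_powersetCard.1 (Finset.mem_coe.1 hT)
      have hT' := Finset.mem_powersetCard.1 (Finset.mem_coe.1 hT')
      have e' := congrArg (fun U => Finset.erase U a) e
      simp only at e'
      rwa [Finset.erase_insert fun h => haR (hT.1 h), Finset.erase_insert fun h => haR (hT'.1 h)]
        at e'
  have h1a := h1 v w hvR hwR hv hvw
  have h1b := h1 w v hwR hvR hw hvw.symm
  have hsame : (P.filter fun T => (v ∈ T ↔ w ∈ T)).card ≤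
      (P.filter fun T => v ∉ T ∧ w ∉ T).card + (P.filter fun T => v ∈ T ∧ w ∈ T).card := by
    rw [← Finset.card_union_of_disjoint]
    · refine Finset.card_le_card fun T hT => ?_
      simp only [Finset.mem_union, Finset.mem_filter] at hT ⊢
      tauto
    · rw [Finset.disjoint_filter]; tauto
  have hdiff : (P.filter fun T => v ∈ T ∧ w ∉ T).card + (P.filter fun T => w ∈ T ∧ v ∉ T).card ≤
      (P.filter fun T => ¬ (v ∈ T ↔ w ∈ T)).card := by
    rw [← Finset.card_union_of_disjoint]
    · refine Finset.card_le_card fun T hT => ?_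
      simp only [Finset.mem_union, Finset.mem_filter] at hT ⊢
      tauto
    · rw [Finset.disjoint_filter]; tauto
  have hall := Finset.card_filter_add_card_filter_not (s := P) (fun T => (v ∈ T ↔ w ∈ T))
  omega

/-! ### The success probability of `sampleEdge` -/

/-- Few of the half-size subsets mislead the search for `i` at an endpoint of an edge along `i`
that is persistent when `i` is replaced by the placeholder. -/
lemma card_misleading_le {n : ℕ} {f : Cube n → Bool} {S : Finset (Var n)} {i : Fin n} {x : Cube n}
    (hn : none ∉ S) (hb : IsBichromatic f i x) (hp : IsPersistentEdge f (swapSet i S) i x) :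
    (((S.powersetCard (S.card / 2)).filter fun T =>
      ¬ (some i ∈ T ↔ f x ≠ f (flipSet x T))).card : ℝ) ≤
      2 / Real.logb 2 n ^ 2 * (S.powersetCard (S.card / 2)).card := by
  set k := S.card / 2 with hk
  have hc : ((swapSet i S).powersetCard k).card = (S.powersetCard k).card := by
    rw [Finset.card_powersetCard, Finset.card_powersetCard, card_swapSet]
  have bad : ∀ z : Cube n, PersistentAt f (swapSet i S) ((swapSet i S).card / 2) z →
      ((((swapSet i S).powersetCard k).filter fun T => ¬ f z = f (flipSet z T)).card : ℝ) ≤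
        1 / Real.logb 2 n ^ 2 * (S.powersetCard k).card := by
    intro z hz
    unfold PersistentAt at hz
    rw [card_swapSet, ← hk, hc] at hz
    have h1 := Finset.card_filter_add_card_filter_not (s := (swapSet i S).powersetCard k)
      (fun T => f z = f (flipSet z T))
    rw [hc] at h1
    have h2 : ((((swapSet i S).powersetCard k).filter fun T => f z = f (flipSet z T)).card : ℝ) +
      (((swapSet i S).powersetCard k).filter fun T => ¬ f z = f (flipSet z T)).card =
      (S.powersetCard k).card := by exact_mod_cast h1
    linarith
  have h1 := bad x hp.1.1
  have h2 := bad _ hp.2.1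
  have h3 : ((S.powersetCard k).filter fun T => ¬ (some i ∈ T ↔ f x ≠ f (flipSet x T))).card ≤
      (((swapSet i S).powersetCard k).filter fun T => ¬ f x = f (flipSet x T)).card +
      (((swapSet i S).powersetCard k).filter fun T =>
        ¬ f (flipVar x i) = f (flipSet (flipVar x i) T)).card := by
    refine le_trans ?_ (Finset.card_union_le _ _)
    refine Finset.card_le_card_of_injOn (swapSet i) ?_ fun T _ T' _ e => by
      rw [← swapSet_swapSet i T, e, swapSet_swapSet]
    intro T hT
    simp only [Finset.coe_filter, Set.mem_ofPred_eq, Finset.mem_powersetCard] at hT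
    obtain ⟨⟨hTS, hTk⟩, hT⟩ := hT
    have hnT : none ∉ T := fun h => hn (hTS h)
    simp only [Finset.coe_union, Finset.coe_filter, Set.mem_union, Set.mem_ofPred_eq,
      Finset.mem_powersetCard, swapSet_subset_swapSet, card_swapSet]
    -- if `i ∈ T`, flipping `T` at `x` is flipping the swapped set at the other endpoint
    by_cases hi : some i ∈ T
    · right
      refine ⟨⟨hTS, hTk⟩, ?_⟩
      have e := flipSet_swapSet_of_mem hi hnT x
      rw [flipVar_flipSet] at e
      rw [← e]
      have hT' : f x = f (flipSet x T) := by tauto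
      rw [← hT']
      exact fun h => hb h.symm
    · left
      refine ⟨⟨hTS, hTk⟩, ?_⟩
      rw [swapSet_of_notMem hi hnT]
      tauto
  have h4 : (((S.powersetCard k).filter fun T => ¬ (some i ∈ T ↔ f x ≠ f (flipSet x T))).card : ℝ) ≤
      (((swapSet i S).powersetCard k).filter fun T => ¬ f x = f (flipSet x T)).card +
      (((swapSet i S).powersetCard k).filter fun T =>
        ¬ f (flipVar x i) = f (flipSet (flipVar x i) T)).card := by exact_mod_cast h3
  calc _ ≤ _ := h4
    _ ≤ _ := add_le_add h1 h2
    _ = _ := by ring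

lemma card_piFinset_filter_le {α : Type} [DecidableEq α] {J : ℕ} (P : Finset α) (Q : α → Prop)
    [DecidablePred Q] (j : Fin J) {β : ℝ} (hβ : ((P.filter Q).card : ℝ) ≤ β * P.card) :
    (((Fintype.piFinset fun _ : Fin J => P).filter fun T => Q (T j)).card : ℝ) ≤
      β * (P.card : ℝ) ^ J := by
  have h1 : ((Fintype.piFinset fun _ : Fin J => P).filter fun T => Q (T j)).card ≤
      (Fintype.piFinset fun k : Fin J => if k = j then P.filter Q else P).card := by
    refine Finset.card_le_card fun T hT => ?_
    rw [Finset.mem_filter, Fintype.mem_piFinset] at hT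
    rw [Fintype.mem_piFinset]
    intro k
    split_ifs with hk
    · exact Finset.mem_filter.2 ⟨hT.1 k, hk ▸ hT.2⟩
    · exact hT.1 k
  have h2 : ((Fintype.piFinset fun k : Fin J => if k = j then P.filter Q else P).card : ℝ) =
      (P.filter Q).card * (P.card : ℝ) ^ (J - 1) := by
    rw [Fintype.card_piFinset, Nat.cast_prod, ← Finset.mul_prod_erase _ _ (Finset.mem_univ j)]
    rw [if_pos rfl]
    congr 1
    rw [Finset.prod_congr rfl (g := fun _ => (P.card : ℝ)) fun k hk => by
      rw [if_neg (Finset.ne_of_mem_erase hk)]]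
    rw [Finset.prod_const, Finset.card_erase_of_mem (Finset.mem_univ j), Finset.card_fin]
  calc (((Fintype.piFinset fun _ : Fin J => P).filter fun T => Q (T j)).card : ℝ)
      ≤ (P.filter Q).card * (P.card : ℝ) ^ (J - 1) := by rw [← h2]; exact_mod_cast h1
    _ ≤ β * P.card * (P.card : ℝ) ^ (J - 1) := by gcongr
    _ = β * (P.card : ℝ) ^ J := by
        rw [mul_assoc, ← pow_succ', Nat.sub_add_cancel (Nat.one_le_iff_ne_zero.2 j.pos.ne')]

lemma card_piFinset_forall {α : Type} [DecidableEq α] {J : ℕ} (P : Finset α) (Q : α → Prop)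
    [DecidablePred Q] :
    ((Fintype.piFinset fun _ : Fin J => P).filter fun T => ∀ j, Q (T j)).card =
      (P.filter Q).card ^ J := by
  have : ((Fintype.piFinset fun _ : Fin J => P).filter fun T => ∀ j, Q (T j)) =
      Fintype.piFinset fun _ : Fin J => P.filter Q := by
    ext T
    simp only [Finset.mem_filter, Fintype.mem_piFinset]
    exact ⟨fun h k => ⟨h.1 k, h.2 k⟩, fun h => ⟨fun k => (h k).1, fun k => (h k).2⟩⟩
  rw [this, Fintype.card_piFinset, Finset.prod_const, Finset.card_fin]

/-- From an endpoint of a persistent edge along `i`, the search succeeds for at least half of the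
choices of the subsets. -/
lemma half_le_card_sampleVal {n J : ℕ} {f : Cube n → Bool} {σ : Bool} {S : Finset (Var n)}
    {i : Fin n} {x : Cube n} (hi : some i ∈ S) (hn : none ∉ S) (hs : IsSignedEdge f σ i x)
    (hp : IsPersistentEdge f (swapSet i S) i x)
    (hJ : J * (2 / Real.logb 2 n ^ 2) + n * (1 / 2) ^ J ≤ (1 : ℝ) / 2) :
    1 / 2 * ((Fintype.piFinset fun _ : Fin J => S.powersetCard (S.card / 2)).card : ℝ) ≤
      (((Fintype.piFinset fun _ : Fin J => S.powersetCard (S.card / 2)).filter fun T =>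
        sampleVal f σ S x T = some (i, x)).card : ℝ) := by
  classical
  set P := S.powersetCard (S.card / 2) with hP
  set Ω := Fintype.piFinset fun _ : Fin J => P with hΩ
  have hΩc : (Ω.card : ℝ) = (P.card : ℝ) ^ J := by rw [hΩ, Fintype.card_piFinset]; simp
  have hSn : S.card ≤ n := by
    have h1 : S ⊆ (Finset.univ : Finset (Var n)).erase none := fun v hv =>
      Finset.mem_erase.2 ⟨fun e => hn (e ▸ hv), Finset.mem_univ _⟩
    have h2 := Finset.card_le_card h1
    rw [Finset.card_erase_of_mem (Finset.mem_univ _)] at h2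
    simpa using h2
  -- the search fails only if some subset misleads it, or if some other variable is in the same
  -- subsets as `i`
  have hbad : Ω.filter (fun T => ¬ sampleVal f σ S x T = some (i, x)) ⊆
      (Finset.univ.biUnion fun j : Fin J =>
        Ω.filter fun T => ¬ (some i ∈ T j ↔ f x ≠ f (flipSet x (T j)))) ∪
      ((S.erase (some i)).biUnion fun v =>
        Ω.filter fun T => ∀ j, (some i ∈ T j ↔ v ∈ T j)) := by
    intro T hT
    rw [Finset.mem_filter] at hT
    by_contra hcon
    simp only [Finset.mem_union, Finset.mem_biUnion, Finset.mem_univ, true_and, Finset.mem_filter,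
      hT.1, not_or, not_exists, not_and, not_not] at hcon
    obtain ⟨c1, c2⟩ := hcon
    have hex : Explains S T (f x) (fun j => f (flipSet x (T j))) i := ⟨hi, c1⟩
    have huniq : ∀ i', Explains S T (f x) (fun j => f (flipSet x (T j))) i' → i' = i := by
      intro i' hi'
      by_contra hne
      exact c2 (some i') (Finset.mem_erase.2 ⟨by simpa using hne, hi'.1⟩)
        fun j => (c1 j).trans (hi'.2 j).symm
    apply hT.2
    unfold sampleVal
    rw [candidate_eq hex huniq]
    exact if_pos hs
  have h1 : ∀ j : Fin J, ((Ω.filter fun T => ¬ (some i ∈ T j ↔ f x ≠ f (flipSet x (T j)))).card : ℝ)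
      ≤ 2 / Real.logb 2 n ^ 2 * (P.card : ℝ) ^ J := fun j =>
    card_piFinset_filter_le P (fun T => ¬ (some i ∈ T ↔ f x ≠ f (flipSet x T))) j
      (card_misleading_le hn hs.1 hp)
  have h2 : ∀ v ∈ S.erase (some i), ((Ω.filter fun T => ∀ j, (some i ∈ T j ↔ v ∈ T j)).card : ℝ) ≤
      (1 / 2) ^ J * (P.card : ℝ) ^ J := by
    intro v hv
    have h3 := card_piFinset_forall (J := J) P (fun T => (some i ∈ T ↔ v ∈ T))
    have h4 := two_mul_card_not_separating_le hi (Finset.mem_of_mem_erase hv)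
      (Finset.ne_of_mem_erase hv).symm
    rw [h3, Nat.cast_pow, ← mul_pow]
    gcongr
    have h5 : (2 : ℝ) * ((P.filter fun T => (some i ∈ T ↔ v ∈ T)).card : ℝ) ≤ P.card := by
      exact_mod_cast h4
    linarith
  have hcard : ((Ω.filter fun T => ¬ sampleVal f σ S x T = some (i, x)).card : ℝ) ≤
      1 / 2 * (P.card : ℝ) ^ J := by
    calc ((Ω.filter fun T => ¬ sampleVal f σ S x T = some (i, x)).card : ℝ)
        ≤ ((∑ j : Fin J, (Ω.filter fun T => ¬ (some i ∈ T j ↔ f x ≠ f (flipSet x (T j)))).card +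
          ∑ v ∈ S.erase (some i),
            (Ω.filter fun T => ∀ j, (some i ∈ T j ↔ v ∈ T j)).card : ℕ) : ℝ) := by
          exact_mod_cast (Finset.card_le_card hbad).trans ((Finset.card_union_le _ _).trans
            (add_le_add Finset.card_biUnion_le Finset.card_biUnion_le))
      _ ≤ ∑ j : Fin J, 2 / Real.logb 2 n ^ 2 * (P.card : ℝ) ^ J +
          ∑ v ∈ S.erase (some i), (1 / 2) ^ J * (P.card : ℝ) ^ J := by
          push_cast
          exact add_le_add (Finset.sum_le_sum fun j _ => h1 j) (Finset.sum_le_sum h2)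
      _ ≤ J * (2 / Real.logb 2 n ^ 2) * (P.card : ℝ) ^ J + n * (1 / 2) ^ J * (P.card : ℝ) ^ J := by
          rw [Finset.sum_const, Finset.sum_const, nsmul_eq_mul, nsmul_eq_mul, Finset.card_fin,
            mul_assoc, mul_assoc]
          gcongr
          exact (Finset.card_le_card (Finset.erase_subset _ _)).trans hSn
      _ = (J * (2 / Real.logb 2 n ^ 2) + n * (1 / 2) ^ J) * (P.card : ℝ) ^ J := by ring
      _ ≤ _ := by gcongr
  have hall := Finset.card_filter_add_card_filter_not (s := Ω)
    (fun T => sampleVal f σ S x T = some (i, x))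
  have hall' : ((Ω.filter fun T => sampleVal f σ S x T = some (i, x)).card : ℝ) +
    (Ω.filter fun T => ¬ sampleVal f σ S x T = some (i, x)).card = Ω.card := by exact_mod_cast hall
  have : ((Ω.filter fun T => sampleVal f σ S x T = some (i, x)).card : ℝ) =
    (Ω.filter fun T => sampleVal f σ S x T = some (i, x)).card := rfl
  rw [hΩc] at hall' ⊢
  linarith

open Classical in
/-- The number of signed edges along `i` that are persistent for the set `S`; each edge is counted
through its endpoint with `x i = 0`. -/
def persistentCount {n : ℕ} (f : Cube n → Bool) (σ : Bool) (i : Fin n) (S : Finset (Var n)) : ℕ :=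
  (Finset.univ.filter fun x : Cube n =>
    x i = false ∧ IsSignedEdge f σ i x ∧ IsPersistentEdge f S i x).card

/-- A sample finds the variable `i` with probability at least half the density of the persistent
edges along `i`. -/
lemma persistentCount_le_ex_sampleEdge {n J : ℕ} (f : Cube n → Bool) (σ : Bool)
    {S : Finset (Var n)} {i : Fin n} (hi : some i ∈ S) (hn : none ∉ S)
    (hJ : J * (2 / Real.logb 2 n ^ 2) + n * (1 / 2) ^ J ≤ (1 : ℝ) / 2) :
    (persistentCount f σ i (swapSet i S) : ℝ≥0∞) / 2 ^ n / 2 ≤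
      ex ((sampleEdge σ J S).law f) fun o => ind (o.map Prod.fst = some i) := by
  classical
  have hne : (Fintype.piFinset fun _ : Fin J => S.powersetCard (S.card / 2)).Nonempty :=
    Fintype.piFinset_nonempty.2 fun _ => Finset.powersetCard_nonempty.2 (Nat.div_le_self _ _)
  rw [law_sampleEdge, ex_bind, ex_uniformOfFintype]
  have hc : (Fintype.card (Cube n) : ℝ≥0∞) = 2 ^ n := by simp
  rw [hc, ENNReal.div_right_comm]
  gcongr
  unfold persistentCount
  rw [← sum_ind, ENNReal.div_eq_inv_mul, Finset.mul_sum]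
  refine Finset.sum_le_sum fun x _ => ?_
  by_cases hx : x i = false ∧ IsSignedEdge f σ i x ∧ IsPersistentEdge f (swapSet i S) i x
  swap
  · rw [ind_of_not hx, mul_zero]; exact zero_le
  rw [ind_of hx, mul_one, ex_bind, ex_uniformOn hne]
  simp only [ex_pure]
  have hpos : ((Fintype.piFinset fun _ : Fin J => S.powersetCard (S.card / 2)).card : ℝ≥0∞) ≠ 0 := by
    exact_mod_cast hne.card_pos.ne'
  rw [ENNReal.le_div_iff_mul_le (Or.inl hpos) (Or.inl (by finiteness))]
  have key := half_le_card_sampleVal hi hn hx.2.1 hx.2.2 hJ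
  calc 2⁻¹ * ((Fintype.piFinset fun _ : Fin J => S.powersetCard (S.card / 2)).card : ℝ≥0∞)
      = ENNReal.ofReal (1 / 2 *
        ((Fintype.piFinset fun _ : Fin J => S.powersetCard (S.card / 2)).card : ℝ)) := by
        rw [ENNReal.ofReal_mul (by norm_num), ENNReal.ofReal_natCast, one_div,
          ENNReal.ofReal_inv_of_pos (by norm_num), ENNReal.ofReal_ofNat]
    _ ≤ ENNReal.ofReal (((Fintype.piFinset fun _ : Fin J => S.powersetCard (S.card / 2)).filter
        fun T => sampleVal f σ S x T = some (i, x)).card : ℝ) := ENNReal.ofReal_le_ofReal key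
    _ = ∑ T ∈ Fintype.piFinset fun _ : Fin J => S.powersetCard (S.card / 2),
        ind (sampleVal f σ S x T = some (i, x)) := by
        rw [ENNReal.ofReal_natCast, sum_ind]
    _ ≤ _ := by
        refine Finset.sum_le_sum fun T _ => ind_mono fun h => ?_
        rw [h]; rfl

/-! ### Uniform subsets of fixed size -/

lemma card_supersets {α : Type} [DecidableEq α] {U W : Finset α} {m : ℕ} (hW : W ⊆ U)
    (hm : W.card ≤ m) : ((U.powersetCard m).filter fun S => W ⊆ S).card =
      (U.card - W.card).choose (m - W.card) := by
  rw [← Finset.card_sdiff_of_subset hW, ← Finset.card_powersetCard]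
  refine Finset.card_bij' (fun S _ => S \ W) (fun S _ => S ∪ W) ?_ ?_ ?_ ?_
  · intro S hS
    rw [Finset.mem_filter, Finset.mem_powersetCard] at hS
    rw [Finset.mem_powersetCard, Finset.card_sdiff_of_subset hS.2, hS.1.2]
    exact ⟨Finset.sdiff_subset_sdiff hS.1.1 le_rfl, rfl⟩
  · intro S hS
    rw [Finset.mem_powersetCard] at hS
    have hd : Disjoint S W := Finset.disjoint_left.2 fun v hv =>
      (Finset.mem_sdiff.1 (hS.1 hv)).2
    rw [Finset.mem_filter, Finset.mem_powersetCard, Finset.card_union_of_disjoint hd, hS.2]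
    exact ⟨⟨Finset.union_subset (hS.1.trans Finset.sdiff_subset) hW, by omega⟩,
      Finset.subset_union_right⟩
  · intro S hS
    rw [Finset.mem_filter] at hS
    exact Finset.sdiff_union_of_subset hS.2
  · intro S hS
    rw [Finset.mem_powersetCard] at hS
    have hd : Disjoint S W := Finset.disjoint_left.2 fun v hv =>
      (Finset.mem_sdiff.1 (hS.1 hv)).2
    exact Finset.union_sdiff_cancel_right hd

lemma ex_uniform_mem {α : Type} [DecidableEq α] {U : Finset α} {v : α} {m : ℕ} (hv : v ∈ U)
    (hm : m ≤ U.card) : ex (uniformOn (U.powersetCard m)) (fun S => ind (v ∈ S)) =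
      (m : ℝ≥0∞) / U.card := by
  have hne : (U.powersetCard m).Nonempty := Finset.powersetCard_nonempty.2 hm
  have hU : 0 < U.card := Finset.card_pos.2 ⟨v, hv⟩
  rw [ex_uniformOn hne, sum_ind, Finset.card_powersetCard]
  rcases m with _ | m
  · simp only [Finset.powersetCard_zero, Nat.cast_zero, ENNReal.zero_div]
    rw [Finset.filter_singleton]; simp
  have h1 := card_supersets (U := U) (W := {v}) (m := m + 1) (by simpa using hv) (by simp)
  simp only [Finset.singleton_subset_iff, Finset.card_singleton, Nat.add_sub_cancel] at h1
  rw [h1]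
  obtain ⟨u, hu⟩ : ∃ u, U.card = u + 1 := ⟨U.card - 1, by omega⟩
  rw [hu, Nat.add_sub_cancel, ENNReal.div_eq_div_iff (by simp) (by simp)
    (by exact_mod_cast (Nat.choose_pos (by omega)).ne') (by finiteness)]
  have := Nat.add_one_mul_choose_eq u m
  have h2 : (u + 1) * u.choose m = (u + 1).choose (m + 1) * (m + 1) := this
  exact_mod_cast h2

lemma ex_uniform_mem_mem_le {α : Type} [DecidableEq α] {U : Finset α} {v w : α} {m : ℕ}
    (hv : v ∈ U) (hw : w ∈ U) (hvw : v ≠ w) (hm : m ≤ U.card) :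
    ex (uniformOn (U.powersetCard m)) (fun S => ind (v ∈ S ∧ w ∈ S)) ≤
      ((m : ℝ≥0∞) / U.card) ^ 2 := by
  have hne : (U.powersetCard m).Nonempty := Finset.powersetCard_nonempty.2 hm
  have hU : 2 ≤ U.card := by
    have := Finset.card_le_card (Finset.insert_subset hv (Finset.singleton_subset_iff.2 hw))
    rwa [Finset.card_pair hvw] at this
  rw [ex_uniformOn hne, sum_ind, Finset.card_powersetCard]
  by_cases hm2 : m < 2
  · have : (U.powersetCard m).filter (fun S => v ∈ S ∧ w ∈ S) = ∅ := by
      refine Finset.filter_eq_empty_iff.2 fun S hS hSv => ?_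
      have h1 := Finset.card_le_card (Finset.insert_subset hSv.1
        (Finset.singleton_subset_iff.2 hSv.2))
      rw [Finset.card_pair hvw, (Finset.mem_powersetCard.1 hS).2] at h1
      omega
    rw [this]; simp
  obtain ⟨m, rfl⟩ : ∃ k, m = k + 2 := ⟨m - 2, by omega⟩
  have h1 := card_supersets (U := U) (W := {v, w}) (m := m + 2)
    (Finset.insert_subset hv (Finset.singleton_subset_iff.2 hw)) (by rw [Finset.card_pair hvw]; omega)
  simp only [Finset.insert_subset_iff, Finset.singleton_subset_iff, Finset.card_pair hvw,
    Nat.add_sub_cancel] at h1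
  rw [h1]
  obtain ⟨u, hu⟩ : ∃ u, U.card = u + 2 := ⟨U.card - 2, by omega⟩
  rw [hu, Nat.add_sub_cancel]
  have hum : m ≤ u := by omega
  have e1 : (u + 2) * (u + 1).choose (m + 1) = (u + 2).choose (m + 2) * (m + 2) :=
    Nat.add_one_mul_choose_eq (u + 1) (m + 1)
  have e2 : (u + 1) * u.choose m = (u + 1).choose (m + 1) * (m + 1) :=
    Nat.add_one_mul_choose_eq u m
  have key : u.choose m * (u + 2) ^ 2 ≤ (m + 2) ^ 2 * (u + 2).choose (m + 2) := by
    have h3 : (u + 2) * (u.choose m) ≤ (m + 2) * (u + 1).choose (m + 1) := by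
      have h4 : (u + 1) * ((u + 2) * u.choose m) ≤ (u + 1) * ((m + 2) * (u + 1).choose (m + 1)) := by
        calc (u + 1) * ((u + 2) * u.choose m) = (u + 2) * (m + 1) * (u + 1).choose (m + 1) := by
              rw [mul_left_comm, e2]; ring
          _ ≤ (u + 1) * (m + 2) * (u + 1).choose (m + 1) := by
              refine Nat.mul_le_mul_right _ ?_
              nlinarith
          _ = _ := by ring
      exact Nat.le_of_mul_le_mul_left h4 (by omega)
    calc u.choose m * (u + 2) ^ 2 = (u + 2) * ((u + 2) * u.choose m) := by ring
      _ ≤ (u + 2) * ((m + 2) * (u + 1).choose (m + 1)) := Nat.mul_le_mul_left _ h3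
      _ = (m + 2) * ((u + 2) * (u + 1).choose (m + 1)) := by ring
      _ = _ := by rw [e1]; ring
  have hc0 : ((u + 2).choose (m + 2) : ℝ≥0∞) ≠ 0 := by
    exact_mod_cast (Nat.choose_pos (by omega)).ne'
  rw [div_eq_mul_inv (_ : ℝ≥0∞) ((u + 2 : ℕ) : ℝ≥0∞), mul_pow, ← ENNReal.inv_pow, ← div_eq_mul_inv]
  rw [ENNReal.div_le_iff hc0 (by finiteness), mul_comm, ← mul_div_assoc,
    ENNReal.le_div_iff_mul_le (Or.inl (by positivity)) (Or.inl (by finiteness)),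
    mul_comm (Nat.cast _) (_ ^ 2)]
  rw [mul_comm (u.choose m), mul_comm ((m + 2) ^ 2)] at key
  exact_mod_cast key

/-- A uniform subset of a uniform set is uniform. -/
lemma ex_uniform_uniform {α : Type} [DecidableEq α] {U : Finset α} {m k : ℕ} (hkm : k ≤ m)
    (hm : m ≤ U.card) (Ψ : Finset α → ℝ≥0∞) :
    ex (uniformOn (U.powersetCard m)) (fun S => ex (uniformOn (S.powersetCard k)) Ψ) =
      ex (uniformOn (U.powersetCard k)) Ψ := by
  have hne : (U.powersetCard m).Nonempty := Finset.powersetCard_nonempty.2 hm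
  have hne' : (U.powersetCard k).Nonempty := Finset.powersetCard_nonempty.2 (hkm.trans hm)
  rw [ex_uniformOn hne, ex_uniformOn hne']
  have h1 : ∀ S ∈ U.powersetCard m, ex (uniformOn (S.powersetCard k)) Ψ =
      (∑ V ∈ U.powersetCard k, ind (V ⊆ S) * Ψ V) / (m.choose k : ℝ≥0∞) := by
    intro S hS
    rw [Finset.mem_powersetCard] at hS
    rw [ex_uniformOn (Finset.powersetCard_nonempty.2 (by omega)), Finset.card_powersetCard, hS.2]
    congr 1
    have : S.powersetCard k = (U.powersetCard k).filter fun V => V ⊆ S := by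
      ext V
      simp only [Finset.mem_filter, Finset.mem_powersetCard]
      exact ⟨fun h => ⟨⟨h.1.trans hS.1, h.2⟩, h.1⟩, fun h => ⟨h.2, h.1.2⟩⟩
    rw [this, Finset.sum_filter]
    refine Finset.sum_congr rfl fun V _ => ?_
    by_cases h : V ⊆ S <;> simp [ind, h]
  rw [Finset.sum_congr rfl h1]
  simp_rw [ENNReal.div_eq_inv_mul]
  rw [← Finset.mul_sum, Finset.sum_comm]
  simp_rw [← Finset.sum_mul]
  have h2 : ∀ V ∈ U.powersetCard k, (∑ S ∈ U.powersetCard m, ind (V ⊆ S)) * Ψ V =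
      ((U.card - k).choose (m - k) : ℝ≥0∞) * Ψ V := by
    intro V hV
    rw [Finset.mem_powersetCard] at hV
    rw [sum_ind, card_supersets hV.1 (by omega), hV.2]
  rw [Finset.sum_congr rfl h2, ← Finset.mul_sum, ← mul_assoc, ← mul_assoc,
    Finset.card_powersetCard, Finset.card_powersetCard]
  congr 1
  have e : (U.card.choose m : ℝ≥0∞) * m.choose k = U.card.choose k * (U.card - k).choose (m - k) := by
    exact_mod_cast Nat.choose_mul hkm
  have n1 : ((U.card - k).choose (m - k) : ℝ≥0∞) ≠ 0 := by
    exact_mod_cast (Nat.choose_pos (by omega)).ne'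
  rw [← ENNReal.mul_inv (Or.inr (by finiteness)) (Or.inl (by finiteness)), e,
    ENNReal.mul_inv (Or.inr (by finiteness)) (Or.inl (by finiteness)), mul_assoc,
    ENNReal.inv_mul_cancel n1 (by finiteness), mul_one]

/-! ### Most variables keep their strong edges persistent -/

/-- The sets of `m` proper variables. -/
def realSets (n m : ℕ) : Finset (Finset (Var n)) := ({none}ᶜ : Finset (Var n)).powersetCard m

lemma card_proper (n : ℕ) : ({none}ᶜ : Finset (Var n)).card = n := by
  rw [Finset.card_compl]; simp

lemma mem_realSets {n m : ℕ} {S : Finset (Var n)} :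
    S ∈ realSets n m ↔ none ∉ S ∧ S.card = m := by
  unfold realSets
  rw [Finset.mem_powersetCard]
  refine and_congr_left fun _ => ?_
  rw [Finset.subset_compl_comm, Finset.singleton_subset_iff, Finset.mem_compl]

lemma realSets_nonempty {n m : ℕ} (h : m ≤ n) : (realSets n m).Nonempty :=
  Finset.powersetCard_nonempty.2 (by rwa [card_proper])

/-- The sets of `m` variables that contain the placeholder. -/
abbrev placeholderSets (n m : ℕ) : Finset (Finset (Var n)) :=
  (Finset.univ.powersetCard m).filter fun S : Finset (Var n) => none ∈ S

lemma ex_distH {n : ℕ} (f : Cube n → Bool) (ξ : ℝ) (m : ℕ) (g : Finset (Var n) → ℝ≥0∞) :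
    ex (distH f ξ m) g =
      ex (uniformOn (placeholderSets n m)) fun S => ex ((preSet S ξ).law f) g := by
  rw [distH, ex_bind]
  rfl

lemma card_placeholderSets {n m : ℕ} (hm : 1 ≤ m) :
    (placeholderSets n m).card = n.choose (m - 1) := by
  have h1 := card_supersets (U := (Finset.univ : Finset (Var n))) (W := {none}) (m := m)
    (Finset.subset_univ _) (by simpa using hm)
  simp only [Finset.singleton_subset_iff, Finset.card_singleton] at h1
  rw [h1]
  simp

/-- Replacing `i` by the placeholder in a uniform set of `m` variables that happens to contain `i`
gives a set whose law is dominated by that of a uniform set with the placeholder. -/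
lemma ex_realSets_swap_le {n m : ℕ} (i : Fin n) (hm : 1 ≤ m) (hmn : 2 * m ≤ n)
    (Φ : Finset (Var n) → ℝ≥0∞) :
    ex (uniformOn (realSets n m)) (fun S => ind (some i ∈ S) * Φ (swapSet i S)) ≤
      2 * m / n * ex (uniformOn (placeholderSets n m)) Φ := by
  have hne : (placeholderSets n m).Nonempty := by
    rw [← Finset.card_pos, card_placeholderSets hm]; exact Nat.choose_pos (by omega)
  rw [ex_uniformOn (realSets_nonempty (by omega)), ex_uniformOn hne, card_placeholderSets hm]
  have hcr : (realSets n m).card = n.choose m := by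
    rw [realSets, Finset.card_powersetCard, card_proper]
  rw [hcr]
  have hsum : ∑ S ∈ realSets n m, ind (some i ∈ S) * Φ (swapSet i S) ≤
      ∑ S ∈ placeholderSets n m, Φ S := by
    have h1 : ∑ S ∈ realSets n m, ind (some i ∈ S) * Φ (swapSet i S) =
        ∑ S ∈ (realSets n m).filter (fun S => some i ∈ S), Φ (swapSet i S) := by
      rw [Finset.sum_filter]
      refine Finset.sum_congr rfl fun S _ => ?_
      by_cases h : some i ∈ S <;> simp [ind, h]
    rw [h1, ← Finset.sum_image (f := Φ) (g := swapSet i)]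
    · refine Finset.sum_le_sum_of_subset fun S' hS' => ?_
      obtain ⟨S, hS, rfl⟩ := Finset.mem_image.1 hS'
      rw [Finset.mem_filter, mem_realSets] at hS
      simp only [Finset.mem_filter, Finset.mem_powersetCard, Finset.subset_univ, true_and,
        card_swapSet, mem_swapSet, swapVar_none]
      exact ⟨hS.1.2, hS.2⟩
    · intro S _ T _ e
      rw [← swapSet_swapSet i S, e, swapSet_swapSet]
  refine (ENNReal.div_le_div_right hsum _).trans ?_
  have hc1 : (n.choose m : ℝ≥0∞) ≠ 0 := by exact_mod_cast (Nat.choose_pos (by omega)).ne'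
  have hc2 : (n.choose (m - 1) : ℝ≥0∞) ≠ 0 := by exact_mod_cast (Nat.choose_pos (by omega)).ne'
  have hn0 : (n : ℝ≥0∞) ≠ 0 := by exact_mod_cast (by omega : n ≠ 0)
  have key : n.choose (m - 1) * n ≤ 2 * m * n.choose m := by
    have h := Nat.choose_succ_right_eq n (m - 1)
    rw [Nat.sub_add_cancel hm] at h
    calc n.choose (m - 1) * n ≤ n.choose (m - 1) * (2 * (n - (m - 1))) :=
          Nat.mul_le_mul_left _ (by omega)
      _ = 2 * (n.choose (m - 1) * (n - (m - 1))) := by ring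
      _ = _ := by rw [← h]; ring
  have key' : (n.choose (m - 1) : ℝ≥0∞) * n ≤ 2 * m * n.choose m := by exact_mod_cast key
  rw [ENNReal.div_le_iff hc1 (by finiteness)]
  set X := ∑ S ∈ placeholderSets n m, Φ S
  calc X = (n.choose (m - 1) : ℝ≥0∞) * n * (X / n.choose (m - 1)) / n := by
        rw [mul_right_comm, ENNReal.mul_div_cancel hc2 (by finiteness),
          ENNReal.mul_div_cancel_right hn0 (by finiteness)]
    _ ≤ 2 * m * n.choose m * (X / n.choose (m - 1)) / n := by gcongr
    _ = _ := by simp only [div_eq_mul_inv]; ring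

open Classical in
/-- The number of `a`-strong signed edges along `i`; each edge is counted through its endpoint with
`x i = 0`. -/
def strongCount {n : ℕ} (ε : ℝ) (f : Cube n → Bool) (σ : Bool) (i : Fin n) (a : ℕ) : ℕ :=
  (Finset.univ.filter fun x : Cube n =>
    x i = false ∧ IsSignedEdge f σ i x ∧ IsStrong ε f a i x).card

lemma scorePlus_eq {n : ℕ} (ε : ℝ) (f : Cube n → Bool) (i : Fin n) (a : ℕ) :
    scorePlus ε f i a = strongCount ε f true i a / 2 ^ n := by
  classical
  unfold scorePlus strongCount
  rw [← Set.ncard_coe_finset]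
  congr 3
  ext x
  simp [IsMonoEdge, IsSignedEdge]

lemma scoreMinus_eq {n : ℕ} (ε : ℝ) (f : Cube n → Bool) (i : Fin n) (a : ℕ) :
    scoreMinus ε f i a = strongCount ε f false i a / 2 ^ n := by
  classical
  unfold scoreMinus strongCount
  rw [← Set.ncard_coe_finset]
  congr 3
  ext x
  simp [IsAntiEdge, IsSignedEdge]

/-- The set `S` keeps `i`, and at least half of the strong edges along `i` are persistent for the
set where `i` is replaced by the placeholder. -/
def Keeps {n : ℕ} (ε : ℝ) (f : Cube n → Bool) (σ : Bool) (a : ℕ) (S : Finset (Var n))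
    (i : Fin n) : Prop :=
  some i ∈ S ∧ strongCount ε f σ i a ≤ 2 * persistentCount f σ i (swapSet i S)

/-- Markov's inequality for the number of strong edges that are not persistent. -/
lemma ex_distH_few_le {n : ℕ} (ε : ℝ) (f : Cube n → Bool) (σ : Bool) {a j k : ℕ} (i : Fin n)
    (hj : (2 : ℝ) ^ j ≤ (n : ℝ) ^ (2 / 3 : ℝ)) (ha : a ≤ k) (hk : k ≤ Lam n ε) :
    ex (distH f (1 / 2 ^ k) (2 ^ j))
      (fun S => ind (2 * persistentCount f σ i S < strongCount ε f σ i a)) ≤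
      2 * ENNReal.ofReal (1 / Real.logb 2 n) := by
  classical
  set E := Finset.univ.filter fun x : Cube n =>
    x i = false ∧ IsSignedEdge f σ i x ∧ IsStrong ε f a i x with hE
  set H := distH f (1 / 2 ^ k) (2 ^ j) with hH
  have hK : strongCount ε f σ i a = E.card := by unfold strongCount; congr
  rw [hK]
  by_cases h0 : E.card = 0
  · rw [h0]
    refine le_trans (ex_le_const (c := 0) fun S => ?_) zero_le
    rw [ind_of_not (by omega)]
  have hpt : ∀ S, (E.card : ℝ≥0∞) * ind (2 * persistentCount f σ i S < E.card) ≤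
      2 * ∑ x ∈ E, ind (x ∉ {x | IsPersistentEdge f S i x}) := by
    intro S
    by_cases h : 2 * persistentCount f σ i S < E.card
    swap
    · rw [ind_of_not h, mul_zero]; exact zero_le
    rw [ind_of h, mul_one, sum_ind]
    have h1 := Finset.card_filter_add_card_filter_not (s := E)
      (fun x => x ∉ {x | IsPersistentEdge f S i x})
    have h2 : (E.filter fun x => ¬ x ∉ {x | IsPersistentEdge f S i x}).card ≤
        persistentCount f σ i S := by
      unfold persistentCount
      refine Finset.card_le_card fun x hx => ?_
      simp only [hE, Finset.mem_filter, Finset.mem_univ, true_and, Set.mem_ofPred_eq,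
        not_not] at hx ⊢
      exact ⟨hx.1.1, hx.1.2.1, hx.2⟩
    have h3 : E.card ≤ 2 * (E.filter fun x => x ∉ {x | IsPersistentEdge f S i x}).card := by omega
    exact_mod_cast h3
  have hex : (E.card : ℝ≥0∞) * ex H (fun S => ind (2 * persistentCount f σ i S < E.card)) ≤
      E.card * (2 * ENNReal.ofReal (1 / Real.logb 2 n)) := by
    rw [← ex_const_mul]
    refine (ex_mono hpt).trans ?_
    rw [ex_const_mul, ex_sum, mul_left_comm]
    gcongr
    rw [← nsmul_eq_mul]
    refine Finset.sum_le_card_nsmul _ _ _ fun x hx => ?_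
    simp only [hE, Finset.mem_filter] at hx
    exact ex_not_le_of_le_prob (hx.2.2.2.1 j k hj ha hk)
  exact (ENNReal.mul_le_mul_iff_right (by exact_mod_cast h0) (by finiteness)).1 hex

/-- The probability (relative to that of `i ∈ S₀`) that `Preprocess` on `S₀` does not keep `i`. -/
lemma ex_not_keeps_le {n : ℕ} (ε : ℝ) (f : Cube n → Bool) (σ : Bool) {a j k : ℕ} (i : Fin n)
    (hj : (2 : ℝ) ^ j ≤ (n : ℝ) ^ (2 / 3 : ℝ)) (hjn : 2 * 2 ^ j ≤ n) (ha : a ≤ k)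
    (hk : k ≤ Lam n ε) :
    ex (uniformOn (realSets n (2 ^ j))) (fun S₀ => ind (some i ∈ S₀) *
      ex ((preSet S₀ (1 / 2 ^ k)).law f) fun S => ind (¬ Keeps ε f σ a S i)) ≤
      2 * (2 ^ j : ℕ) / n * (2 * ENNReal.ofReal (1 / Real.logb 2 n) +
        (2 ^ j : ℕ) * (numRounds n (1 / 2 ^ k) * roundErr f i (2 ^ j))) := by
  have h1 := ex_realSets_swap_le i (Nat.one_le_two_pow (n := j)) hjn fun S' =>
    ex ((preSet S' (1 / 2 ^ k)).law f) (fun S =>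
      ind (2 * persistentCount f σ i S < strongCount ε f σ i a)) +
      (2 ^ j : ℕ) * (numRounds n (1 / 2 ^ k) * roundErr f i (2 ^ j))
  rw [ex_add, ex_const, ← ex_distH] at h1
  refine le_trans ?_ (h1.trans (by gcongr; exact ex_distH_few_le ε f σ i hj ha hk))
  refine ex_mono_support fun S₀ hS₀ => ?_
  rw [mem_support_uniformOn (realSets_nonempty (by omega)), mem_realSets] at hS₀
  by_cases hi : some i ∈ S₀
  swap
  · rw [ind_of_not hi, zero_mul]; exact zero_le
  gcongr
  have h2 := ex_preSet_swap_le f (1 / 2 ^ k) hi hS₀.1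
    (g := fun S => ind (¬ Keeps ε f σ a S i))
    (h := fun S => ind (2 * persistentCount f σ i S < strongCount ε f σ i a))
    (fun S => ind_le_one _) (fun S hiS hnS _ => ind_mono fun h => by
      unfold Keeps at h
      push Not at h
      exact h hiS)
  rw [hS₀.2] at h2
  exact h2

/-! ### Elementary probability estimates -/

/-- If a trial fails with probability at most `1 - z` and `r * z ≤ 1`, then `r` independent trials
fail with probability at most `1 - r * z / 2`. -/
lemma pow_add_mul_div_two_le_one {p z : ℝ≥0∞} (h : p + z ≤ 1) {r : ℕ} (hr : r * z ≤ 1) :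
    p ^ r + r * z / 2 ≤ 1 := by
  have hp : p ≠ ⊤ := ne_top_of_le_ne_top ENNReal.one_ne_top ((le_add_right le_rfl).trans h)
  have hz : z ≠ ⊤ := ne_top_of_le_ne_top ENNReal.one_ne_top ((le_add_left le_rfl).trans h)
  lift p to NNReal using hp
  lift z to NNReal using hz
  have h' : (p : ℝ) + z ≤ 1 := by exact_mod_cast h
  have hr' : (r : ℝ) * z ≤ 1 := by exact_mod_cast hr
  have hz0 : (0 : ℝ) ≤ z := z.2
  have hp0 : (0 : ℝ) ≤ p := p.2
  have key : (p : ℝ) ^ r + r * z / 2 ≤ 1 := by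
    have h1 : 1 + (r : ℝ) * z ≤ (1 + z) ^ r := one_add_mul_le_pow (by linarith) r
    have h2 : (p : ℝ) ^ r * (1 + z) ^ r ≤ 1 := by
      rw [← mul_pow]
      exact pow_le_one₀ (by positivity) (by nlinarith)
    have h3 : (p : ℝ) ^ r * (1 + r * z) ≤ 1 :=
      (mul_le_mul_of_nonneg_left h1 (by positivity)).trans h2
    have h4 : (0 : ℝ) ≤ r * z := by positivity
    have h5 : (0 : ℝ) ≤ (p : ℝ) ^ r := by positivity
    nlinarith [mul_nonneg h4 (sub_nonneg.2 hr')]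
  have h2 : ((2 : NNReal) : ℝ≥0∞) = 2 := by norm_num
  rw [← h2, ← ENNReal.coe_natCast, ← ENNReal.coe_mul, ← ENNReal.coe_div (by norm_num),
    ← ENNReal.coe_pow, ← ENNReal.coe_add, ← ENNReal.coe_one, ENNReal.coe_le_coe]
  rw [← NNReal.coe_le_coe]
  push_cast
  exact key

/-- A Paley–Zygmund inequality: a random natural number with expectation at least `3K/4` and second
moment at most `K + K²` exceeds `K / 4` with constant probability. -/
lemma paley_zygmund {α : Type} (p : PMF α) (X : α → ℕ) {K : ℝ} (hK : 1 / 8 ≤ K)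
    (h1 : ENNReal.ofReal K ≤ ex p (fun a => (X a : ℝ≥0∞)) + ENNReal.ofReal (K / 4))
    (h2 : ex p (fun a => (X a : ℝ≥0∞) ^ 2) ≤ ENNReal.ofReal (K + K ^ 2)) :
    ENNReal.ofReal (1 / 144) ≤ ex p fun a => ind (K / 4 < X a) := by
  have hpt : ∀ a, (X a : ℝ≥0∞) ≤ ENNReal.ofReal (K / 4) +
      ENNReal.ofReal (1 / (4 * (K + 1))) * (X a : ℝ≥0∞) ^ 2 +
      ENNReal.ofReal (4 * (K + 1)) * ind (K / 4 < X a) := by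
    intro a
    have hX : (X a : ℝ≥0∞) = ENNReal.ofReal (X a : ℝ) := (ENNReal.ofReal_natCast _).symm
    by_cases h : K / 4 < X a
    · rw [ind_of h, mul_one, hX, ← ENNReal.ofReal_pow (by positivity),
        ← ENNReal.ofReal_mul (by positivity), add_assoc, ← ENNReal.ofReal_add (by positivity)
        (by positivity)]
      refine le_add_left (ENNReal.ofReal_le_ofReal ?_)
      set L := 4 * (K + 1) with hL
      have hL0 : 0 < L := by rw [hL]; linarith
      rcases le_total (X a : ℝ) L with h3 | h3
      · have : 0 ≤ 1 / L * (X a : ℝ) ^ 2 := by positivity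
        linarith
      · have : (X a : ℝ) ≤ 1 / L * (X a : ℝ) ^ 2 := by
          rw [one_div, ← div_eq_inv_mul, le_div_iff₀ hL0, sq]
          exact mul_le_mul_of_nonneg_left h3 (by positivity)
        linarith
    · rw [hX]
      exact le_add_right (le_add_right (ENNReal.ofReal_le_ofReal (not_lt.1 h)))
  have hex := ex_mono (p := p) hpt
  rw [ex_add, ex_add, ex_const, ex_const_mul, ex_const_mul] at hex
  have hfin : ex p (fun a => ind (K / 4 < X a)) ≠ ⊤ :=
    ne_top_of_le_ne_top ENNReal.one_ne_top (ex_le_const fun a => ind_le_one _)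
  obtain ⟨P, hP⟩ : ∃ P : ℝ, 0 ≤ P ∧ ex p (fun a => ind (K / 4 < X a)) = ENNReal.ofReal P :=
    ⟨_, ENNReal.toReal_nonneg, (ENNReal.ofReal_toReal hfin).symm⟩
  rw [hP.2] at hex ⊢
  have h3 : ENNReal.ofReal K ≤ ENNReal.ofReal (K / 4) +
      ENNReal.ofReal (1 / (4 * (K + 1))) * ENNReal.ofReal (K + K ^ 2) +
      ENNReal.ofReal (4 * (K + 1)) * ENNReal.ofReal P + ENNReal.ofReal (K / 4) :=
    h1.trans (by gcongr; exact hex.trans (by gcongr))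
  rw [← ENNReal.ofReal_mul (by positivity), ← ENNReal.ofReal_mul (by positivity),
    ← ENNReal.ofReal_add (by positivity) (by positivity),
    ← ENNReal.ofReal_add (by positivity) (by have := hP.1; positivity),
    ← ENNReal.ofReal_add (by have := hP.1; positivity) (by positivity),
    ENNReal.ofReal_le_ofReal_iff (by have := hP.1; positivity)] at h3
  refine ENNReal.ofReal_le_ofReal ?_
  have h4 : 1 / (4 * (K + 1)) * (K + K ^ 2) = K / 4 := by
    have : K + 1 ≠ 0 := by positivity
    field_simp
    ring
  rw [h4] at h3
  have h5 : K / 4 ≤ 4 * (K + 1) * P := by linarith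
  by_contra hcon
  have h6 : P < 1 / 144 := not_le.1 hcon
  nlinarith

/-! ### The search algorithm -/

/-- Record an edge found. -/
def record {n : ℕ} (found : Fin n → Option (Cube n)) : Option (Fin n × Cube n) →
    Fin n → Option (Cube n)
  | none => found
  | some v => Function.update found v.1 (some v.2)

/-- Look `q` times for anti-monotone edges along variables of `S`, and record them. -/
def collect {n : ℕ} (J : ℕ) (S : Finset (Var n)) : ℕ → (Fin n → Option (Cube n)) →
    QueryAlg n (Fin n → Option (Cube n))
  | 0, found => QueryAlg.ret found
  | q + 1, found => (sampleEdge false J S).bind fun o => collect J S q (record found o)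

/-- The violation formed by a monotone edge and a recorded anti-monotone edge. -/
def hit {n : ℕ} (found : Fin n → Option (Cube n)) (o : Option (Fin n × Cube n)) :
    Option (Fin n × Cube n × Cube n) :=
  o.bind fun v => (found v.1).map fun x => (v.1, v.2, x)

/-- Look once for a monotone edge along a variable of `S` with a recorded anti-monotone edge. -/
def searchHit {n : ℕ} (J : ℕ) (S : Finset (Var n)) (found : Fin n → Option (Cube n)) :
    QueryAlg n (Option (Fin n × Cube n × Cube n)) :=
  (sampleEdge true J S).bind fun o => QueryAlg.ret (hit found o)

/-- Preprocess a uniform subset of `S₀` of size `m'`, and look up to `r` times for a monotone edge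
along one of its variables with a recorded anti-monotone edge. -/
def searchBlock {n : ℕ} (J m' : ℕ) (ξ : ℝ) (r : ℕ) (S₀ : Finset (Var n))
    (found : Fin n → Option (Cube n)) : QueryAlg n (Option (Fin n × Cube n × Cube n)) :=
  QueryAlg.draw (Finset (Var n)) (uniformOn (S₀.powersetCard m')) fun V =>
    (preSet V ξ).bind fun S => (searchHit J S found).firstSome r

/-- Choose a uniform set `S₀` of `m` variables, preprocess it and collect anti-monotone edges with
`q` samples; then look for matching monotone edges with `B` small random subsets of `S₀`. -/
def attempt (n J m m' q r B : ℕ) (ξ ξ' : ℝ) : QueryAlg n (Option (Fin n × Cube n × Cube n)) :=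
  QueryAlg.draw (Finset (Var n)) (uniformOn (realSets n m)) fun S₀ =>
    (preSet S₀ ξ).bind fun S => (collect J S q fun _ => none).bind fun found =>
      (searchBlock J m' ξ' r S₀ found).firstSome B

/-! ### Query counts -/

lemma queriesAtMost_collect {n : ℕ} (J : ℕ) (S : Finset (Var n)) (q : ℕ)
    (found : Fin n → Option (Cube n)) : (collect J S q found).QueriesAtMost (q * (J + 2)) := by
  induction q generalizing found with
  | zero => trivial
  | succ q ih =>
    rw [show (q + 1) * (J + 2) = (J + 2) + q * (J + 2) by ring]
    exact (queriesAtMost_sampleEdge _ _ _).bind fun o => ih _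

lemma QueryAlg.QueriesAtMost.draw_uniformOn {n : ℕ} {α β : Type} [Inhabited β] {s : Finset β}
    (hs : s.Nonempty) {g : β → QueryAlg n α} {q : ℕ} (h : ∀ b ∈ s, (g b).QueriesAtMost q) :
    (QueryAlg.draw β (uniformOn s) g).QueriesAtMost q :=
  fun b hb => h b ((mem_support_uniformOn hs).1 hb)

lemma queriesAtMost_attempt {n J m m' q r B : ℕ} {ξ ξ' : ℝ} (hmn : m ≤ n) (hm' : m' ≤ m) :
    (attempt n J m m' q r B ξ ξ').QueriesAtMost
      (m * (numRounds n ξ * (2 + Nat.clog 2 m)) + (q * (J + 2) +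
        B * (m' * (numRounds n ξ' * (2 + Nat.clog 2 m')) + r * (J + 2)))) := by
  refine QueryAlg.QueriesAtMost.draw_uniformOn (realSets_nonempty hmn) fun S₀ hS₀ => ?_
  rw [mem_realSets] at hS₀
  have h1 := queriesAtMost_preSet S₀ ξ
  rw [hS₀.2] at h1
  refine h1.bind fun S => (queriesAtMost_collect J S q _).bind fun found =>
    QueryAlg.queriesAtMost_firstSome ?_ B
  refine QueryAlg.QueriesAtMost.draw_uniformOn
    (Finset.powersetCard_nonempty.2 (by omega)) fun V hV => ?_
  have h2 := queriesAtMost_preSet V ξ'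
  rw [(Finset.mem_powersetCard.1 hV).2] at h2
  refine h2.bind fun S' => QueryAlg.queriesAtMost_firstSome ?_ r
  exact ((queriesAtMost_sampleEdge _ _ _).bind (b := 0) fun o => trivial)

/-! ### Soundness -/

/-- All the recorded edges are anti-monotone. -/
def ValidRecord {n : ℕ} (f : Cube n → Bool) (found : Fin n → Option (Cube n)) : Prop :=
  ∀ i x, found i = some x → IsSignedEdge f false i x

lemma ValidRecord.record {n : ℕ} {f : Cube n → Bool} {found : Fin n → Option (Cube n)}
    (h : ValidRecord f found) {J : ℕ} {S : Finset (Var n)} {o : Option (Fin n × Cube n)}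
    (ho : o ∈ ((sampleEdge false J S).law f).support) : ValidRecord f (record found o) := by
  rcases o with _ | v
  · exact h
  intro i x hx
  by_cases hi : i = v.1
  · subst hi
    simp only [_root_.record, Function.update_self, Option.some.injEq] at hx
    exact hx ▸ sampleEdge_sound f false J S v ho
  · simp only [_root_.record, Function.update_of_ne hi] at hx
    exact h i x hx

lemma validRecord_of_mem_collect {n : ℕ} {f : Cube n → Bool} {J : ℕ} {S : Finset (Var n)} {q : ℕ}
    {found found' : Fin n → Option (Cube n)} (h : ValidRecord f found)
    (h' : found' ∈ ((collect J S q found).law f).support) : ValidRecord f found' := by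
  induction q generalizing found with
  | zero => simp [collect, QueryAlg.law] at h'; exact h' ▸ h
  | succ q ih =>
    rw [collect, QueryAlg.law_bind, PMF.mem_support_bind_iff] at h'
    obtain ⟨o, ho, h'⟩ := h'
    exact ih (h.record ho) h'

lemma attempt_sound {n : ℕ} (f : Cube n → Bool) (J m m' q r B : ℕ) (ξ ξ' : ℝ) :
    (attempt n J m m' q r B ξ ξ').Sound f (IsEdgeViolation f) := by
  refine QueryAlg.Sound.draw fun S₀ _ => QueryAlg.Sound.bind fun S _ =>
    QueryAlg.Sound.bind fun found hfound => QueryAlg.Sound.firstSome ?_ _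
  have hv : ValidRecord f found :=
    validRecord_of_mem_collect (fun i x h => by simp at h) hfound
  refine QueryAlg.Sound.draw fun V _ => QueryAlg.Sound.bind fun S' _ =>
    QueryAlg.Sound.firstSome (QueryAlg.Sound.bind fun o ho => ?_) _
  intro w hw
  simp only [QueryAlg.law, PMF.support_pure, Set.mem_singleton_iff] at hw
  rcases o with _ | v
  · simp [hit] at hw
  · simp only [hit, Option.bind_some] at hw
    rcases hx : found v.1 with _ | x
    · simp [hx] at hw
    · simp only [hx, Option.map_some, Option.some.injEq] at hw
      subst hw
      have h1 := sampleEdge_sound f true J S' v ho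
      have h2 := hv v.1 x hx
      unfold IsSignedEdge at h1 h2
      exact ⟨⟨h1.1, h1.2.2 rfl⟩, ⟨h2.1, fun e => by simpa using h2.2.1 e⟩⟩

/-! ### Collecting anti-monotone edges -/

open Classical in
/-- The number of variables in `G` with a recorded edge. -/
def foundCount {n : ℕ} (G : Finset (Fin n)) (found : Fin n → Option (Cube n)) : ℕ :=
  (G.filter fun i => found i ≠ none).card

lemma foundCount_record {n : ℕ} (G : Finset (Fin n)) (found : Fin n → Option (Cube n))
    (o : Option (Fin n × Cube n)) : (foundCount G found : ℝ≥0∞) +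
      ∑ i ∈ G.filter (fun i => found i = none), ind (o.map Prod.fst = some i) ≤
      foundCount G (record found o) := by
  classical
  rcases o with _ | ⟨k, x⟩
  · simp [record, ind]
  have hsum : ∑ i ∈ G.filter (fun i => found i = none),
      ind ((some (k, x)).map Prod.fst = some i) ≤
      ((if k ∈ G ∧ found k = none then 1 else 0 : ℕ) : ℝ≥0∞) := by
    rw [sum_ind, Nat.cast_le]
    split_ifs with h
    · refine Finset.card_le_one.2 fun a ha b hb => ?_
      simp only [Finset.mem_filter, Option.map_some, Option.some.injEq] at ha hb
      rw [← ha.2, ← hb.2]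
    · refine (Finset.card_eq_zero.2 (Finset.filter_eq_empty_iff.2 fun a ha hk => h ?_)).le
      simp only [Option.map_some, Option.some.injEq] at hk
      subst hk
      exact Finset.mem_filter.1 ha
  refine (add_le_add_right hsum _).trans ?_
  unfold foundCount
  norm_cast
  have hsub : (G.filter fun i => found i ≠ none) ⊆
      G.filter fun i => record found (some (k, x)) i ≠ none := by
    intro i hi
    rw [Finset.mem_filter] at hi ⊢
    refine ⟨hi.1, ?_⟩
    by_cases hik : i = k
    · subst hik; simp [record]
    · simpa [record, hik] using hi.2
  split_ifs with h
  · rw [← Finset.card_insert_of_notMem (a := k) (by simp [h.2])]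
    refine Finset.card_le_card (Finset.insert_subset ?_ hsub)
    exact Finset.mem_filter.2 ⟨h.1, by simp [record]⟩
  · exact Finset.card_le_card hsub

lemma le_foundCount_record {n : ℕ} (G : Finset (Fin n)) (found : Fin n → Option (Cube n))
    (o : Option (Fin n × Cube n)) : foundCount G found ≤ foundCount G (record found o) := by
  have := (le_add_right le_rfl).trans (foundCount_record G found o)
  exact_mod_cast this

lemma ex_collect_lt_eq_zero {n : ℕ} (f : Cube n → Bool) (J : ℕ) (S : Finset (Var n))
    (G : Finset (Fin n)) {d : ℕ} (q : ℕ) {found : Fin n → Option (Cube n)}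
    (h : d ≤ foundCount G found) :
    ex ((collect J S q found).law f) (fun F => ind (foundCount G F < d)) = 0 := by
  induction q generalizing found with
  | zero => rw [collect, QueryAlg.law, ex_pure, ind_of_not (by omega)]
  | succ q ih =>
    rw [collect, QueryAlg.law_bind, ex_bind]
    simp_rw [fun o => ih (h.trans (le_foundCount_record G found o))]
    exact ex_const _ 0

/-- As long as fewer than `d` variables of `G` have been found, each sample finds a new one with
probability at least `k * a`; hence `q` samples rarely find fewer than `d`. -/
lemma ex_collect_lt_le {n : ℕ} (f : Cube n → Bool) (J : ℕ) (S : Finset (Var n))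
    (G : Finset (Fin n)) {d k : ℕ} (hk : k + d ≤ G.card + 1) {a : ℝ≥0∞}
    (ha : ∀ i ∈ G, a ≤ ex ((sampleEdge false J S).law f) fun o => ind (o.map Prod.fst = some i))
    (q : ℕ) (found : Fin n → Option (Cube n)) :
    k * a * q * ex ((collect J S q found).law f) (fun F => ind (foundCount G F < d)) +
      (min d (foundCount G found) : ℕ) ≤ d := by
  classical
  induction q generalizing found with
  | zero => simp
  | succ q ih =>
    by_cases hd : d ≤ foundCount G found
    · rw [ex_collect_lt_eq_zero f J S G _ hd, mul_zero, zero_add]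
      exact_mod_cast min_le_left _ _
    rw [not_le] at hd
    set p := (sampleEdge false J S).law f with hp
    have e : ex ((collect J S (q + 1) found).law f) (fun F => ind (foundCount G F < d)) =
        ex p fun o => ex ((collect J S q (record found o)).law f)
          (fun F => ind (foundCount G F < d)) := by
      rw [collect, QueryAlg.law_bind, ex_bind]
    have h1 : ex p (fun o => k * a * q * ex ((collect J S q (record found o)).law f)
        (fun F => ind (foundCount G F < d)) + (min d (foundCount G (record found o)) : ℕ)) ≤ d :=
      ex_le_const fun o => ih _
    rw [ex_add, ex_const_mul, ← e] at h1
    have h2 : (foundCount G found : ℝ≥0∞) + k * a ≤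
        ex p fun o => ((min d (foundCount G (record found o)) : ℕ) : ℝ≥0∞) := by
      have h3 : (foundCount G found : ℝ≥0∞) + ex p (fun o =>
          ∑ i ∈ G.filter (fun i => found i = none), ind (o.map Prod.fst = some i)) ≤
          ex p fun o => ((min d (foundCount G (record found o)) : ℕ) : ℝ≥0∞) := by
        rw [← ex_const p (foundCount G found : ℝ≥0∞), ← ex_add]
        refine ex_mono fun o => ?_
        rw [(Nat.mono_cast (α := ℝ≥0∞)).map_min]
        refine le_min ?_ (foundCount_record G found o)
        -- at most one variable is found by one sample
        have h4 : ∑ i ∈ G.filter (fun i => found i = none), ind (o.map Prod.fst = some i) ≤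
            ((1 : ℕ) : ℝ≥0∞) := by
          rw [sum_ind, Nat.cast_le]
          refine Finset.card_le_one.2 fun b hb c hc => ?_
          have := (Finset.mem_filter.1 hb).2.symm.trans (Finset.mem_filter.1 hc).2
          exact Option.some.inj this
        refine (add_le_add_right h4 _).trans ?_
        exact_mod_cast hd
      refine le_trans (add_le_add_right ?_ _) h3
      rw [ex_sum]
      have h5 : G.card ≤ (G.filter fun i => found i = none).card + foundCount G found := by
        unfold foundCount
        have := Finset.card_filter_add_card_filter_not (s := G) (fun i => found i = none)
        exact this.symm.le
      calc (k : ℝ≥0∞) * a ≤ (G.filter fun i => found i = none).card * a := by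
            gcongr; omega
        _ ≤ _ := by
            rw [← nsmul_eq_mul]
            exact Finset.card_nsmul_le_sum _ _ _ fun i hi => ha i (Finset.mem_filter.1 hi).1
    have h6 : ex ((collect J S (q + 1) found).law f) (fun F => ind (foundCount G F < d)) ≤ 1 :=
      ex_le_const fun _ => ind_le_one _
    rw [min_eq_right hd.le]
    refine le_trans ?_ h1
    rw [Nat.cast_succ, mul_add, mul_one, add_mul, add_assoc]
    refine add_le_add_right ?_ _
    refine le_trans ?_ h2
    rw [add_comm]
    refine add_le_add_right ?_ _
    calc _ ≤ k * a * 1 := mul_le_mul_right h6 _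
      _ = k * a := mul_one _

lemma half_le_ex_collect {n : ℕ} (f : Cube n → Bool) (J : ℕ) (S : Finset (Var n))
    (G : Finset (Fin n)) {d k q : ℕ} (hd : 1 ≤ d) (hk : k + d ≤ G.card + 1) {a : ℝ≥0∞}
    (ha : ∀ i ∈ G, a ≤ ex ((sampleEdge false J S).law f) fun o => ind (o.map Prod.fst = some i))
    (hq : 2 * d ≤ k * a * q) :
    1 / 2 ≤ ex ((collect J S q fun _ => none).law f) (fun F => ind (d ≤ foundCount G F)) := by
  have h1 := (le_add_right le_rfl).trans (ex_collect_lt_le f J S G hk ha q fun _ => none)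
  set P := ex ((collect J S q fun _ => none).law f) (fun F => ind (foundCount G F < d)) with hP
  have h2 : (d : ℝ≥0∞) * (2 * P) ≤ d * 1 := by
    rw [mul_one]
    calc (d : ℝ≥0∞) * (2 * P) = 2 * d * P := by ring
      _ ≤ k * a * q * P := by gcongr
      _ ≤ d := h1
  have hd0 : (d : ℝ≥0∞) ≠ 0 := by exact_mod_cast (by omega : d ≠ 0)
  have h3 := (ENNReal.mul_le_mul_iff_right hd0 (by finiteness)).1 h2
  have h4 := ex_add_ex_not ((collect J S q fun _ => none).law f) fun F => foundCount G F < d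
  simp only [not_lt] at h4
  rw [← hP] at h4
  have h5 : P ≤ 1 / 2 := by
    rw [ENNReal.le_div_iff_mul_le (by simp) (by simp), mul_comm]; exact h3
  by_contra hcon
  rw [not_le] at hcon
  have h6 := ENNReal.add_lt_add_of_le_of_lt
    (ne_top_of_le_ne_top (by finiteness) h5) h5 hcon
  rw [h4, ENNReal.add_halves] at h6
  exact lt_irrefl _ h6

/-! ### Matching monotone edges -/

lemma Keeps.le_ex_sampleEdge {n J : ℕ} {ε : ℝ} {f : Cube n → Bool} {σ : Bool} {a : ℕ}
    {S : Finset (Var n)} {i : Fin n} (h : Keeps ε f σ a S i) (hn : none ∉ S)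
    (hJ : J * (2 / Real.logb 2 n ^ 2) + n * (1 / 2) ^ J ≤ (1 : ℝ) / 2) {b : ℝ≥0∞}
    (hb : b ≤ strongCount ε f σ i a / 2 ^ n / 4) :
    b ≤ ex ((sampleEdge σ J S).law f) fun o => ind (o.map Prod.fst = some i) := by
  refine hb.trans (le_trans ?_ (persistentCount_le_ex_sampleEdge f σ h.1 hn hJ))
  have h1 : (strongCount ε f σ i a : ℝ≥0∞) ≤ 2 * persistentCount f σ i (swapSet i S) := by
    exact_mod_cast h.2
  calc (strongCount ε f σ i a : ℝ≥0∞) / 2 ^ n / 4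
      ≤ 2 * persistentCount f σ i (swapSet i S) / 2 ^ n / 4 := by gcongr
    _ = (persistentCount f σ i (swapSet i S) : ℝ≥0∞) / 2 ^ n / 2 := by
        have : (4 : ℝ≥0∞) = 2 * 2 := by norm_num
        simp only [div_eq_mul_inv]
        rw [this, ENNReal.mul_inv (by simp) (by simp)]
        calc _ = (2 * 2⁻¹) * ((persistentCount f σ i (swapSet i S) : ℝ≥0∞) * (2 ^ n)⁻¹ * 2⁻¹) := by
              ring
          _ = _ := by rw [ENNReal.mul_inv_cancel (by simp) (by simp), one_mul]

open Classical in
/-- The events that a sample finds the different kept variables of `D` are disjoint, and each of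
them gives a match. -/
lemma ex_searchHit_none_add_le {n J : ℕ} {ε : ℝ} {f : Cube n → Bool} {a : ℕ}
    {S : Finset (Var n)} (hn : none ∉ S) {found : Fin n → Option (Cube n)} {D : Finset (Fin n)}
    (hD : ∀ i ∈ D, found i ≠ none)
    (hJ : J * (2 / Real.logb 2 n ^ 2) + n * (1 / 2) ^ J ≤ (1 : ℝ) / 2) {b : ℝ≥0∞}
    (hb : ∀ i ∈ D, b ≤ strongCount ε f true i a / 2 ^ n / 4) :
    ex ((searchHit J S found).law f) (fun o => ind (o = none)) +
      (D.filter fun i => Keeps ε f true a S i).card * b ≤ 1 := by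
  have e : ex ((searchHit J S found).law f) (fun o => ind (o = none)) =
      ex ((sampleEdge true J S).law f) fun o => ind (hit found o = none) := by
    rw [searchHit, QueryAlg.law_bind, ex_bind]
    simp only [QueryAlg.law, ex_pure]
  rw [e]
  have h1 : (D.filter fun i => Keeps ε f true a S i).card * b ≤
      ∑ i ∈ D.filter fun i => Keeps ε f true a S i,
        ex ((sampleEdge true J S).law f) fun o => ind (o.map Prod.fst = some i) := by
    rw [← nsmul_eq_mul]
    refine Finset.card_nsmul_le_sum _ _ _ fun i hi => ?_
    rw [Finset.mem_filter] at hi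
    exact hi.2.le_ex_sampleEdge hn hJ (hb i hi.1)
  refine (add_le_add_right h1 _).trans ?_
  rw [← ex_sum, ← ex_add]
  refine ex_le_const fun o => ?_
  by_cases h : hit found o = none
  · rw [ind_of h, Finset.sum_eq_zero, add_zero]
    intro i hi
    refine ind_of_not fun ho => ?_
    rcases o with _ | v
    · simp at ho
    · simp only [Option.map_some, Option.some.injEq] at ho
      have h2 := hD i (Finset.mem_of_mem_filter _ hi)
      rw [← ho] at h2
      obtain ⟨x, hx⟩ := Option.ne_none_iff_exists'.1 h2
      simp [hit, hx] at h
  · rw [ind_of_not h, zero_add, sum_ind, ← Nat.cast_one, Nat.cast_le]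
    refine Finset.card_le_one.2 fun b hb c hc => ?_
    exact Option.some.inj ((Finset.mem_filter.1 hb).2.symm.trans (Finset.mem_filter.1 hc).2)

/-- The law of the preprocessed random subset used by `searchBlock`. -/
def blockLaw {n : ℕ} (f : Cube n → Bool) (m' : ℕ) (ξ : ℝ) (S₀ : Finset (Var n)) :
    PMF (Finset (Var n)) :=
  (uniformOn (S₀.powersetCard m')).bind fun V => (preSet V ξ).law f

lemma subset_of_mem_blockLaw {n : ℕ} {f : Cube n → Bool} {m' : ℕ} {ξ : ℝ} {S₀ S : Finset (Var n)}
    (hm : m' ≤ S₀.card) (h : S ∈ (blockLaw f m' ξ S₀).support) : S ⊆ S₀ := by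
  rw [blockLaw, PMF.mem_support_bind_iff] at h
  obtain ⟨V, hV, h⟩ := h
  rw [mem_support_uniformOn (Finset.powersetCard_nonempty.2 hm), Finset.mem_powersetCard] at hV
  exact (preSet_subset h).trans hV.1

lemma ex_searchBlock_none_add_le {n J m' r : ℕ} {ξ ε : ℝ} {f : Cube n → Bool} {a : ℕ}
    {S₀ : Finset (Var n)} (hn : none ∉ S₀) (hm : m' ≤ S₀.card)
    {found : Fin n → Option (Cube n)} {D : Finset (Fin n)}
    (hD : ∀ i ∈ D, found i ≠ none)
    (hJ : J * (2 / Real.logb 2 n ^ 2) + n * (1 / 2) ^ J ≤ (1 : ℝ) / 2) {b θ : ℝ≥0∞}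
    (hb : ∀ i ∈ D, b ≤ strongCount ε f true i a / 2 ^ n / 4)
    (hr : r * (D.card * b) ≤ 1)
    (hθ : ∀ i ∈ D, θ ≤ ex (blockLaw f m' ξ S₀) fun S => ind (Keeps ε f true a S i)) :
    ex ((searchBlock J m' ξ r S₀ found).law f) (fun o => ind (o = none)) +
      r * (D.card * b) * θ / 2 ≤ 1 := by
  classical
  have e : ex ((searchBlock J m' ξ r S₀ found).law f) (fun o => ind (o = none)) =
      ex (blockLaw f m' ξ S₀) fun S =>
        ex ((searchHit J S found).law f) (fun o => ind (o = none)) ^ r := by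
    rw [searchBlock, QueryAlg.law, ex_bind, blockLaw, ex_bind]
    congr 1
    funext V
    rw [QueryAlg.law_bind, ex_bind]
    simp_rw [QueryAlg.ex_firstSome_none]
  -- the expected number of variables of `D` that a block keeps is at least `D.card * θ`
  have h1 : r * (D.card * b) * θ / 2 ≤ ex (blockLaw f m' ξ S₀) fun S =>
      r * ((D.filter fun i => Keeps ε f true a S i).card * b) / 2 := by
    have h2 : D.card * θ ≤ ex (blockLaw f m' ξ S₀) fun S =>
        ((D.filter fun i => Keeps ε f true a S i).card : ℝ≥0∞) := by
      simp_rw [← sum_ind]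
      rw [ex_sum, ← nsmul_eq_mul]
      exact Finset.card_nsmul_le_sum _ _ _ hθ
    calc r * (D.card * b) * θ / 2 = (r * b / 2) * (D.card * θ) := by
          simp only [div_eq_mul_inv]; ring
      _ ≤ (r * b / 2) * ex (blockLaw f m' ξ S₀) fun S =>
        ((D.filter fun i => Keeps ε f true a S i).card : ℝ≥0∞) := by gcongr
      _ = _ := by
          rw [← ex_const_mul]
          congr 1
          funext S
          simp only [div_eq_mul_inv]; ring
  rw [e]
  refine (add_le_add_right h1 _).trans ?_
  rw [← ex_add]
  refine (ex_mono_support fun S hS => ?_).trans_eq (ex_const (blockLaw f m' ξ S₀) 1)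
  have hnS : none ∉ S := fun h => hn (subset_of_mem_blockLaw hm hS h)
  refine pow_add_mul_div_two_le_one (ex_searchHit_none_add_le hnS hD hJ hb) (le_trans ?_ hr)
  gcongr
  exact Finset.filter_subset _ _

/-- The block size cancels in the success probability: `B` blocks, each of which keeps a variable
with probability `θ`, are as good as one block that keeps it with probability `1 / 2`. -/
lemma le_ex_searchBlocks {n J m' r B : ℕ} {ξ ε : ℝ} {f : Cube n → Bool} {a : ℕ}
    {S₀ : Finset (Var n)} (hn : none ∉ S₀) (hm : m' ≤ S₀.card)
    {found : Fin n → Option (Cube n)} {D : Finset (Fin n)}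
    (hD : ∀ i ∈ D, found i ≠ none)
    (hJ : J * (2 / Real.logb 2 n ^ 2) + n * (1 / 2) ^ J ≤ (1 : ℝ) / 2) {b θ : ℝ≥0∞}
    (hb : ∀ i ∈ D, b ≤ strongCount ε f true i a / 2 ^ n / 4)
    (hr : r * (D.card * b) ≤ 1)
    (hθ : ∀ i ∈ D, θ ≤ ex (blockLaw f m' ξ S₀) fun S => ind (Keeps ε f true a S i))
    (hB : B * θ = 1 / 2) :
    r * (D.card * b) / 8 ≤
      ex (((searchBlock J m' ξ r S₀ found).firstSome B).law f) (fun o => ind (o ≠ none)) := by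
  have h1 := ex_searchBlock_none_add_le hn hm hD hJ hb hr hθ
  have e : B * (r * (D.card * b) * θ / 2) = r * (D.card * b) / 4 := by
    calc B * (r * (D.card * b) * θ / 2) = r * (D.card * b) * (B * θ) * 2⁻¹ := by
          simp only [div_eq_mul_inv]; ring
      _ = r * (D.card * b) * (2⁻¹ * 2⁻¹) := by rw [hB, one_div]; ring
      _ = _ := by
          rw [← ENNReal.mul_inv (by simp) (by simp)]
          norm_num
          rfl
  have h2 := pow_add_mul_div_two_le_one h1 (r := B) (by
    rw [e]
    refine ENNReal.div_le_of_le_mul (hr.trans (by norm_num)))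
  rw [e, ← QueryAlg.ex_firstSome_none] at h2
  have h3 := ex_add_ex_not (((searchBlock J m' ξ r S₀ found).firstSome B).law f)
    fun o => o = none
  rw [← h3] at h2
  have hfin : ex (((searchBlock J m' ξ r S₀ found).firstSome B).law f) (fun o => ind (o = none)) ≠ ⊤ :=
    ne_top_of_le_ne_top ENNReal.one_ne_top (ex_le_const fun _ => ind_le_one _)
  refine le_trans (le_of_eq ?_) ((ENNReal.add_le_add_iff_left hfin).1 h2)
  simp only [div_eq_mul_inv]
  rw [mul_assoc, mul_assoc _ (4⁻¹), ← ENNReal.mul_inv (by simp) (by simp)]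
  norm_num [mul_assoc]

/-! ### The success probability of an attempt -/

/-- For most `S₀` that contain `i`, a random block keeps `i` at least half as often as it contains
`i`. -/
lemma ex_not_block_keeps_le {n : ℕ} (ε : ℝ) (f : Cube n → Bool) {s j jv : ℕ} (i : Fin n)
    (hj : (2 : ℝ) ^ j ≤ (n : ℝ) ^ (2 / 3 : ℝ)) (hjn : 2 * 2 ^ j ≤ n) (hjv : jv ≤ j)
    (hs : s ≤ Lam n ε) {η : ℝ≥0∞}
    (hη : 2 * ENNReal.ofReal (1 / Real.logb 2 n) +
        (2 ^ jv : ℕ) * (numRounds n (1 / 2 ^ s) * roundErr f i (2 ^ jv)) ≤ η) :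
    ex (uniformOn (realSets n (2 ^ j))) (fun S₀ => ind (some i ∈ S₀) *
      ind (¬ ((2 ^ jv : ℕ) : ℝ≥0∞) / (2 ^ j : ℕ) / 2 ≤
        ex (blockLaw f (2 ^ jv) (1 / 2 ^ s) S₀) fun S => ind (Keeps ε f true s S i))) ≤
      4 * (2 ^ j : ℕ) / n * η := by
  have hmv : 2 ^ jv ≤ 2 ^ j := Nat.pow_le_pow_right (by norm_num) hjv
  have hj' : (2 : ℝ) ^ jv ≤ (n : ℝ) ^ (2 / 3 : ℝ) :=
    (pow_le_pow_right₀ (by norm_num) hjv).trans hj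
  set θ : ℝ≥0∞ := ((2 ^ jv : ℕ) : ℝ≥0∞) / (2 ^ j : ℕ) / 2 with hθ
  have hv0 : ((2 ^ jv : ℕ) : ℝ≥0∞) ≠ 0 := by positivity
  have hj0 : ((2 ^ j : ℕ) : ℝ≥0∞) ≠ 0 := by positivity
  have hθ0 : θ ≠ 0 := by simp [hθ]
  have hθt : θ ≠ ⊤ := by
    rw [hθ]; exact ENNReal.div_ne_top (ENNReal.div_ne_top (by finiteness) hj0) (by simp)
  set Ψ : Finset (Var n) → ℝ≥0∞ := fun V => ind (some i ∈ V) *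
    ex ((preSet V (1 / 2 ^ s)).law f) fun S => ind (¬ Keeps ε f true s S i) with hΨ
  have h1 : ex (uniformOn (realSets n (2 ^ j))) (fun S₀ =>
      ex (uniformOn (S₀.powersetCard (2 ^ jv))) Ψ) ≤ 2 * (2 ^ jv : ℕ) / n * η := by
    have := ex_uniform_uniform (U := ({none}ᶜ : Finset (Var n))) hmv
      (by rw [card_proper]; omega) Ψ
    refine le_of_eq_of_le this ?_
    refine (ex_not_keeps_le ε f true i hj' (by omega) le_rfl hs).trans ?_
    gcongr
  have h2 : ∀ S₀ ∈ (uniformOn (realSets n (2 ^ j))).support, θ * (ind (some i ∈ S₀) *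
      ind (¬ θ ≤ ex (blockLaw f (2 ^ jv) (1 / 2 ^ s) S₀) fun S => ind (Keeps ε f true s S i))) ≤
      ex (uniformOn (S₀.powersetCard (2 ^ jv))) Ψ := by
    intro S₀ hS₀
    rw [mem_support_uniformOn (realSets_nonempty (by omega)), mem_realSets] at hS₀
    rw [ind_mul_ind]
    by_cases h : some i ∈ S₀ ∧ ¬ θ ≤ ex (blockLaw f (2 ^ jv) (1 / 2 ^ s) S₀)
      fun S => ind (Keeps ε f true s S i)
    swap
    · rw [ind_of_not h, mul_zero]; exact zero_le
    rw [ind_of h, mul_one]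
    obtain ⟨hi, h⟩ := h
    rw [not_le] at h
    have h3 := ex_uniform_mem (m := 2 ^ jv) hi (by rw [hS₀.2]; exact hmv)
    rw [hS₀.2] at h3
    have h4 : θ + θ ≤ ex (uniformOn (S₀.powersetCard (2 ^ jv))) Ψ +
        ex (blockLaw f (2 ^ jv) (1 / 2 ^ s) S₀) fun S => ind (Keeps ε f true s S i) := by
      rw [hθ, ENNReal.add_halves, ← h3, blockLaw, ex_bind, ← ex_add]
      refine ex_mono fun V => ?_
      by_cases hV : some i ∈ V
      · simp only [hΨ]
        rw [ind_of hV, one_mul, add_comm, ex_add_ex_not]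
      · rw [ind_of_not hV]; exact zero_le
    -- a block contains `i` with probability `2 * θ`, and keeps it with probability less than `θ`
    by_contra hcon
    rw [not_le] at hcon
    exact absurd h4 (not_le.2 (ENNReal.add_lt_add hcon h))
  have h5 := (ex_mono_support h2).trans h1
  rw [ex_const_mul] at h5
  refine (ENNReal.mul_le_mul_iff_right hθ0 hθt).1 (h5.trans (le_of_eq ?_))
  rw [hθ]
  simp only [div_eq_mul_inv]
  have h22 : (2 : ℝ≥0∞)⁻¹ * 4 = 2 := by
    rw [show (4 : ℝ≥0∞) = 2 * 2 by norm_num, ← mul_assoc, ENNReal.inv_mul_cancel (by simp) (by simp),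
      one_mul]
  calc 2 * ((2 ^ jv : ℕ) : ℝ≥0∞) * (n : ℝ≥0∞)⁻¹ * η =
        (((2 ^ j : ℕ) : ℝ≥0∞)⁻¹ * (2 ^ j : ℕ)) * (((2 : ℝ≥0∞)⁻¹ * 4) * ((2 ^ jv : ℕ) : ℝ≥0∞) *
          (n : ℝ≥0∞)⁻¹ * η) := by
        rw [h22, ENNReal.inv_mul_cancel hj0 (by finiteness), one_mul]
    _ = _ := by ring

open Classical in
/-- The variables of `I` that `S` keeps for anti-monotone edges, and that random blocks of `S₀`
keep for monotone edges as often as can be expected. -/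
def goodVars {n : ℕ} (ε : ℝ) (f : Cube n → Bool) (s t j jv : ℕ) (I : Finset (Fin n))
    (S₀ S : Finset (Var n)) : Finset (Fin n) :=
  I.filter fun i => some i ∈ S₀ ∧ Keeps ε f false t S i ∧
    ((2 ^ jv : ℕ) : ℝ≥0∞) / (2 ^ j : ℕ) / 2 ≤
      ex (blockLaw f (2 ^ jv) (1 / 2 ^ s) S₀) fun S' => ind (Keeps ε f true s S' i)

/-- The law of the random set `S₀` and of its preprocessed version. -/
def startLaw {n : ℕ} (f : Cube n → Bool) (m : ℕ) (ξ : ℝ) :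
    PMF (Finset (Var n) × Finset (Var n)) :=
  (uniformOn (realSets n m)).bind fun S₀ => ((preSet S₀ ξ).law f).map fun S => (S₀, S)

lemma ex_startLaw {n : ℕ} (f : Cube n → Bool) (m : ℕ) (ξ : ℝ)
    (g : Finset (Var n) × Finset (Var n) → ℝ≥0∞) : ex (startLaw f m ξ) g =
      ex (uniformOn (realSets n m)) fun S₀ => ex ((preSet S₀ ξ).law f) fun S => g (S₀, S) := by
  rw [startLaw, ex_bind]
  simp_rw [ex_map]

/-- With constant probability, the number of good variables is at least a quarter of the expected
number of variables of `I` in the random set. -/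
lemma goodVars_large {n : ℕ} (ε : ℝ) (f : Cube n → Bool) {s t j jv : ℕ} {I : Finset (Fin n)}
    (hj : (2 : ℝ) ^ j ≤ (n : ℝ) ^ (2 / 3 : ℝ)) (hjn : 2 * 2 ^ j ≤ n) (hjv : jv ≤ j)
    (ht : t ≤ Lam n ε) (hs : s ≤ Lam n ε)
    (herr₁ : ∀ i ∈ I, 2 * ENNReal.ofReal (1 / Real.logb 2 n) +
        (2 ^ j : ℕ) * (numRounds n (1 / 2 ^ t) * roundErr f i (2 ^ j)) ≤ 1 / 24)
    (herr₂ : ∀ i ∈ I, 2 * ENNReal.ofReal (1 / Real.logb 2 n) +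
        (2 ^ jv : ℕ) * (numRounds n (1 / 2 ^ s) * roundErr f i (2 ^ jv)) ≤ 1 / 24)
    (hK : (1 : ℝ) / 8 ≤ I.card * 2 ^ j / n) :
    ENNReal.ofReal (1 / 144) ≤ ex (startLaw f (2 ^ j) (1 / 2 ^ t)) fun P =>
      ind ((I.card * 2 ^ j / n : ℝ) / 4 < (goodVars ε f s t j jv I P.1 P.2).card) := by
  classical
  have hn : 0 < n := by have := Nat.one_le_two_pow (n := j); omega
  have hn0 : (n : ℝ≥0∞) ≠ 0 := by exact_mod_cast hn.ne'
  set K : ℝ := I.card * 2 ^ j / n with hKdef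
  have hKo : ENNReal.ofReal K = I.card * ((2 ^ j : ℕ) / n) := by
    rw [hKdef, mul_div_assoc, ENNReal.ofReal_mul (by positivity), ENNReal.ofReal_natCast,
      ENNReal.ofReal_div_of_pos (by exact_mod_cast hn), ENNReal.ofReal_natCast,
      ENNReal.ofReal_pow (by norm_num), ENNReal.ofReal_ofNat]
    push_cast
    rfl
  have hmem : ∀ i : Fin n, ex (uniformOn (realSets n (2 ^ j))) (fun S₀ => ind (some i ∈ S₀)) =
      ((2 ^ j : ℕ) : ℝ≥0∞) / n := by
    intro i
    have := ex_uniform_mem (U := ({none}ᶜ : Finset (Var n))) (v := some i) (m := 2 ^ j)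
      (by simp) (by rw [card_proper]; omega)
    rwa [card_proper] at this
  refine paley_zygmund _ _ hK ?_ ?_
  · have hpt : ∀ P : Finset (Var n) × Finset (Var n), ∑ i ∈ I, ind (some i ∈ P.1) ≤
        ((goodVars ε f s t j jv I P.1 P.2).card : ℝ≥0∞) +
        ∑ i ∈ I, (ind (some i ∈ P.1) * ind (¬ Keeps ε f false t P.2 i) + ind (some i ∈ P.1) *
          ind (¬ ((2 ^ jv : ℕ) : ℝ≥0∞) / (2 ^ j : ℕ) / 2 ≤
          ex (blockLaw f (2 ^ jv) (1 / 2 ^ s) P.1) fun S' => ind (Keeps ε f true s S' i))) := by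
      intro P
      rw [goodVars, ← sum_ind, ← Finset.sum_add_distrib]
      refine Finset.sum_le_sum fun i _ => ?_
      rw [ind_mul_ind, ind_mul_ind]
      by_cases h1 : some i ∈ P.1
      swap
      · rw [ind_of_not h1]; exact zero_le
      by_cases h2 : Keeps ε f false t P.2 i
      swap
      · rw [ind_of h1, ind_of (⟨h1, h2⟩ : _ ∧ ¬ Keeps ε f false t P.2 i)]
        exact le_add_left (le_add_right le_rfl)
      by_cases h3 : ((2 ^ jv : ℕ) : ℝ≥0∞) / (2 ^ j : ℕ) / 2 ≤
          ex (blockLaw f (2 ^ jv) (1 / 2 ^ s) P.1) fun S' => ind (Keeps ε f true s S' i)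
      · exact le_add_right (ind_mono fun _ => ⟨h1, h2, h3⟩)
      · exact le_add_left (le_add_left (ind_mono fun _ => ⟨h1, h3⟩))
    have hex := ex_mono (p := startLaw f (2 ^ j) (1 / 2 ^ t)) hpt
    rw [ex_add, ex_sum, ex_sum] at hex
    have hL : ∑ i ∈ I, ex (startLaw f (2 ^ j) (1 / 2 ^ t)) (fun P => ind (some i ∈ P.1)) =
        ENNReal.ofReal K := by
      rw [hKo, Finset.sum_congr rfl (g := fun _ => ((2 ^ j : ℕ) : ℝ≥0∞) / n), Finset.sum_const,
        nsmul_eq_mul]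
      intro i _
      rw [ex_startLaw]
      simp_rw [ex_const]
      exact hmem i
    rw [hL] at hex
    refine hex.trans (add_le_add_right ?_ _)
    have hR : ∀ i ∈ I, ex (startLaw f (2 ^ j) (1 / 2 ^ t)) (fun P =>
        ind (some i ∈ P.1) * ind (¬ Keeps ε f false t P.2 i) + ind (some i ∈ P.1) *
          ind (¬ ((2 ^ jv : ℕ) : ℝ≥0∞) / (2 ^ j : ℕ) / 2 ≤
          ex (blockLaw f (2 ^ jv) (1 / 2 ^ s) P.1) fun S' => ind (Keeps ε f true s S' i))) ≤
        ((2 ^ j : ℕ) : ℝ≥0∞) / n * (1 / 4) := by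
      intro i hi
      rw [ex_add, ex_startLaw, ex_startLaw]
      simp_rw [ex_const, ex_const_mul]
      have h1 := (ex_not_keeps_le ε f false (a := t) (k := t) i hj hjn le_rfl ht).trans
        (mul_le_mul_right (herr₁ i hi) _)
      have h2 := ex_not_block_keeps_le ε f i hj hjn hjv hs (herr₂ i hi)
      refine (add_le_add h1 h2).trans (le_of_eq ?_)
      have e24 : (6 : ℝ≥0∞) * (1 / 24) = 1 / 4 := by
        rw [show (24 : ℝ≥0∞) = 6 * 4 by norm_num, one_div, one_div,
          ENNReal.mul_inv (by simp) (by simp), ← mul_assoc,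
          ENNReal.mul_inv_cancel (by simp) (by simp), one_mul]
      rw [← e24]
      simp only [div_eq_mul_inv]
      ring
    refine (Finset.sum_le_card_nsmul _ _ _ hR).trans (le_of_eq ?_)
    rw [nsmul_eq_mul, ← mul_assoc, ← hKo]
    clear_value K
    rw [ENNReal.ofReal_div_of_pos (by norm_num), div_eq_mul_inv, one_mul, div_eq_mul_inv]
    norm_num
  · have hpt : ∀ P : Finset (Var n) × Finset (Var n),
        ((goodVars ε f s t j jv I P.1 P.2).card : ℝ≥0∞) ^ 2 ≤
        ∑ i ∈ I, ∑ k ∈ I, ind (some i ∈ P.1 ∧ some k ∈ P.1) := by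
      intro P
      have h1 : ((goodVars ε f s t j jv I P.1 P.2).card : ℝ≥0∞) ≤ ∑ i ∈ I, ind (some i ∈ P.1) := by
        rw [goodVars, ← sum_ind]
        exact Finset.sum_le_sum fun i _ => ind_mono fun h => h.1
      calc _ ≤ (∑ i ∈ I, ind (some i ∈ P.1)) ^ 2 := by gcongr
        _ = _ := by
          rw [sq, Finset.sum_mul_sum]
          simp_rw [ind_mul_ind]
    refine (ex_mono hpt).trans ?_
    rw [ex_sum]
    simp_rw [ex_sum]
    have h2 : ∀ i ∈ I, ∀ k ∈ I, ex (startLaw f (2 ^ j) (1 / 2 ^ t)) (fun P =>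
        ind (some i ∈ P.1 ∧ some k ∈ P.1)) ≤
        (if k = i then ((2 ^ j : ℕ) : ℝ≥0∞) / n else 0) + (((2 ^ j : ℕ) : ℝ≥0∞) / n) ^ 2 := by
      intro i _ k _
      rw [ex_startLaw]
      simp_rw [ex_const]
      split_ifs with hik
      · subst hik
        simp_rw [and_self]
        exact (hmem k).le.trans (le_add_right le_rfl)
      · rw [zero_add]
        have := ex_uniform_mem_mem_le (U := ({none}ᶜ : Finset (Var n))) (v := some i)
          (w := some k) (m := 2 ^ j) (by simp) (by simp) (by simpa using fun h => hik h.symm)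
          (by rw [card_proper]; omega)
        rwa [card_proper] at this
    refine (Finset.sum_le_sum fun i hi => Finset.sum_le_sum (h2 i hi)).trans (le_of_eq ?_)
    rw [ENNReal.ofReal_add (by linarith) (by positivity), ENNReal.ofReal_pow (by linarith), hKo]
    simp_rw [Finset.sum_add_distrib]
    congr 1
    · rw [Finset.sum_congr rfl (g := fun _ => ((2 ^ j : ℕ) : ℝ≥0∞) / n), Finset.sum_const,
        nsmul_eq_mul]
      intro i hi
      rw [Finset.sum_ite_eq' I i, if_pos hi]
    · rw [Finset.sum_const, Finset.sum_const, nsmul_eq_mul, nsmul_eq_mul]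
      ring

/-- The success probability of an attempt is bounded below by a constant if the numbers of samples
fit the scores. -/
lemma le_ex_attempt {n : ℕ} {ε : ℝ} {f : Cube n → Bool} {s t j jv J d q r : ℕ}
    {I : Finset (Fin n)} {a b κ : ℝ≥0∞}
    (hj : (2 : ℝ) ^ j ≤ (n : ℝ) ^ (2 / 3 : ℝ)) (hjn : 2 * 2 ^ j ≤ n) (hjv : jv ≤ j)
    (ht : t ≤ Lam n ε) (hs : s ≤ Lam n ε)
    (hJ : J * (2 / Real.logb 2 n ^ 2) + n * (1 / 2) ^ J ≤ (1 : ℝ) / 2)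
    (herr₁ : ∀ i ∈ I, 2 * ENNReal.ofReal (1 / Real.logb 2 n) +
        (2 ^ j : ℕ) * (numRounds n (1 / 2 ^ t) * roundErr f i (2 ^ j)) ≤ 1 / 24)
    (herr₂ : ∀ i ∈ I, 2 * ENNReal.ofReal (1 / Real.logb 2 n) +
        (2 ^ jv : ℕ) * (numRounds n (1 / 2 ^ s) * roundErr f i (2 ^ jv)) ≤ 1 / 24)
    (hK : (1 : ℝ) / 8 ≤ I.card * 2 ^ j / n)
    (ha : ∀ i ∈ I, a ≤ strongCount ε f false i t / 2 ^ n / 4)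
    (hb : ∀ i ∈ I, b ≤ strongCount ε f true i s / 2 ^ n / 4)
    (hd : 1 ≤ d) (hdK : (d : ℝ) - 1 ≤ (I.card * 2 ^ j / n : ℝ) / 8)
    (hq : 2 * d ≤ ENNReal.ofReal ((I.card * 2 ^ j / n : ℝ) / 8) * a * q)
    (hr : r * (d * b) ≤ 1) (hκ : κ ≤ r * (d * b)) :
    ENNReal.ofReal (1 / 144) * (1 / 2 * (κ / 8)) ≤
      ex ((attempt n J (2 ^ j) (2 ^ jv) q r (2 ^ (j - jv)) (1 / 2 ^ t) (1 / 2 ^ s)).law f)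
        fun o => ind (o ≠ none) := by
  classical
  have hmv : 2 ^ jv ≤ 2 ^ j := Nat.pow_le_pow_right (by norm_num) hjv
  refine (mul_le_mul_left (goodVars_large ε f hj hjn hjv ht hs herr₁ herr₂ hK) _).trans ?_
  rw [← ex_mul_const, ex_startLaw, attempt, QueryAlg.law, ex_bind]
  refine ex_mono_support fun S₀ hS₀ => ?_
  rw [mem_support_uniformOn (realSets_nonempty (by omega)), mem_realSets] at hS₀
  rw [QueryAlg.law_bind, ex_bind]
  refine ex_mono_support fun S hS => ?_
  have hnS : none ∉ S := fun h => hS₀.1 (preSet_subset hS h)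
  by_cases hG : (I.card * 2 ^ j / n : ℝ) / 4 < (goodVars ε f s t j jv I S₀ S).card
  swap
  · rw [ind_of_not hG, zero_mul]; exact zero_le
  rw [ind_of hG, one_mul, QueryAlg.law_bind, ex_bind]
  set G := goodVars ε f s t j jv I S₀ S with hGdef
  have hGmem : ∀ i ∈ G, i ∈ I ∧ some i ∈ S₀ ∧ Keeps ε f false t S i ∧
      ((2 ^ jv : ℕ) : ℝ≥0∞) / (2 ^ j : ℕ) / 2 ≤
      ex (blockLaw f (2 ^ jv) (1 / 2 ^ s) S₀) fun S' => ind (Keeps ε f true s S' i) :=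
    fun i hi => Finset.mem_filter.1 hi
  have hdG : d ≤ G.card + 1 := by
    have : (d : ℝ) ≤ G.card + 1 := by linarith
    exact_mod_cast this
  have hkK : (I.card * 2 ^ j / n : ℝ) / 8 ≤ ((G.card + 1 - d : ℕ) : ℝ) := by
    rw [Nat.cast_sub hdG]; push_cast; linarith
  have half := half_le_ex_collect f J S G (k := G.card + 1 - d) (q := q) (a := a) hd
    (by omega) (fun i hi => (hGmem i hi).2.2.1.le_ex_sampleEdge hnS hJ (ha i (hGmem i hi).1))
    (by
      refine hq.trans ?_
      gcongr
      rw [← ENNReal.ofReal_natCast]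
      exact ENNReal.ofReal_le_ofReal hkK)
  refine (mul_le_mul_left half _).trans ?_
  rw [← ex_mul_const]
  refine ex_mono fun found => ?_
  by_cases hfound : d ≤ foundCount G found
  swap
  · rw [ind_of_not hfound, zero_mul]; exact zero_le
  rw [ind_of hfound, one_mul]
  obtain ⟨D, hDsub, hDc⟩ := Finset.exists_subset_card_eq hfound
  have hDG : ∀ i ∈ D, i ∈ G ∧ found i ≠ none := fun i hi => Finset.mem_filter.1 (hDsub hi)
  rw [← hDc] at hr hκ
  have hfin := le_ex_searchBlocks (J := J) (m' := 2 ^ jv) (r := r) (B := 2 ^ (j - jv))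
    (ξ := 1 / 2 ^ s) (ε := ε) (f := f) (a := s) (found := found) (D := D)
    (θ := ((2 ^ jv : ℕ) : ℝ≥0∞) / (2 ^ j : ℕ) / 2) hS₀.1
    (by rw [hS₀.2]; exact hmv) (fun i hi => (hDG i hi).2) hJ
    (fun i hi => hb i (hGmem i (hDG i hi).1).1) hr
    (fun i hi => (hGmem i (hDG i hi).1).2.2.2) (by
      have e : (2 ^ j : ℕ) = 2 ^ (j - jv) * 2 ^ jv := by rw [← pow_add]; congr 1; omega
      rw [← mul_div_assoc, ← mul_div_assoc, ← Nat.cast_mul, ← e,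
        ENNReal.div_self (by positivity) (by finiteness)])
  exact (ENNReal.div_le_div_right hκ _).trans hfin

/-! ### The choice of the parameters -/

/-- The exponent `u` for which `2 ^ u` is `n^{1/3}` up to a factor of two. -/
def rootExp (n : ℕ) : ℕ := (Nat.clog 2 n + 2) / 3

/-- The logarithm of the number of good variables that a set of size `2 ^ sizeExp` is expected to
contain (up to constants); it is `0` unless `2 ^ ℓ` exceeds `n^{2/3} 2 ^ s`. -/
def gainExp (u s ℓ : ℕ) : ℕ := ℓ - s - 2 * u

/-- The logarithm of the size of the set chosen by an attempt. -/
def sizeExp (u s t ℓ : ℕ) : ℕ := u - t + gainExp u s ℓ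

/-- The logarithm of the size of the blocks: the largest size for which replacing one variable of
low influence is negligible at precision `2 ^ (-s)`, unless the whole set is smaller. -/
def blockExp (u s t ℓ : ℕ) : ℕ := min (sizeExp u s t ℓ) (ℓ - s - u)

/-- The relations between the parameters that are used in the analysis; `A` is the cube root of
`n`. -/
structure Regime (n u s t h ℓ : ℕ) (A : ℝ) : Prop where
  pow_three : A ^ 3 = n
  two_le : 2 ≤ A
  le_pow : A ≤ 2 ^ u
  pow_lt : 2 ^ u < 2 * A
  one_le_t : 1 ≤ t
  t_le_s : t ≤ s
  s_lt_u : s < u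
  t_add_le : t + 2 * u ≤ ℓ + 1
  ℓ_le : ℓ ≤ 3 * u
  ℓ_add_le : ℓ + s ≤ h + u
  sq_mul_le : A ^ 2 * 2 ^ t ≤ 2 ^ ℓ
  pow_le : (2 : ℝ) ^ ℓ ≤ n

lemma rootExp_spec {n : ℕ} (hn : 2 ≤ n) {A : ℝ} (hA : A ^ 3 = n) (hA0 : 0 ≤ A) :
    A ≤ 2 ^ rootExp n ∧ (2 : ℝ) ^ rootExp n < 2 * A := by
  have h1 : n ≤ 2 ^ Nat.clog 2 n := Nat.le_pow_clog (by norm_num) n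
  have h2 : 2 ^ (Nat.clog 2 n - 1) < n := Nat.pow_pred_clog_lt_self (by norm_num) hn
  have h3 : 1 ≤ Nat.clog 2 n := Nat.clog_pos (by norm_num) hn
  have e1 : Nat.clog 2 n ≤ rootExp n * 3 := by unfold rootExp; omega
  have e2 : rootExp n * 3 ≤ (Nat.clog 2 n - 1) + 3 := by unfold rootExp; omega
  constructor
  · refine le_of_pow_le_pow_left₀ (n := 3) (by norm_num) (by positivity) ?_
    rw [hA, ← pow_mul]
    exact_mod_cast h1.trans (Nat.pow_le_pow_right (by norm_num) e1)
  · refine lt_of_pow_lt_pow_left₀ 3 (by positivity) ?_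
    rw [mul_pow, hA, ← pow_mul]
    have : 2 ^ (rootExp n * 3) < n * 2 ^ 3 :=
      (Nat.pow_le_pow_right (by norm_num) e2).trans_lt (by rw [pow_add]; omega)
    have h4 : (2 : ℝ) ^ (rootExp n * 3) < n * 2 ^ 3 := by exact_mod_cast this
    linarith

namespace Regime

variable {n u s t h ℓ : ℕ} {A : ℝ}

lemma pos (H : Regime n u s t h ℓ A) : 0 < A := by linarith [H.two_le]

lemma sizeExp_eq (H : Regime n u s t h ℓ A) :
    sizeExp u s t ℓ = u - t ∧ ℓ ≤ s + 2 * u ∨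
      sizeExp u s t ℓ + (s + t + u) = ℓ ∧ s + 2 * u ≤ ℓ := by
  have h1 := H.t_le_s
  have h2 := H.s_lt_u
  have h3 := H.t_add_le
  unfold sizeExp gainExp
  omega

lemma pow_sub_le (H : Regime n u s t h ℓ A) {k : ℕ} (hk : k + u ≤ ℓ) :
    (2 : ℝ) ^ k ≤ A ^ 2 := by
  have h1 : (2 : ℝ) ^ k * 2 ^ u ≤ A ^ 2 * A := by
    rw [← pow_add, ← pow_succ, H.pow_three]
    exact (pow_le_pow_right₀ (by norm_num) hk).trans H.pow_le
  have h2 : (2 : ℝ) ^ k * A ≤ A ^ 2 * A :=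
    (mul_le_mul_of_nonneg_left H.le_pow (by positivity)).trans h1
  exact le_of_mul_le_mul_right h2 H.pos

lemma pow_sizeExp_le (H : Regime n u s t h ℓ A) : (2 : ℝ) ^ sizeExp u s t ℓ ≤ A ^ 2 := by
  rcases H.sizeExp_eq with h1 | h1
  · have h2 : (2 : ℝ) ^ sizeExp u s t ℓ * 2 ≤ 2 ^ u := by
      rw [← pow_succ]
      have := H.one_le_t
      have := H.t_le_s
      have := H.s_lt_u
      exact pow_le_pow_right₀ (by norm_num) (by omega)
    nlinarith [H.two_le, H.pow_lt]
  · exact H.pow_sub_le (by omega)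

lemma two_mul_pow_sizeExp_le (H : Regime n u s t h ℓ A) : 2 * 2 ^ sizeExp u s t ℓ ≤ n := by
  have h1 : (2 : ℝ) * 2 ^ sizeExp u s t ℓ ≤ n := by
    rw [← H.pow_three]
    nlinarith [H.pow_sizeExp_le, H.two_le, sq_nonneg A]
  exact_mod_cast h1

/-- The cost of preprocessing, up to logarithmic factors, in the first step (`k = t`) and in all the
blocks together (`k = s`). -/
lemma pow_sizeExp_add_le (H : Regime n u s t h ℓ A) {k : ℕ} (hk : k ≤ s) :
    (2 : ℝ) ^ (sizeExp u s t ℓ + k) ≤ 4 * A ^ 2 := by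
  have h2 := H.t_le_s
  have h3 := H.s_lt_u
  have h4 := H.one_le_t
  rcases H.sizeExp_eq with h1 | h1
  · calc (2 : ℝ) ^ (sizeExp u s t ℓ + k) ≤ 2 ^ (u * 2) :=
        pow_le_pow_right₀ (by norm_num) (by omega)
      _ = (2 ^ u) ^ 2 := pow_mul _ _ _
      _ ≤ (2 * A) ^ 2 := pow_le_pow_left₀ (by positivity) H.pow_lt.le 2
      _ = 4 * A ^ 2 := by ring
  · have := H.pow_sub_le (k := sizeExp u s t ℓ + k) (by omega)
    nlinarith [sq_nonneg A]

/-- The set of size `2 ^ sizeExp` is small enough for the replacement of one variable to be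
negligible in the first preprocessing step. -/
lemma pow_sizeExp_mul_le (H : Regime n u s t h ℓ A) :
    (2 : ℝ) ^ (sizeExp u s t ℓ + t) * A ≤ 2 ^ ℓ := by
  have h2 := H.t_le_s
  have h3 := H.s_lt_u
  have h4 := H.one_le_t
  rcases H.sizeExp_eq with h1 | h1
  · rw [show sizeExp u s t ℓ + t = u by omega]
    have h5 : (2 : ℝ) ≤ 2 ^ t := by
      calc (2 : ℝ) = 2 ^ 1 := (pow_one _).symm
        _ ≤ 2 ^ t := pow_le_pow_right₀ (by norm_num) h4
    nlinarith [H.sq_mul_le, H.pow_lt, H.pos, sq_nonneg A]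
  · calc (2 : ℝ) ^ (sizeExp u s t ℓ + t) * A ≤ 2 ^ (sizeExp u s t ℓ + t) * 2 ^ u := by
          gcongr; exact H.le_pow
      _ = 2 ^ (sizeExp u s t ℓ + t + u) := (pow_add _ _ _).symm
      _ ≤ 2 ^ ℓ := pow_le_pow_right₀ (by norm_num) (by omega)

/-- The blocks are small enough for the replacement of one variable to be negligible in the second
preprocessing step. -/
lemma pow_blockExp_mul_le (H : Regime n u s t h ℓ A) :
    (2 : ℝ) ^ (blockExp u s t ℓ + s) * A ≤ 2 ^ ℓ := by
  have h2 := H.t_le_s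
  have h3 := H.s_lt_u
  have h4 := H.one_le_t
  have h5 := H.t_add_le
  have h6 : blockExp u s t ℓ ≤ ℓ - s - u := min_le_right _ _
  calc (2 : ℝ) ^ (blockExp u s t ℓ + s) * A ≤ 2 ^ (blockExp u s t ℓ + s) * 2 ^ u := by
        gcongr; exact H.le_pow
    _ = 2 ^ (blockExp u s t ℓ + s + u) := (pow_add _ _ _).symm
    _ ≤ 2 ^ ℓ := pow_le_pow_right₀ (by norm_num) (by omega)

lemma card_mul_div (H : Regime n u s t h ℓ A) {N : ℕ} (hN : 2 ^ ℓ ≤ 2 * N) :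
    (2 : ℝ) ^ (ℓ + 1 + gainExp u s ℓ) / 2 ^ (t + 2 * u + 2) ≤ N * 2 ^ sizeExp u s t ℓ / n := by
  have h2 := H.t_le_s
  have h3 := H.s_lt_u
  have hn : (0 : ℝ) < n := by rw [← H.pow_three]; exact pow_pos H.pos 3
  have hN' : (2 : ℝ) ^ ℓ ≤ 2 * N := by exact_mod_cast hN
  have h1 : (n : ℝ) ≤ 2 ^ (3 * u) := by
    rw [← H.pow_three, mul_comm, pow_mul]
    exact pow_le_pow_left₀ H.pos.le H.le_pow 3
  rw [div_le_div_iff₀ (by positivity) hn]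
  calc (2 : ℝ) ^ (ℓ + 1 + gainExp u s ℓ) * n ≤ 2 ^ (ℓ + 1 + gainExp u s ℓ) * 2 ^ (3 * u) := by
        gcongr
    _ = 2 ^ ℓ * 2 ^ (1 + gainExp u s ℓ + 3 * u) := by rw [← pow_add, ← pow_add]; congr 1; omega
    _ ≤ 2 * N * 2 ^ (1 + gainExp u s ℓ + 3 * u) := by gcongr
    _ = N * (2 ^ (1 + (1 + gainExp u s ℓ + 3 * u))) := by rw [pow_add _ 1]; ring
    _ = N * (2 ^ (sizeExp u s t ℓ + (t + 2 * u + 2))) := by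
        congr 2; unfold sizeExp; omega
    _ = _ := by rw [pow_add]; ring

lemma gain_le (H : Regime n u s t h ℓ A) {N : ℕ} (hN : 2 ^ ℓ ≤ 2 * N) :
    (2 : ℝ) ^ gainExp u s ℓ / 4 ≤ N * 2 ^ sizeExp u s t ℓ / n := by
  refine le_trans ?_ (H.card_mul_div hN)
  rw [div_le_div_iff₀ (by norm_num) (by positivity), ← pow_add]
  have h1 := H.t_add_le
  calc (2 : ℝ) ^ (gainExp u s ℓ + (t + 2 * u + 2)) ≤ 2 ^ (ℓ + 1 + gainExp u s ℓ + 2) :=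
        pow_le_pow_right₀ (by norm_num) (by omega)
    _ = _ := by rw [pow_add _ _ 2]; norm_num

/-- The number of samples suffices for finding `d` good variables: an eighth of the expected number
of variables of low influence remains to be found at any time, each of them with probability at
least `2 ^ t / 2 ^ h / 4`. -/
lemma samples_le (H : Regime n u s t h ℓ A) {N d : ℕ} (hN : 2 ^ ℓ ≤ 2 * N)
    (hd : d ≤ 2 ^ gainExp u s ℓ) :
    (2 : ℝ) * d ≤ N * 2 ^ sizeExp u s t ℓ / n / 8 * (2 ^ t / 2 ^ h / 4) *
      (2 ^ (7 + h + 2 * u - ℓ) : ℕ) := by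
  have h1 := H.ℓ_add_le
  have hd' : (d : ℝ) ≤ 2 ^ gainExp u s ℓ := by exact_mod_cast hd
  calc (2 : ℝ) * d ≤ 2 * 2 ^ gainExp u s ℓ := by gcongr
    _ = 2 ^ (ℓ + 1 + gainExp u s ℓ) / 2 ^ (t + 2 * u + 2) / 8 * (2 ^ t / 2 ^ h / 4) *
      (2 ^ (7 + h + 2 * u - ℓ) : ℕ) := by
        have e : (2 : ℝ) ^ (ℓ + 1 + gainExp u s ℓ) * 2 ^ t * 2 ^ (7 + h + 2 * u - ℓ) =
            2 ^ gainExp u s ℓ * 2 ^ (t + 2 * u + 2) * 2 ^ h * 2 ^ 6 := by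
          simp only [← pow_add]; congr 1; omega
        push_cast
        field_simp
        rw [← mul_comm, mul_assoc] at e
        linear_combination (-1 : ℝ) * e
    _ ≤ _ := mul_le_mul_of_nonneg_right (mul_le_mul_of_nonneg_right
        (div_le_div_of_nonneg_right (H.card_mul_div hN) (by norm_num)) (by positivity))
        (by positivity)

lemma gainExp_add_le (H : Regime n u s t h ℓ A) : s + gainExp u s ℓ ≤ h := by
  have h1 := H.ℓ_add_le
  have h2 := H.t_add_le
  have h3 := H.s_lt_u
  have h4 := H.t_le_s
  have h5 := H.one_le_t
  unfold gainExp; omega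

/-- The number of samples in the blocks of an attempt is at most the number of samples in its first
part. -/
lemma blocks_mul_le (H : Regime n u s t h ℓ A) :
    2 ^ (sizeExp u s t ℓ - blockExp u s t ℓ) * 2 ^ (h - s - gainExp u s ℓ) ≤
      2 ^ (7 + h + 2 * u - ℓ) := by
  have h1 := H.ℓ_add_le
  have h2 := H.t_add_le
  have h3 := H.s_lt_u
  have h4 := H.t_le_s
  have h5 := H.one_le_t
  rw [← pow_add]
  refine Nat.pow_le_pow_right (by norm_num) ?_
  unfold blockExp sizeExp gainExp; omega

end Regime

/-! ### Estimates for the logarithmic factors -/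

lemma logb_le_logb_div {n : ℕ} {ε : ℝ} (hn : 0 < n) (hε : 0 < ε) (hε1 : ε ≤ 1) :
    Real.logb 2 n ≤ Real.logb 2 (n / ε) := by
  have hn' : (0 : ℝ) < n := by exact_mod_cast hn
  refine Real.logb_le_logb_of_le (by norm_num) hn' ?_
  rw [le_div_iff₀ hε]
  nlinarith

lemma two_mul_logb_le_Lam {n : ℕ} {ε : ℝ} (hn : 0 < n) (hε : 0 < ε) (hε1 : ε ≤ 1) :
    2 * Real.logb 2 n ≤ Lam n ε :=
  (mul_le_mul_of_nonneg_left (logb_le_logb_div hn hε hε1) (by norm_num)).trans (Nat.le_ceil _)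

lemma Lam_le {n : ℕ} {ε : ℝ} (h : 1 ≤ Real.logb 2 (n / ε)) :
    (Lam n ε : ℝ) ≤ 3 * Real.logb 2 (n / ε) := by
  have := Nat.ceil_lt_add_one (a := 2 * Real.logb 2 (n / ε)) (by linarith)
  unfold Lam; linarith

lemma numRounds_le {n : ℕ} (hL : 1 ≤ Real.logb 2 n) (a : ℕ) :
    (numRounds n (1 / 2 ^ a) : ℝ) ≤ 2 * Real.logb 2 n ^ 4 * 2 ^ a := by
  have h1 : (1 : ℝ) ≤ Real.logb 2 n ^ 4 * 2 ^ a :=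
    one_le_mul_of_one_le_of_one_le (one_le_pow₀ hL) (one_le_pow₀ (by norm_num))
  have h2 : Real.logb 2 n ^ 4 / (1 / 2 ^ a) = Real.logb 2 n ^ 4 * 2 ^ a := by
    rw [div_div_eq_mul_div, div_one]
  unfold numRounds
  rw [h2]
  have := Nat.ceil_lt_add_one (a := Real.logb 2 n ^ 4 * 2 ^ a) (by linarith)
  linarith

lemma two_add_clog_le {n k : ℕ} (hL : 2 ≤ Real.logb 2 n) (hk : 2 ^ k ≤ n) :
    ((2 + Nat.clog 2 (2 ^ k) : ℕ) : ℝ) ≤ 2 * Real.logb 2 n := by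
  rw [Nat.clog_pow 2 k (by norm_num)]
  have h1 : (k : ℝ) ≤ Real.logb 2 n := by
    rw [Real.le_logb_iff_rpow_le (by norm_num) (by
      have : 0 < n := lt_of_lt_of_le (by positivity) hk
      exact_mod_cast this), Real.rpow_natCast]
    exact_mod_cast hk
  push_cast; linarith

/-- The total change caused by replacing a variable of small influence by the placeholder in a
preprocessing step is negligible. -/
lemma preprocess_err_le {n k a ℓ : ℕ} {ε A : ℝ} {f : Cube n → Bool} {i : Fin n}
    (hL : 96 ≤ Real.logb 2 n) (hn : 0 < n) (hε : 0 < ε) (hε1 : ε ≤ 1)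
    (hinf : influence f i ≤ ε ^ 2 / (Lam n ε : ℝ) ^ 13 * (A / 2 ^ ℓ)) (hk : 2 ^ k ≤ n)
    (h : (2 : ℝ) ^ (k + a) * A ≤ 2 ^ ℓ) :
    2 * ENNReal.ofReal (1 / Real.logb 2 n) +
      (2 ^ k : ℕ) * (numRounds n (1 / 2 ^ a) * roundErr f i (2 ^ k)) ≤ 1 / 24 := by
  have h1 := numRounds_le (n := n) (by linarith) a
  have h2 := two_add_clog_le (by linarith) hk
  have h3 := two_mul_logb_le_Lam hn hε hε1
  have hI0 : 0 ≤ influence f i := by unfold influence; positivity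
  set L := Real.logb 2 n
  set Λ : ℝ := (Lam n ε : ℝ)
  have hL0 : 0 < L := by linarith
  have hΛ0 : 0 < Λ := by linarith
  have h4 : ((2 ^ k : ℕ) : ℝ) * (numRounds n (1 / 2 ^ a) *
      (((2 + Nat.clog 2 (2 ^ k) : ℕ) : ℝ) * influence f i)) ≤ 1 / 48 := by
    calc _ ≤ ((2 ^ k : ℕ) : ℝ) * ((2 * L ^ 4 * 2 ^ a) *
        ((2 * L) * (ε ^ 2 / Λ ^ 13 * (A / 2 ^ ℓ)))) := by gcongr
      _ = 4 * L ^ 5 * (ε ^ 2 / Λ ^ 13) * ((2 ^ (k + a) * A) / 2 ^ ℓ) := by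
        push_cast; rw [pow_add]; ring
      _ ≤ 4 * L ^ 5 * (ε ^ 2 / Λ ^ 13) * 1 :=
        mul_le_mul_of_nonneg_left (div_le_one_of_le₀ h (by positivity)) (by positivity)
      _ ≤ 4 * L ^ 5 * (1 / (2 * L) ^ 13) * 1 := by
        have : ε ^ 2 ≤ 1 := pow_le_one₀ hε.le hε1
        gcongr
      _ = 4 / 2 ^ 13 / L ^ 8 := by field_simp
      _ ≤ 4 / 2 ^ 13 := div_le_self (by positivity) (one_le_pow₀ (by linarith))
      _ ≤ 1 / 48 := by norm_num
  have h5 : 1 / L ≤ 1 / 96 := one_div_le_one_div_of_le (by norm_num) hL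
  have e : (1 : ℝ≥0∞) / 24 = ENNReal.ofReal (1 / 24) := by
    rw [ENNReal.ofReal_div_of_pos (by norm_num)]; norm_num
  rw [e, roundErr, ← ENNReal.ofReal_natCast (2 + _), ← ENNReal.ofReal_natCast (numRounds _ _),
    ← ENNReal.ofReal_natCast (2 ^ k), ← ENNReal.ofReal_mul (by positivity),
    ← ENNReal.ofReal_mul (by positivity), ← ENNReal.ofReal_mul (by positivity),
    show (2 : ℝ≥0∞) = ENNReal.ofReal 2 by norm_num, ← ENNReal.ofReal_mul (by positivity),
    ← ENNReal.ofReal_add (by positivity) (by positivity)]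
  exact ENNReal.ofReal_le_ofReal (by linarith)

/-- The number of half-size subsets tested by a sample: large enough for distinguishing `n`
variables, and small enough for all the tests to be correct. -/
def numTests (n : ℕ) : ℕ := ⌈Real.logb 2 n⌉₊ + 2

lemma numTests_le {n : ℕ} (hL : 0 ≤ Real.logb 2 n) : (numTests n : ℝ) ≤ Real.logb 2 n + 3 := by
  have := Nat.ceil_lt_add_one hL
  unfold numTests; push_cast; linarith

lemma numTests_err {n : ℕ} (hL : 96 ≤ Real.logb 2 n) (hn : 0 < n) :
    numTests n * (2 / Real.logb 2 n ^ 2) + n * (1 / 2) ^ numTests n ≤ (1 : ℝ) / 2 := by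
  have h1 := numTests_le (n := n) (by linarith)
  have h2 : (n : ℝ) * (1 / 2) ^ numTests n ≤ 1 / 4 := by
    have h3 : (n : ℝ) ≤ 2 ^ ⌈Real.logb 2 n⌉₊ := by
      rw [← Real.rpow_natCast, ← Real.logb_le_iff_le_rpow (by norm_num) (by exact_mod_cast hn)]
      exact Nat.le_ceil _
    rw [numTests, pow_add, one_div_pow]
    rw [← div_le_one (by positivity)] at h3
    calc (n : ℝ) * (1 / 2 ^ ⌈Real.logb 2 n⌉₊ * (1 / 2) ^ 2) =
        n / 2 ^ ⌈Real.logb 2 n⌉₊ * (1 / 4) := by ring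
      _ ≤ 1 * (1 / 4) := by gcongr
      _ = 1 / 4 := one_mul _
  set L := Real.logb 2 n
  have h4 : (numTests n : ℝ) * (2 / L ^ 2) ≤ 1 / 4 := by
    rw [← mul_div_assoc, div_le_div_iff₀ (by positivity) (by norm_num)]
    nlinarith
  linarith

/-! ### One attempt with suitable parameters -/

/-- An attempt with the parameters prescribed by the score summary. -/
def search (n s t h ℓ : ℕ) : QueryAlg n (Option (Fin n × Cube n × Cube n)) :=
  attempt n (numTests n) (2 ^ sizeExp (rootExp n) s t ℓ) (2 ^ blockExp (rootExp n) s t ℓ)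
    (2 ^ (7 + h + 2 * rootExp n - ℓ)) (2 ^ (h - s - gainExp (rootExp n) s ℓ))
    (2 ^ (sizeExp (rootExp n) s t ℓ - blockExp (rootExp n) s t ℓ)) (1 / 2 ^ t) (1 / 2 ^ s)

/-- A lower bound for the success probability of one attempt. -/
def successProb : ℝ≥0∞ :=
  ENNReal.ofReal (1 / 144) * (1 / 2 * (ENNReal.ofReal (1 / 128) / 8))

lemma le_strongCount_div {n a h k : ℕ} (hs : (1 : ℝ) / 2 ^ h ≤ (k / 2 ^ n : ℝ) * (1 / 2 ^ a)) :
    ENNReal.ofReal (2 ^ a / 2 ^ h / 4) ≤ (k : ℝ≥0∞) / 2 ^ n / 4 := by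
  have e : (k : ℝ≥0∞) / 2 ^ n / 4 = ENNReal.ofReal (k / 2 ^ n / 4) := by
    rw [ENNReal.ofReal_div_of_pos (by norm_num), ENNReal.ofReal_div_of_pos (by positivity),
      ENNReal.ofReal_natCast, ENNReal.ofReal_pow (by norm_num)]
    norm_num
  rw [e]
  refine ENNReal.ofReal_le_ofReal (div_le_div_of_nonneg_right ?_ (by norm_num))
  have h2 : (0 : ℝ) < 2 ^ a := by positivity
  calc (2 : ℝ) ^ a / 2 ^ h = 2 ^ a * (1 / 2 ^ h) := by ring
    _ ≤ 2 ^ a * ((k / 2 ^ n : ℝ) * (1 / 2 ^ a)) := by gcongr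
    _ = k / 2 ^ n := by field_simp

lemma successProb_le_ex_search {n s t h ℓ : ℕ} {ε A : ℝ} (hA : A = (n : ℝ) ^ (1 / 3 : ℝ))
    (H : Regime n (rootExp n) s t h ℓ A) (hL : 96 ≤ Real.logb 2 n) (hε : 0 < ε) (hε1 : ε ≤ 1)
    (hs : s ≤ Lam n ε) {f : Cube n → Bool} {I : Finset (Fin n)} (hI : 2 ^ ℓ ≤ 2 * I.card)
    (hscore : ∀ i ∈ I, (1 : ℝ) / 2 ^ h ≤ scorePlus ε f i s * (1 / 2 ^ s) ∧
      (1 : ℝ) / 2 ^ h ≤ scoreMinus ε f i t * (1 / 2 ^ t))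
    (hinf : ∀ i ∈ I, influence f i ≤ ε ^ 2 / (Lam n ε : ℝ) ^ 13 * (A / 2 ^ ℓ)) :
    successProb ≤ ex ((search n s t h ℓ).law f) fun o => ind (o ≠ none) := by
  have hnR : (0 : ℝ) < n := by rw [← H.pow_three]; exact pow_pos H.pos 3
  have hn : 0 < n := by exact_mod_cast hnR
  have hA2 : (n : ℝ) ^ (2 / 3 : ℝ) = A ^ 2 := by
    rw [hA, ← Real.rpow_natCast, ← Real.rpow_mul hnR.le]; norm_num
  have hjn := H.two_mul_pow_sizeExp_le
  have hvj : blockExp (rootExp n) s t ℓ ≤ sizeExp (rootExp n) s t ℓ := min_le_left _ _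
  set g := gainExp (rootExp n) s ℓ with hg
  -- about `2 ^ g / 4` good variables are expected, of which a fixed fraction (and at least one) has
  -- to be found
  set d := 2 ^ g / 32 + 1 with hd
  have hdle : d ≤ 2 ^ g := by
    rcases Nat.eq_zero_or_pos g with h0 | h0
    · rw [hd, h0]; norm_num
    · have : 2 ^ 1 ≤ 2 ^ g := Nat.pow_le_pow_right (by norm_num) h0
      omega
  have hdge : 2 ^ g ≤ 32 * d := by omega
  have hd32 : ((d : ℝ) - 1) * 32 ≤ 2 ^ g := by
    have : (2 ^ g / 32) * 32 ≤ 2 ^ g := Nat.div_mul_le_self _ _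
    have h2 : ((2 ^ g / 32 : ℕ) : ℝ) * 32 ≤ 2 ^ g := by exact_mod_cast this
    rw [hd, Nat.cast_add, Nat.cast_one, add_sub_cancel_right]
    exact h2
  have hgain := H.gain_le hI
  rw [← hg] at hgain
  have h2g : (1 : ℝ) ≤ 2 ^ g := one_le_pow₀ (by norm_num)
  -- this quantity lies between `1 / 128` and `1 / 4` as `2 ^ g / 32 ≤ d ≤ 2 ^ g`
  have hrb : ((2 ^ (h - s - g) : ℕ) : ℝ≥0∞) * (d * ENNReal.ofReal (2 ^ s / 2 ^ h / 4)) =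
      ENNReal.ofReal (d / 2 ^ g / 4) := by
    rw [← ENNReal.ofReal_natCast, ← ENNReal.ofReal_natCast, ← ENNReal.ofReal_mul (by positivity),
      ← ENNReal.ofReal_mul (by positivity)]
    congr 1
    have := H.gainExp_add_le
    have e : (2 : ℝ) ^ (h - s - g) * 2 ^ s * 2 ^ g = 2 ^ h := by
      simp only [← pow_add]; congr 1; omega
    push_cast
    field_simp
    linear_combination (d : ℝ) * e
  have hdR : (d : ℝ) ≤ 2 ^ g := by exact_mod_cast hdle
  have hdR' : (2 : ℝ) ^ g ≤ 32 * d := by exact_mod_cast hdge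
  refine le_ex_attempt (ε := ε) (I := I) (d := d) (a := ENNReal.ofReal (2 ^ t / 2 ^ h / 4))
    (b := ENNReal.ofReal (2 ^ s / 2 ^ h / 4)) ?_ hjn hvj (H.t_le_s.trans hs) hs
    (numTests_err hL hn) ?_ ?_ ?_ ?_ ?_ (by omega) ?_ ?_ ?_ ?_
  · rw [hA2]; exact H.pow_sizeExp_le
  · exact fun i hi => preprocess_err_le hL hn hε hε1 (hinf i hi) (by omega) H.pow_sizeExp_mul_le
  · refine fun i hi => preprocess_err_le hL hn hε hε1 (hinf i hi) ?_ H.pow_blockExp_mul_le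
    have := Nat.pow_le_pow_right (n := 2) (by norm_num) hvj
    omega
  · linarith
  · exact fun i hi => le_strongCount_div (by rw [← scoreMinus_eq]; exact (hscore i hi).2)
  · exact fun i hi => le_strongCount_div (by rw [← scorePlus_eq]; exact (hscore i hi).1)
  · linarith
  · have := ENNReal.ofReal_le_ofReal (H.samples_le hI hdle)
    rw [ENNReal.ofReal_mul (by positivity), ENNReal.ofReal_mul (by positivity),
      ENNReal.ofReal_mul (by positivity), ENNReal.ofReal_natCast, ENNReal.ofReal_natCast] at this
    simpa using this
  · rw [hrb, ← ENNReal.ofReal_one]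
    refine ENNReal.ofReal_le_ofReal ?_
    rw [div_div, div_le_one (by positivity)]
    linarith
  · rw [hrb]
    refine ENNReal.ofReal_le_ofReal ?_
    rw [div_div, div_le_div_iff₀ (by norm_num) (by positivity)]
    linarith

lemma samples_cast_le {n u s t h ℓ : ℕ} {A c ε Λ : ℝ} (H : Regime n u s t h ℓ A) (hc : 0 < c)
    (hε : 0 < ε) (hΛ : 0 < Λ) (hsize : c * (ε ^ 2 / Λ ^ 11) ≤ 2 ^ ℓ / 2 ^ h) :
    ((2 ^ (7 + h + 2 * u - ℓ) : ℕ) : ℝ) ≤ 2 ^ 9 * (A ^ 2 / ε ^ 2) * (Λ ^ 11 / c) := by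
  have h1 := H.ℓ_add_le
  have h2 : (2 : ℝ) ^ h / 2 ^ ℓ ≤ Λ ^ 11 / (c * ε ^ 2) := by
    have := one_div_le_one_div_of_le (by positivity) hsize
    rw [one_div_div] at this
    refine this.trans (le_of_eq ?_)
    field_simp
  calc ((2 ^ (7 + h + 2 * u - ℓ) : ℕ) : ℝ) = 2 ^ 7 * (2 ^ h / 2 ^ ℓ) * (2 ^ u) ^ 2 := by
        have e : (2 : ℝ) ^ (7 + h + 2 * u - ℓ) * 2 ^ ℓ = 2 ^ 7 * 2 ^ h * (2 ^ u) ^ 2 := by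
          rw [← pow_mul]; simp only [← pow_add]; congr 1; omega
        push_cast
        rw [← mul_div_assoc, div_mul_eq_mul_div, eq_div_iff (by positivity)]
        exact e
    _ ≤ 2 ^ 7 * (Λ ^ 11 / (c * ε ^ 2)) * (2 * A) ^ 2 := by gcongr; exact H.pow_lt.le
    _ = _ := by field_simp

lemma exists_queriesAtMost_search {n s t h ℓ : ℕ} {A c ε : ℝ}
    (H : Regime n (rootExp n) s t h ℓ A) (hL : 96 ≤ Real.logb 2 n) (hc : 0 < c) (hε : 0 < ε)
    (hε1 : ε ≤ 1) (hsize : c * (ε ^ 2 / (Lam n ε : ℝ) ^ 11) ≤ 2 ^ ℓ / 2 ^ h) :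
    ∃ q : ℕ, (search n s t h ℓ).QueriesAtMost q ∧
      (q : ℝ) ≤ (32 + 2 ^ 11 * 3 ^ 11 / c) * (A ^ 2 / ε ^ 2) * Real.logb 2 (n / ε) ^ 12 := by
  have hnR : (0 : ℝ) < n := by rw [← H.pow_three]; exact pow_pos H.pos 3
  have hn : 0 < n := by exact_mod_cast hnR
  have hLW := logb_le_logb_div hn hε hε1
  have hΛL := two_mul_logb_le_Lam hn hε hε1
  have hΛW := Lam_le (n := n) (ε := ε) (by linarith)
  have hjn := H.two_mul_pow_sizeExp_le
  have hvj : blockExp (rootExp n) s t ℓ ≤ sizeExp (rootExp n) s t ℓ := min_le_left _ _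
  have hvj' := Nat.pow_le_pow_right (n := 2) (by norm_num) hvj
  have hN1 := numRounds_le (n := n) (by linarith) t
  have hN2 := numRounds_le (n := n) (by linarith) s
  have hC1 := two_add_clog_le (n := n) (k := sizeExp (rootExp n) s t ℓ) (by linarith) (by omega)
  have hC2 := two_add_clog_le (n := n) (k := blockExp (rootExp n) s t ℓ) (by linarith) (by omega)
  have hJ := numTests_le (n := n) (by linarith)
  have hQ := samples_cast_le H hc hε (Λ := Lam n ε) (by linarith) hsize
  have hBr := H.blocks_mul_le
  have hp1 := H.pow_sizeExp_add_le H.t_le_s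
  have hp2 := H.pow_sizeExp_add_le le_rfl
  have hB : (2 : ℝ) ^ (sizeExp (rootExp n) s t ℓ - blockExp (rootExp n) s t ℓ) *
      2 ^ blockExp (rootExp n) s t ℓ = 2 ^ sizeExp (rootExp n) s t ℓ := by
    rw [← pow_add]; congr 1; omega
  refine ⟨_, queriesAtMost_attempt (by omega) hvj', ?_⟩
  set j := sizeExp (rootExp n) s t ℓ
  set v := blockExp (rootExp n) s t ℓ
  set Q := 2 ^ (7 + h + 2 * rootExp n - ℓ)
  set r := 2 ^ (h - s - gainExp (rootExp n) s ℓ)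
  set L := Real.logb 2 n
  set W := Real.logb 2 (n / ε)
  set Λ : ℝ := (Lam n ε : ℝ)
  have hBr' : (2 : ℝ) ^ (j - v) * r ≤ Q := by exact_mod_cast hBr
  have hA := H.pos
  have hL0 : 0 < L := by linarith
  have hW0 : 0 < W := by linarith
  have hε2 : A ^ 2 ≤ A ^ 2 / ε ^ 2 := by
    rw [le_div_iff₀ (by positivity)]
    exact mul_le_of_le_one_right (by positivity) (pow_le_one₀ hε.le hε1)
  have T1 : (2 : ℝ) ^ j * (numRounds n (1 / 2 ^ t) * (2 + Nat.clog 2 (2 ^ j) : ℕ)) ≤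
      16 * (A ^ 2 / ε ^ 2) * W ^ 12 := by
    calc _ ≤ (2 : ℝ) ^ j * ((2 * L ^ 4 * 2 ^ t) * (2 * L)) := by gcongr
      _ = 4 * 2 ^ (j + t) * L ^ 5 := by rw [pow_add]; ring
      _ ≤ 4 * (4 * (A ^ 2 / ε ^ 2)) * W ^ 5 := by gcongr; linarith
      _ ≤ 4 * (4 * (A ^ 2 / ε ^ 2)) * W ^ 12 := by gcongr <;> linarith
      _ = _ := by ring
  have T2 : (2 : ℝ) ^ (j - v) * (2 ^ v * (numRounds n (1 / 2 ^ s) *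
      (2 + Nat.clog 2 (2 ^ v) : ℕ))) ≤ 16 * (A ^ 2 / ε ^ 2) * W ^ 12 := by
    calc _ = (2 : ℝ) ^ j * (numRounds n (1 / 2 ^ s) * (2 + Nat.clog 2 (2 ^ v) : ℕ)) := by
          rw [← mul_assoc, hB]
      _ ≤ (2 : ℝ) ^ j * ((2 * L ^ 4 * 2 ^ s) * (2 * L)) := by gcongr
      _ = 4 * 2 ^ (j + s) * L ^ 5 := by rw [pow_add]; ring
      _ ≤ 4 * (4 * (A ^ 2 / ε ^ 2)) * W ^ 5 := by gcongr; linarith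
      _ ≤ 4 * (4 * (A ^ 2 / ε ^ 2)) * W ^ 12 := by gcongr <;> linarith
      _ = _ := by ring
  have T3 : (Q : ℝ) * (2 * (numTests n + 2)) ≤
      2 ^ 11 * 3 ^ 11 / c * (A ^ 2 / ε ^ 2) * W ^ 12 := by
    calc _ ≤ (2 ^ 9 * (A ^ 2 / ε ^ 2) * (Λ ^ 11 / c)) * (2 * (2 * L)) := by
          gcongr; linarith
      _ ≤ (2 ^ 9 * (A ^ 2 / ε ^ 2) * ((3 * W) ^ 11 / c)) * (2 * (2 * W)) := by gcongr
      _ = _ := by ring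
  have T4 : (2 : ℝ) ^ (j - v) * r * (numTests n + 2) ≤ Q * (numTests n + 2) := by gcongr
  have hfin : ((2 ^ j * (numRounds n (1 / 2 ^ t) * (2 + Nat.clog 2 (2 ^ j))) +
      (Q * (numTests n + 2) + 2 ^ (j - v) * (2 ^ v * (numRounds n (1 / 2 ^ s) *
        (2 + Nat.clog 2 (2 ^ v))) + r * (numTests n + 2))) : ℕ) : ℝ) =
      (2 : ℝ) ^ j * (numRounds n (1 / 2 ^ t) * (2 + Nat.clog 2 (2 ^ j) : ℕ)) +
      (2 : ℝ) ^ (j - v) * (2 ^ v * (numRounds n (1 / 2 ^ s) * (2 + Nat.clog 2 (2 ^ v) : ℕ))) +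
      Q * (numTests n + 2) + (2 : ℝ) ^ (j - v) * r * (numTests n + 2) := by
    push_cast; ring
  rw [hfin]
  linear_combination T1 + T2 + T3 + T4

/-! ### Small dimensions -/

open Classical in
/-- Query all the points of the cube and output a violation if there is one. -/
def queryAll (n : ℕ) : QueryAlg n (Option (Fin n × Cube n × Cube n)) :=
  (queryFin (Fintype.card (Cube n)) (Fintype.equivFin (Cube n)).symm).bind fun a =>
    QueryAlg.ret (if h : ∃ w, IsEdgeViolation (fun x => a (Fintype.equivFin (Cube n) x)) w
      then some h.choose else none)

lemma queriesAtMost_queryAll (n : ℕ) : (queryAll n).QueriesAtMost (2 ^ n) := by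
  have h := (queriesAtMost_queryFin (Fintype.card (Cube n)) (Fintype.equivFin (Cube n)).symm).bind
    (b := 0) (g := fun a => QueryAlg.ret (open Classical in
      if h : ∃ w, IsEdgeViolation (fun x => a (Fintype.equivFin (Cube n) x)) w
      then some h.choose else none)) fun _ => trivial
  refine QueryAlg.QueriesAtMost.mono h ?_
  simp

lemma prob_queryAll {n : ℕ} {f : Cube n → Bool} (h : ∃ w, IsEdgeViolation f w) :
    prob ((queryAll n).law f) {o | ∃ w, o = some w ∧ IsEdgeViolation f w} = 1 := by
  classical
  have e : (queryAll n).law f = PMF.pure (some h.choose) := by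
    rw [queryAll, QueryAlg.law_bind, law_queryFin, PMF.pure_bind, QueryAlg.law]
    simp only [Equiv.symm_apply_apply]
    rw [dif_pos h]
  rw [e, prob_eq_ex, ex_pure, ind_of ⟨_, rfl, h.choose_spec⟩, ENNReal.toReal_one]

lemma exists_violation {n s t h : ℕ} {ε c : ℝ} {f : Cube n → Bool} {I : Finset (Fin n)}
    (hI : I.Nonempty) (hsum : ScoreSummary c ε f s t h I) : ∃ w, IsEdgeViolation f w := by
  obtain ⟨i, hi⟩ := hI
  have h1 := hsum.2 i hi
  rw [le_min_iff] at h1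
  have hpos : (0 : ℝ) < 1 / 2 ^ h := by positivity
  have h2 : 0 < scorePlus ε f i s := pos_of_mul_pos_left (hpos.trans_le h1.1) (by positivity)
  have h3 : 0 < scoreMinus ε f i t := pos_of_mul_pos_left (hpos.trans_le h1.2) (by positivity)
  obtain ⟨x, hx⟩ : {x : Cube n | x i = false ∧ IsMonoEdge f i x ∧ IsStrong ε f s i x}.Nonempty := by
    by_contra hne
    rw [Set.not_nonempty_iff_eq_empty] at hne
    simp [scorePlus, hne] at h2
  obtain ⟨y, hy⟩ : {x : Cube n | x i = false ∧ IsAntiEdge f i x ∧ IsStrong ε f t i x}.Nonempty := by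
    by_contra hne
    rw [Set.not_nonempty_iff_eq_empty] at hne
    simp [scoreMinus, hne] at h3
  exact ⟨(i, x, y), hx.2.1, hy.2.1⟩

/-! ### Repeated attempts -/

lemma scorePlus_le_influence {n : ℕ} (ε : ℝ) (f : Cube n → Bool) (i : Fin n) (a : ℕ) :
    scorePlus ε f i a ≤ influence f i := by
  unfold scorePlus influence
  refine div_le_div_of_nonneg_right ?_ (by positivity)
  rw [← Set.ncard_coe_finset]
  refine Nat.cast_le.2 (Set.ncard_le_ncard (fun x hx => ?_) (Set.toFinite _))
  exact Finset.mem_coe.2 (Finset.mem_filter.2 ⟨Finset.mem_univ x, hx.2.1.1⟩)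

/-- An algorithm that succeeds with probability at least `p` succeeds with probability at least
`2 / 3` when it is run sufficiently often. -/
lemma two_thirds_le_prob_firstSome {n r : ℕ} {f : Cube n → Bool}
    {A : QueryAlg n (Option (Fin n × Cube n × Cube n))} {p : ℝ≥0∞}
    (hr : (1 - p) ^ r ≤ ENNReal.ofReal (1 / 3)) (hA : A.Sound f (IsEdgeViolation f))
    (hp : p ≤ ex (A.law f) fun o => ind (o ≠ none)) :
    2 / 3 ≤ prob ((A.firstSome r).law f) {o | ∃ w, o = some w ∧ IsEdgeViolation f w} := by
  rw [le_prob_iff]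
  have h1 : ex (A.law f) (fun o => ind (o = none)) ≤ 1 - p := by
    have := ex_add_ex_not (A.law f) fun o => o = none
    refine ENNReal.le_sub_of_add_le_right
      (ne_top_of_le_ne_top ENNReal.one_ne_top (hp.trans (ex_le_const fun _ => ind_le_one _))) ?_
    rw [← this]
    exact add_le_add_right hp _
  have h2 : ex ((A.firstSome r).law f) (fun o => ind (o = none)) ≤ ENNReal.ofReal (1 / 3) := by
    rw [QueryAlg.ex_firstSome_none]
    exact (pow_le_pow_left' h1 r).trans hr
  have h3 := ex_add_ex_not ((A.firstSome r).law f) fun o => o = none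
  have h4 : ex ((A.firstSome r).law f) (fun o => ind (o ≠ none)) ≤
      ex ((A.firstSome r).law f)
        fun o => ind (o ∈ {o | ∃ w, o = some w ∧ IsEdgeViolation f w}) := by
    refine ex_mono_support fun o ho => ind_mono fun hne => ?_
    obtain ⟨w, rfl⟩ := Option.ne_none_iff_exists'.1 hne
    exact ⟨w, rfl, hA.firstSome r w ho⟩
  refine le_trans ?_ h4
  have h5 : ENNReal.ofReal (1 / 3) + ENNReal.ofReal (2 / 3) ≤
      ENNReal.ofReal (1 / 3) + ex ((A.firstSome r).law f) (fun o => ind (o ≠ none)) := by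
    rw [← ENNReal.ofReal_add (by norm_num) (by norm_num)]
    norm_num
    rw [← h3]
    refine add_le_add_left (h2.trans (le_of_eq (by norm_num))) _
  exact (ENNReal.add_le_add_iff_left ENNReal.ofReal_ne_top).1 h5

lemma exists_repetitions : ∃ r : ℕ, (1 - successProb) ^ r ≤ ENNReal.ofReal (1 / 3) := by
  have h : 1 - successProb < 1 := by
    refine ENNReal.sub_lt_self ENNReal.one_ne_top one_ne_zero ?_
    simp [successProb, ENNReal.div_eq_zero_iff]
  obtain ⟨r, hr⟩ := ((ENNReal.tendsto_pow_atTop_nhds_zero_of_lt_one h).eventually_le_const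
    (u := ENNReal.ofReal (1 / 3)) (by simp)).exists
  exact ⟨r, hr⟩

/-- The assumptions of the theorem imply the relations between the parameters, if `n` is large. -/
lemma regime_of_bounds {n s t h ℓ : ℕ} {A c ε Λ : ℝ} (hA : A = (n : ℝ) ^ (1 / 3 : ℝ))
    (hn : 8 ≤ n) (hc : 0 < c) (hε : 0 < ε) (hε1 : ε ≤ 1) (hΛ : 1 ≤ Λ) (hcΛ : 2 ≤ c * Λ ^ 2)
    (ht : 1 ≤ t) (hts : t ≤ s) (hℓ : ℓ ≤ Nat.log 2 n)
    (hlarge : (n : ℝ) ^ (2 / 3 : ℝ) ≤ (2 : ℝ) ^ ℓ / 2 ^ t)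
    (hsize : c * (ε ^ 2 / Λ ^ 11) ≤ 2 ^ ℓ / 2 ^ h)
    (hscore : (2 : ℝ) ^ s / 2 ^ h ≤ ε ^ 2 / Λ ^ 13 * (A / 2 ^ ℓ)) :
    Regime n (rootExp n) s t h ℓ A := by
  have hnR : (0 : ℝ) < n := by exact_mod_cast (by omega : 0 < n)
  have hA2 : (n : ℝ) ^ (2 / 3 : ℝ) = A ^ 2 := by
    rw [hA, ← Real.rpow_natCast, ← Real.rpow_mul hnR.le]; norm_num
  have hA3 : A ^ 3 = n := by
    rw [hA, ← Real.rpow_natCast, ← Real.rpow_mul hnR.le]; norm_num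
  have hA0 : 0 ≤ A := by rw [hA]; positivity
  have hA8 : 2 ≤ A := by
    refine le_of_pow_le_pow_left₀ (n := 3) (by norm_num) hA0 ?_
    rw [hA3]
    norm_num
    exact_mod_cast hn
  obtain ⟨hu1, hu2⟩ := rootExp_spec (by omega) hA3 hA0
  have hpn : (2 : ℝ) ^ ℓ ≤ n := by
    exact_mod_cast (Nat.pow_le_pow_right (by norm_num) hℓ).trans (Nat.pow_log_le_self 2 (by omega))
  have hsq : A ^ 2 * 2 ^ t ≤ 2 ^ ℓ := by
    rw [hA2, le_div_iff₀ (by positivity)] at hlarge; exact hlarge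
  have h2 : (1 : ℝ) < 2 := by norm_num
  have hΛ0 : 0 < Λ := by linarith
  -- the score is at most the influence, which is small
  have hprod : (2 : ℝ) ^ (ℓ + s) ≤ 2 ^ h * (ε ^ 2 / Λ ^ 13 * A) := by
    rw [div_le_iff₀ (by positivity)] at hscore
    calc (2 : ℝ) ^ (ℓ + s) = 2 ^ ℓ * 2 ^ s := pow_add _ _ _
      _ ≤ 2 ^ ℓ * (ε ^ 2 / Λ ^ 13 * (A / 2 ^ ℓ) * 2 ^ h) := by gcongr
      _ = _ := by field_simp
  have hle : ε ^ 2 / Λ ^ 13 ≤ 1 :=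
    div_le_one_of_le₀ ((pow_le_one₀ hε.le hε1).trans (one_le_pow₀ hΛ)) (by positivity)
  have hsA : c * Λ ^ 2 * 2 ^ s ≤ A := by
    rw [le_div_iff₀ (by positivity)] at hsize
    have h3 : c * (ε ^ 2 / Λ ^ 11) * 2 ^ s * 2 ^ h ≤ (ε ^ 2 / Λ ^ 13 * A) * 2 ^ h := by
      calc c * (ε ^ 2 / Λ ^ 11) * 2 ^ s * 2 ^ h = c * (ε ^ 2 / Λ ^ 11) * 2 ^ h * 2 ^ s := by ring
        _ ≤ 2 ^ ℓ * 2 ^ s := by gcongr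
        _ = 2 ^ (ℓ + s) := (pow_add _ _ _).symm
        _ ≤ _ := by rw [mul_comm _ ((2 : ℝ) ^ h)]; exact hprod
    have h4 := le_of_mul_le_mul_right h3 (by positivity)
    have h5 : (0 : ℝ) < ε ^ 2 / Λ ^ 13 := by positivity
    refine le_of_mul_le_mul_left ?_ h5
    calc ε ^ 2 / Λ ^ 13 * (c * Λ ^ 2 * 2 ^ s) = c * (ε ^ 2 / Λ ^ 11) * 2 ^ s := by field_simp
      _ ≤ _ := h4
  refine ⟨hA3, hA8, hu1, hu2, ht, hts, ?_, ?_, ?_, ?_, hsq, hpn⟩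
  · have : (2 : ℝ) ^ (s + 1) ≤ 2 ^ rootExp n := by
      refine le_trans ?_ (hsA.trans hu1)
      rw [pow_succ, mul_comm]
      gcongr
    exact (pow_le_pow_iff_right₀ h2).1 this
  · have : (2 : ℝ) ^ (t + 2 * rootExp n) < 2 ^ (ℓ + 2) := by
      calc (2 : ℝ) ^ (t + 2 * rootExp n) = (2 ^ rootExp n) ^ 2 * 2 ^ t := by
            rw [← pow_mul, ← pow_add]; congr 1; ring
        _ < (2 * A) ^ 2 * 2 ^ t := by
            have := pow_lt_pow_left₀ hu2 (by positivity) (n := 2) (by norm_num)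
            gcongr
        _ = 4 * (A ^ 2 * 2 ^ t) := by ring
        _ ≤ 4 * 2 ^ ℓ := by gcongr
        _ = 2 ^ (ℓ + 2) := by rw [pow_add]; ring
    have := (pow_lt_pow_iff_right₀ h2).1 this
    omega
  · have : (2 : ℝ) ^ ℓ ≤ 2 ^ (3 * rootExp n) := by
      rw [mul_comm, pow_mul]
      exact hpn.trans (hA3 ▸ pow_le_pow_left₀ hA0 hu1 3)
    exact (pow_le_pow_iff_right₀ h2).1 this
  · have : (2 : ℝ) ^ (ℓ + s) ≤ 2 ^ (h + rootExp n) := by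
      rw [pow_add _ h]
      refine hprod.trans ?_
      gcongr
      exact (mul_le_of_le_one_left hA0 hle).trans hu1
    exact (pow_le_pow_iff_right₀ h2).1 this

/-- For large `n`, repeated attempts find a violation whenever the parameters can occur; otherwise
there is nothing to show. -/
lemma exists_algorithm_of_large {c : ℝ} (hc : 0 < c) {R : ℕ}
    (hR : (1 - successProb) ^ R ≤ ENNReal.ofReal (1 / 3)) {n : ℕ} {ε : ℝ} (hε : 0 < ε)
    (hε1 : ε ≤ 1) (hL : 96 ≤ Real.logb 2 n) (hcL : 1 ≤ c * Real.logb 2 n) {s t h ℓ : ℕ}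
    (ht : 1 ≤ t) (hts : t ≤ s) (hs : s ≤ Lam n ε) (hℓ : ℓ ≤ Nat.log 2 n)
    (hlarge : (n : ℝ) ^ (2 / 3 : ℝ) ≤ (2 : ℝ) ^ ℓ / 2 ^ t) :
    ∃ A : QueryAlg n (Option (Fin n × Cube n × Cube n)),
      (∃ q : ℕ, A.QueriesAtMost q ∧ (q : ℝ) ≤ R * (32 + 2 ^ 11 * 3 ^ 11 / c) *
        ((n : ℝ) ^ (2 / 3 : ℝ) / ε ^ 2) * Real.logb 2 (n / ε) ^ 12) ∧
      ∀ (f : Cube n → Bool) (I : Finset (Fin n)),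
        I.card = 2 ^ ℓ → ScoreSummary c ε f s t h I → HalfLowInfluence ε f I →
        2 / 3 ≤ prob (A.law f) {out | ∃ v, out = some v ∧ IsEdgeViolation f v} := by
  have hn : 8 ≤ n := by
    by_contra hcon
    have h1 : (n : ℝ) < 2 ^ (96 : ℝ) := by
      have : (n : ℝ) ≤ 8 := by exact_mod_cast (by omega : n ≤ 8)
      refine this.trans_lt ?_
      norm_num
    rcases Nat.eq_zero_or_pos n with h0 | h0
    · rw [h0] at hL; norm_num at hL
    · have := (Real.logb_lt_iff_lt_rpow (b := 2) (by norm_num)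
        (by exact_mod_cast h0 : (0 : ℝ) < n)).2 h1
      linarith
  have hn0 : 0 < n := by omega
  have hΛ := two_mul_logb_le_Lam hn0 hε hε1
  have hW := logb_le_logb_div hn0 hε hε1
  have hnR : (0 : ℝ) < n := by exact_mod_cast hn0
  by_cases hpar : c * (ε ^ 2 / (Lam n ε : ℝ) ^ 11) ≤ 2 ^ ℓ / 2 ^ h ∧
      (2 : ℝ) ^ s / 2 ^ h ≤ ε ^ 2 / (Lam n ε : ℝ) ^ 13 * ((n : ℝ) ^ (1 / 3 : ℝ) / 2 ^ ℓ)
  · obtain ⟨hsize, hscore⟩ := hpar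
    have H := regime_of_bounds rfl hn hc hε hε1 (by linarith)
      (by nlinarith [mul_le_mul_of_nonneg_left hΛ hc.le]) ht hts hℓ hlarge hsize hscore
    obtain ⟨q, hq, hqle⟩ := exists_queriesAtMost_search H hL hc hε hε1 hsize
    refine ⟨(search n s t h ℓ).firstSome R, ⟨R * q, QueryAlg.queriesAtMost_firstSome hq R, ?_⟩, ?_⟩
    · have hA2 : (n : ℝ) ^ (2 / 3 : ℝ) = ((n : ℝ) ^ (1 / 3 : ℝ)) ^ 2 := by
        rw [← Real.rpow_natCast, ← Real.rpow_mul hnR.le]; norm_num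
      rw [hA2, Nat.cast_mul, mul_assoc, mul_assoc]
      rw [mul_assoc] at hqle
      exact mul_le_mul_of_nonneg_left hqle (by positivity)
    · intro f I hI hsum hlow
      classical
      refine two_thirds_le_prob_firstSome hR (attempt_sound f _ _ _ _ _ _ _ _) ?_
      unfold HalfLowInfluence at hlow
      rw [hI] at hlow
      refine successProb_le_ex_search rfl H hL hε hε1 hs (hlow.trans (le_of_eq ?_)) ?_ ?_
        (I := I.filter fun i => influence f i ≤ ε ^ 2 / (Lam n ε : ℝ) ^ 13 *
          ((n : ℝ) ^ (1 / 3 : ℝ) / (2 ^ ℓ : ℕ)))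
      · congr!
      · exact fun i hi => le_min_iff.1 (hsum.2 i (Finset.mem_filter.1 hi).1)
      · intro i hi
        simpa using (Finset.mem_filter.1 hi).2
  · refine ⟨QueryAlg.ret none, ⟨0, trivial, ?_⟩, fun f I hI hsum hlow => (hpar ?_).elim⟩
    · rw [Nat.cast_zero]
      have : 0 ≤ Real.logb 2 (n / ε) := by linarith
      positivity
    · classical
      unfold HalfLowInfluence at hlow
      rw [hI] at hlow
      obtain ⟨i, hi⟩ : (I.filter fun i => influence f i ≤ ε ^ 2 / (Lam n ε : ℝ) ^ 13 *
          ((n : ℝ) ^ (1 / 3 : ℝ) / (2 ^ ℓ : ℕ))).Nonempty := by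
        rw [← Finset.card_pos]
        have h2 : 0 < 2 ^ ℓ := by positivity
        convert (Nat.mul_pos_iff_of_pos_left (by norm_num)).1 (h2.trans_le hlow)
      obtain ⟨hi, hinf⟩ := Finset.mem_filter.1 hi
      refine ⟨by simpa [hI] using hsum.1, ?_⟩
      have h1 := (le_min_iff.1 (hsum.2 i hi)).1
      calc (2 : ℝ) ^ s / 2 ^ h = 2 ^ s * (1 / 2 ^ h) := by ring
        _ ≤ 2 ^ s * (scorePlus ε f i s * (1 / 2 ^ s)) := by gcongr
        _ = scorePlus ε f i s := by field_simp
        _ ≤ influence f i := scorePlus_le_influence ε f i s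
        _ ≤ _ := by simpa using hinf

end

theorem lemma5p1 :
    ∃ k : ℕ, ∀ c : ℝ, 0 < c → ∃ C : ℝ, 0 < C ∧
      ∀ (n : ℕ) (ε : ℝ), 0 < ε → ε ≤ 1 →
      ∀ s t h ℓ : ℕ, 1 ≤ t → t ≤ s → s ≤ Lam n ε → 1 ≤ h → h ≤ 3 * Lam n ε →
        1 ≤ ℓ → ℓ ≤ Nat.log 2 n → (n : ℝ) ^ (2 / 3 : ℝ) ≤ (2 : ℝ) ^ ℓ / 2 ^ t →
      ∃ A : QueryAlg n (Option (Fin n × Cube n × Cube n)),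
        (∃ q : ℕ, A.QueriesAtMost q ∧
          (q : ℝ) ≤ C * ((n : ℝ) ^ (2 / 3 : ℝ) / ε ^ 2) * Real.logb 2 (n / ε) ^ k) ∧
        ∀ (f : Cube n → Bool) (I : Finset (Fin n)),
          I.card = 2 ^ ℓ → ScoreSummary c ε f s t h I → HalfLowInfluence ε f I →
          2 / 3 ≤ prob (A.law f) {out | ∃ v, out = some v ∧ IsEdgeViolation f v} := by
  obtain ⟨R, hR⟩ := exists_repetitions
  refine ⟨12, fun c hc => ?_⟩
  obtain ⟨n₀, hn₀⟩ : ∃ n₀ : ℕ, (2 : ℝ) ^ (96 + 1 / c) ≤ n₀ := exists_nat_ge _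
  refine ⟨R * (32 + 2 ^ 11 * 3 ^ 11 / c) + 2 ^ n₀, by positivity, ?_⟩
  intro n ε hε hε1 s t h ℓ ht hts hs _ _ hℓ1 hℓ hlarge
  have hn2 : 2 ≤ n := by
    by_contra hcon
    rw [Nat.log_of_lt (by omega)] at hℓ
    omega
  have hnR : (2 : ℝ) ≤ n := by exact_mod_cast hn2
  have hL1 : 1 ≤ Real.logb 2 n := by
    rw [Real.le_logb_iff_rpow_le (by norm_num) (by linarith), Real.rpow_one]; exact hnR
  have hW1 : 1 ≤ Real.logb 2 (n / ε) := hL1.trans (logb_le_logb_div (by omega) hε hε1)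
  have hX : 1 ≤ (n : ℝ) ^ (2 / 3 : ℝ) / ε ^ 2 := by
    rw [one_le_div (by positivity)]
    exact (pow_le_one₀ hε.le hε1).trans (Real.one_le_rpow (by linarith) (by norm_num))
  have hW12 : 1 ≤ Real.logb 2 (n / ε) ^ 12 := one_le_pow₀ hW1
  rcases le_total n₀ n with hn | hn
  · have hL : 96 + 1 / c ≤ Real.logb 2 n := by
      rw [Real.le_logb_iff_rpow_le (by norm_num) (by linarith)]
      exact hn₀.trans (by exact_mod_cast hn)
    have hc' : 0 < 1 / c := by positivity
    have hcL : 1 ≤ c * Real.logb 2 n := by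
      rw [← div_le_iff₀' hc]; linarith
    obtain ⟨A, ⟨q, hq, hqle⟩, hA⟩ := exists_algorithm_of_large hc hR hε hε1 (by linarith) hcL
      ht hts hs hℓ hlarge (h := h)
    refine ⟨A, ⟨q, hq, hqle.trans ?_⟩, hA⟩
    gcongr
    exact le_add_of_nonneg_right (by positivity)
  · refine ⟨queryAll n, ⟨2 ^ n, queriesAtMost_queryAll n, ?_⟩, fun f I hI hsum _ => ?_⟩
    · have h1 : (2 : ℝ) ^ n ≤ 2 ^ n₀ := pow_le_pow_right₀ (by norm_num) hn
      rw [Nat.cast_pow, Nat.cast_ofNat]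
      refine h1.trans ?_
      have h2 : (2 : ℝ) ^ n₀ ≤ R * (32 + 2 ^ 11 * 3 ^ 11 / c) + 2 ^ n₀ :=
        le_add_of_nonneg_left (by positivity)
      rw [mul_assoc]
      exact h2.trans (le_mul_of_one_le_right (by positivity)
        (one_le_mul_of_one_le_of_one_le hX hW12))
    · rw [prob_queryAll (exists_violation (Finset.card_pos.1 (hI ▸ by positivity)) hsum)]
      norm_num
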